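/- Setting. Let $d\ge 3$, $\Lambda=\mathbb R^d/\mathbb Z^d$, $\mathbb D=\Lambda\times\mathbb R^d$, $0<\varepsilon<\tfrac12$, and $\mathcal D^n_\varepsilon=\{(x_1,v_1,\dots,x_n,v_n)\in\mathbb D^n:\ |x_i-x_j|>\varepsilon \text{ for } i<j\}$, with Lebesgue measure. In the hard sphere dynamics, particles move along straight lines, and when $|x_q-x_{q'}|=\varepsilon$ they scatter: $v_q\mapsto v_q-\big(\nu\cdot(v_q-v_{q'})\big)\nu$, $v_{q'}\mapsto v_{q'}+\big(\nu\cdot(v_q-v_{q'})\big)\nu$, where $\nu=(x_{q'}-x_q)/|x_{q'}-x_q|$. Let $\mathbf Z_N(t)=(\mathbf z_1(t),\dots,\mathbf z_N(t))$ be the configuration at time $t$ in the dynamics started from $\mathbf Z_N(0)\in\mathcal D^N_\varepsilon$; for a family $\underline i_n=(i_1,\dots,i_n)$ of pairwise distinct particles of $\{1,\dots,N\}$ put $\mathbf Z_{\underline i_n}=(\mathbf z_{i_1},\dots,\mathbf z_{i_n})$. Pseudotrajectories. Let $m\le n$ and fix parameters $(s_i,\bar s_i)_{1\le i\le n-m}\in(\{\pm1\}^2)^{n-m}$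 and $(\kappa_j)_{1\le j\le n}\in\mathbb N^n$, where $0\in\mathbb N$. The pseudotrajectory $\mathrm Z_n(\tau)$ starts at $\mathrm Z_n(0)=Z_n\in\mathcal D^n_\varepsilon$, with $\iota(0)=1$ and $\kappa_j(0)=\kappa_j$. The remaining particles move freely between collisions. At a collision of two remaining particles $q<q'$: * if $\iota\le n-m$, let $p=q$ if $s_\iota=1$ and $p=q'$ if $s_\iota=-1$. If $\kappa_p>0$, then $q$ and $q'$ scatter and $\kappa_p$ decreases by $1$ (recollision). If $\kappa_p=0$, then $p$ is removed, the other particle gets its scattered velocity if $\bar s_\iota=1$ and continues in a straight line if $\bar s_\iota=-1$, and $\iota$ increases by $1$ (annihilation); * if $\iota=n-m+1$, then $q$ and $q'$ scatter. Let $\mathcal R^{m\leftarrow n,t}_{((s_i,\bar s_i),(\kappa_j))}\subset\mathcal D^n_\varepsilon$ be the set of initial data $Z_n$ for which, at time $t$, the remaining particles are exactly $1,\dots,m$ and $\kappa_j(t)=0$ for all $j\in\{1,\dots,n\}$. For $h_m:\mathbb D^m\to\mathbb R$ let $$\Phi^t_{m\leftarrow n}[h_m](Z_n)=\frac1{(n-m)!}\sum_{(s_i,\bar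 s_i)_i,\,(\kappa_j)_j}\Big(\prod_{i=1}^{n-m}\bar s_i\Big)\mathbf 1_{\mathcal R^{m\leftarrow n,t}_{((s_i,\bar s_i),(\kappa_j))}}(Z_n)\;h_m(\mathrm Z_n(t)),$$ where $h_m(\mathrm Z_n(t))$ is $h_m$ evaluated at the remaining particles $1,\dots,m$ of the pseudotrajectory with these parameters. Theorem. Let $t>0$, $m\ge0$, $h_m\in L^\infty(\mathbb D^m)$ (not necessarily symmetric) and $N\ge 0$. 1. For almost every $\mathbf Z_N(0)\in\mathcal D^N_\varepsilon$, the hard sphere dynamics is well defined up to time $t$ (with finitely many collisions, all binary and at distinct times); for every $n\ge m$ and every family $\underline i_n$ of pairwise distinct particles, the same is true of the pseudotrajectories started from $\mathbf Z_{\underline i_n}(0)$, for all parameters, and only finitely many parameters contribute to $\Phi^t_{m\leftarrow n}[h_m](\mathbf Z_{\underline i_n}(0))$. 2. For every family $(i_1,\dots,i_m)$ of pairwise distinct particles of $\{1,\dots,N\}$ and for almost every $\mathbf Z_N(0)\in\mathcal D^N_\varepsilon$, $$h_m\big(\mathbf Z_{\underline i_m}(t)\big)=\sum_{n\ge m}\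 \sum_{(i_{m+1},\dots,i_n)}\Phi^t_{m\leftarrow n}[h_m]\big(\mathbf Z_{\underline i_n}(0)\big),$$ where the inner sum runs over all $(i_{m+1},\dots,i_n)$ for which $i_1,\dots,i_n$ are pairwise distinct particles of $\{1,\dots,N\}$. 3. For almost every $\mathbf Z_N(0)\in\mathcal D^N_\varepsilon$, $$\sum_{\underline i_m}h_m\big(\mathbf Z_{\underline i_m}(t)\big)=\sum_{n\ge m}\ \sum_{\underline i_n}\Phi^t_{m\leftarrow n}[h_m]\big(\mathbf Z_{\underline i_n}(0)\big),$$ where $\underline i_m$ and $\underline i_n$ run over all families of $m$, respectively $n$, pairwise distinct particles of $\{1,\dots,N\}$. -/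

import Mathlib

open MeasureTheory

namespace HardSpheres

/-- The torus `ℝ^d / ℤ^d`. -/
abbrev Torus (d : ℕ) : Type := Fin d → UnitAddCircle

/-- The one-particle phase space: (position on the torus, velocity in `ℝ^d`). -/
abbrev Phase (d : ℕ) : Type := Torus d × EuclideanSpace ℝ (Fin d)

/-- The vector `y - x`: the representative of the class `y - x` with coordinates in `(-1/2, 1/2]`,
which is a shortest one. -/
noncomputable def disp {d : ℕ} (x y : Torus d) : EuclideanSpace ℝ (Fin d) :=
  WithLp.toLp 2 fun k => ((AddCircle.equivIoc (1 : ℝ) (-1 / 2) (y k - x k) : _) : ℝ)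

/-- The Euclidean distance `|x - y|` on the torus. -/
noncomputable def torusDist {d : ℕ} (x y : Torus d) : ℝ := ‖disp x y‖

/-- The `n`-particle phase space of hard spheres of diameter `ε`. -/
def domain (d : ℕ) (ε : ℝ) (n : ℕ) : Set (Fin n → Phase d) :=
  {Z | ∀ i j : Fin n, i < j → ε < torusDist (Z i).1 (Z j).1}

/-- Free transport of all particles during a time `u`. -/
noncomputable def freeFlight {d n : ℕ} (u : ℝ) (Z : Fin n → Phase d) : Fin n → Phase d :=
  fun i => (fun k => (Z i).1 k + ((u * (Z i).2 k : ℝ) : UnitAddCircle), (Z i).2)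

/-- Elastic scattering of the particles `q` and `q'`, along the unit vector
`(x_{q'} - x_q) / |x_{q'} - x_q|`. -/
noncomputable def scatter {d n : ℕ} (q q' : Fin n) (Z : Fin n → Phase d) : Fin n → Phase d :=
  let ν : EuclideanSpace ℝ (Fin d) :=
    (torusDist (Z q).1 (Z q').1)⁻¹ • disp (Z q).1 (Z q').1
  let w : EuclideanSpace ℝ (Fin d) := inner ℝ ν ((Z q).2 - (Z q').2) • ν
  fun i => if i = q then ((Z q).1, (Z q).2 - w)
    else if i = q' then ((Z q').1, (Z q').2 + w)
    else Z i

/-- No two particles of `A` overlap or are in contact. -/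
def Separated {d n : ℕ} (ε : ℝ) (A : Finset (Fin n)) (Z : Fin n → Phase d) : Prop :=
  ∀ i ∈ A, ∀ j ∈ A, i < j → ε < torusDist (Z i).1 (Z j).1

/-- Among the particles of `A`, the pair `q < q'` is in contact, and it is the only such pair. -/
def Contact {d n : ℕ} (ε : ℝ) (A : Finset (Fin n)) (q q' : Fin n) (Z : Fin n → Phase d) : Prop :=
  q ∈ A ∧ q' ∈ A ∧ q < q' ∧ torusDist (Z q).1 (Z q').1 = ε ∧
    ∀ i ∈ A, ∀ j ∈ A, i < j → (i, j) ≠ (q, q') → ε < torusDist (Z i).1 (Z j).1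

/-- The hard sphere dynamics: `HardSphereEvolves ε Z t Z'` says that, starting from `Z`, the
particles move along straight lines and scatter at their binary collisions, that there are finitely
many of these in `(0, t]` at distinct times, and that the configuration at time `t` is `Z'`. -/
inductive HardSphereEvolves {d n : ℕ} (ε : ℝ) :
    (Fin n → Phase d) → ℝ → (Fin n → Phase d) → Prop
  | free (Z : Fin n → Phase d) (t : ℝ) (ht : 0 ≤ t)
      (h : ∀ u ∈ Set.Ioc 0 t, Separated ε Finset.univ (freeFlight u Z)) :
      HardSphereEvolves ε Z t (freeFlight t Z)
  | collision (Z : Fin n → Phase d) (t τ : ℝ) (q q' : Fin n) (Z' : Fin n → Phase d)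
      (hτ : 0 < τ) (hτt : τ ≤ t)
      (h : ∀ u ∈ Set.Ioo 0 τ, Separated ε Finset.univ (freeFlight u Z))
      (hc : Contact ε Finset.univ q q' (freeFlight τ Z))
      (hrest : HardSphereEvolves ε (scatter q q' (freeFlight τ Z)) (t - τ) Z') :
      HardSphereEvolves ε Z t Z'

open Classical in
/-- The hard sphere flow; it has a meaning where `HardSphereEvolves ε Z t` is satisfiable. -/
noncomputable def flow {d n : ℕ} (ε t : ℝ) (Z : Fin n → Phase d) : Fin n → Phase d :=
  if h : ∃ Z', HardSphereEvolves ε Z t Z' then h.choose else Z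

/-- The state of a pseudotrajectory: the set of remaining particles, the phase space coordinates
(those of removed particles play no role), the number `iota` of annihilations that have been
performed, and the current recollision indices. -/
structure State (d n : ℕ) where
  alive : Finset (Fin n)
  z : Fin n → Phase d
  iota : ℕ
  kappa : Fin n → ℕ

/-- Free transport of a state. -/
noncomputable def State.free {d n : ℕ} (S : State d n) (u : ℝ) : State d n :=
  { S with z := freeFlight u S.z }

/-- What happens in a pseudotrajectory at a collision of `q < q'`, when `r` is the total number of
annihilations to be performed and `σ i = (s_i, s̄_i)`. While some annihilation has still to be
performed, the sign `s` of the next one selects the particle `p`, which is `q` if `s = 1` and `q'`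
if `s = -1`. If the recollision index of `p` is positive, the two particles scatter and this index
decreases by one. Otherwise `p` is removed, and the other particle is scattered if `s̄ = 1` and
continues on its straight line if `s̄ = -1`. After the last annihilation all collisions are elastic
scatterings. -/
noncomputable def State.collide {d n r : ℕ} (σ : Fin r → ℤˣ × ℤˣ) (q q' : Fin n)
    (S : State d n) : State d n :=
  if h : S.iota < r then
    let p : Fin n := if (σ ⟨S.iota, h⟩).1 = 1 then q else q'
    if 0 < S.kappa p then
      { S with
        z := scatter q q' S.z
        kappa := Function.update S.kappa p (S.kappa p - 1) }
    else
      { S with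
        alive := S.alive.erase p
        z := if (σ ⟨S.iota, h⟩).2 = 1 then scatter q q' S.z else S.z
        iota := S.iota + 1 }
  else
    { S with z := scatter q q' S.z }

/-- The pseudotrajectory dynamics: starting from the state `S`, the state after a time `t` is
`S'`. -/
inductive PseudoEvolves {d n r : ℕ} (ε : ℝ) (σ : Fin r → ℤˣ × ℤˣ) :
    State d n → ℝ → State d n → Prop
  | free (S : State d n) (t : ℝ) (ht : 0 ≤ t)
      (h : ∀ u ∈ Set.Ioc 0 t, Separated ε S.alive (freeFlight u S.z)) :
      PseudoEvolves ε σ S t (S.free t)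
  | collision (S : State d n) (t τ : ℝ) (q q' : Fin n) (S' : State d n)
      (hτ : 0 < τ) (hτt : τ ≤ t)
      (h : ∀ u ∈ Set.Ioo 0 τ, Separated ε S.alive (freeFlight u S.z))
      (hc : Contact ε S.alive q q' (freeFlight τ S.z))
      (hrest : PseudoEvolves ε σ ((S.free τ).collide σ q q') (t - τ) S') :
      PseudoEvolves ε σ S t S'

/-- The pseudotrajectory parameters `((s_i, s̄_i)_{i ≤ r}, (κ_j)_{j ≤ n})`, where `r = n - m`. -/
abbrev Params (r n : ℕ) : Type := (Fin r → ℤˣ × ℤˣ) × (Fin n → ℕ)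

/-- The initial state: all particles are present and no annihilation has been performed. -/
def initState {d n : ℕ} (κ : Fin n → ℕ) (Z : Fin n → Phase d) : State d n where
  alive := Finset.univ
  z := Z
  iota := 0
  kappa := κ

open Classical in
/-- The state at time `t` of the pseudotrajectory with parameters `p` that starts from `Z`; it has a
meaning where this pseudotrajectory exists up to time `t`. -/
noncomputable def pseudoState {d n r : ℕ} (ε t : ℝ) (p : Params r n) (Z : Fin n → Phase d) :
    State d n :=
  if h : ∃ S, PseudoEvolves ε p.1 (initState p.2 Z) t S then h.choose else initState p.2 Z

/-- The set of initial configurations of `n = m + r` hard spheres such that, at time `t`, the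
remaining particles of the pseudotrajectory with parameters `p` are the first `m` ones and all
recollision indices vanish. -/
def admissible {d : ℕ} (m r : ℕ) (ε t : ℝ) (p : Params r (m + r)) :
    Set (Fin (m + r) → Phase d) :=
  {Z | Z ∈ domain d ε (m + r) ∧
    (∃ S, PseudoEvolves ε p.1 (initState p.2 Z) t S) ∧
    (∀ j : Fin (m + r), j ∈ (pseudoState ε t p Z).alive ↔ (j : ℕ) < m) ∧
    ∀ j, (pseudoState ε t p Z).kappa j = 0}

/-- The pseudotrajectory development `Φ^t_{m ← m + r}`. -/
noncomputable def development {d : ℕ} (m r : ℕ) (ε t : ℝ) (h : (Fin m → Phase d) → ℝ)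
    (Z : Fin (m + r) → Phase d) : ℝ :=
  (1 / (r.factorial : ℝ)) * ∑' p : Params r (m + r),
    (∏ i, (((p.1 i).2 : ℤ) : ℝ)) *
      (admissible m r ε t p).indicator
        (fun Y => h fun k => (pseudoState ε t p Y).z (Fin.castAdd r k)) Z

/-- The families `(i_1, …, i_{m+r})` of pairwise distinct particles among `N` that extend a given
family `(i_1, …, i_m)`. -/
noncomputable def extensions {m N : ℕ} (i : Fin m ↪ Fin N) (r : ℕ) : Finset (Fin (m + r) ↪ Fin N) :=
  Finset.univ.filter fun j => ∀ k : Fin m, j (Fin.castAdd r k) = i k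

lemma no_contact {d n : ℕ} {ε : ℝ} {A : Finset (Fin n)} {q q' : Fin n} {Z : Fin n → Phase d}
    (hc : Contact ε A q q' Z) : ¬ Separated ε A Z := fun hs =>
  absurd hc.2.2.2.1 (hs q hc.1 q' hc.2.1 hc.2.2.1).ne'

lemma contact_unique {d n : ℕ} {ε : ℝ} {A : Finset (Fin n)} {q q' p p' : Fin n}
    {Z : Fin n → Phase d} (hc : Contact ε A q q' Z) (hc' : Contact ε A p p' Z) :
    q = p ∧ q' = p' := by
  by_contra hne
  have h := hc'.2.2.2.2 q hc.1 q' hc.2.1 hc.2.2.1 (by simpa using hne)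
  exact absurd hc.2.2.2.1 h.ne'

/-- The hard sphere dynamics is deterministic. -/
theorem HardSphereEvolves.unique {d n : ℕ} {ε t : ℝ} {Z Z₁ Z₂ : Fin n → Phase d}
    (h₁ : HardSphereEvolves ε Z t Z₁) (h₂ : HardSphereEvolves ε Z t Z₂) : Z₁ = Z₂ := by
  induction h₁ with
  | free Z t ht h =>
    cases h₂ with
    | free _ _ _ _ => rfl
    | collision _ _ τ q q' _ hτ hτt _ hc _ => exact absurd (h τ ⟨hτ, hτt⟩) (no_contact hc)
  | collision Z t τ q q' Z' hτ hτt h hc _ ih =>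
    cases h₂ with
    | free _ _ _ h' => exact absurd (h' τ ⟨hτ, hτt⟩) (no_contact hc)
    | collision _ _ τ' p p' _ hτ' _ h' hc' hrest' =>
      obtain hlt | rfl | hgt := lt_trichotomy τ τ'
      · exact absurd (h' τ ⟨hτ, hlt⟩) (no_contact hc)
      · obtain ⟨rfl, rfl⟩ := contact_unique hc hc'
        exact ih hrest'
      · exact absurd (h τ' ⟨hτ', hgt⟩) (no_contact hc')

/-- The pseudotrajectory dynamics is deterministic. -/
theorem PseudoEvolves.unique {d n r : ℕ} {ε t : ℝ} {σ : Fin r → ℤˣ × ℤˣ} {S S₁ S₂ : State d n}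
    (h₁ : PseudoEvolves ε σ S t S₁) (h₂ : PseudoEvolves ε σ S t S₂) : S₁ = S₂ := by
  induction h₁ with
  | free S t ht h =>
    cases h₂ with
    | free _ _ _ _ => rfl
    | collision _ _ τ q q' _ hτ hτt _ hc _ => exact absurd (h τ ⟨hτ, hτt⟩) (no_contact hc)
  | collision S t τ q q' S' hτ hτt h hc _ ih =>
    cases h₂ with
    | free _ _ _ h' => exact absurd (h' τ ⟨hτ, hτt⟩) (no_contact hc)
    | collision _ _ τ' p p' _ hτ' _ h' hc' hrest' =>
      obtain hlt | rfl | hgt := lt_trichotomy τ τ'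
      · exact absurd (h' τ ⟨hτ, hlt⟩) (no_contact hc)
      · obtain ⟨rfl, rfl⟩ := contact_unique hc hc'
        exact ih hrest'
      · exact absurd (h τ' ⟨hτ', hgt⟩) (no_contact hc')

end HardSpheres

/-! The proof has a deterministic half and a measure-theoretic half, and `Tame` is the interface
between them. A datum is tame for a set of particles if every branch of its collision tree exists up
to time `t`, where each collision may scatter both particles, or remove one of them with or without
scattering the other. This tree contains all pseudotrajectories for all parameters and also the
elastic trajectories of all subsystems.

Deterministic half. Write `C_A` for the alternating sum, over the sets `B` with `M ⊆ B ⊆ A`, of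
`(-1)^(|A|+|B|)` times the value of `h` along the elastic flow in which only `B` interacts. At the
first collision `q, q'` in `A`, the sets `B` that contain both particles scatter and all the others
go straight on. Comparing coefficients, `C_A` before the collision equals `C_A` after scattering,
plus, for each `p` in `{q, q'}`, the difference of `C_{A \ p}` with and without scattering
(`cumulant_collision`). The signed parameter sum obeys the same recursion: `s` chooses `p`, `s̄`
gives the two signed terms, and the sum over `κ_p` splits into `κ_p > 0` (scatter, then shift the
index) and `κ_p = 0` (remove); see `recollisionSum_collision`. Both sides vanish if the motion is
free while annihilations are still due, so they agree along the whole tree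
(`signedSum_eq_cumulant`). The development is thus `1/r!` times a cumulant. The factor `1/r!`
cancels the orderings of the added particles, and summing `C_B` over all `B ⊇ M` is Möbius
inversion, which leaves the flow of the full system (`sum_cumulant`).

Measure-theoretic half. Almost every datum is tame for every set of particles, by Alexander's
argument. Cut `[0, t]` into `k` steps of length `δ = t / k` at bounded energy. Apart from a set of
volume `O(δ²)`, where two different pairs are close to contact (`exists_volume_irregular_le`), a
step has at most one collision, and pulling a set back along a step does not increase its volume
(`volume_step_le`), because scattering has Jacobian `±1` (`Impacting.exists_hasFDerivAt`). The total
loss is `k · O(t² / k²)`, which tends to `0`. The branches that remove a particle are covered by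
induction on the set of particles (`volume_not_tame`). -/

namespace HardSpheres

/-! ### Collisions, relabelling, and the elastic dynamics of subsystems. -/

variable {d n N : ℕ} {ε : ℝ}

/-! ### Geometry of the torus -/

/-- The projection of `ℝ^d` onto the torus. -/
noncomputable def toTorus : EuclideanSpace ℝ (Fin d) →+ Torus d where
  toFun v k := (v k : UnitAddCircle)
  map_zero' := by ext k; simp
  map_add' v w := by ext k; simp

lemma toTorus_apply (v : EuclideanSpace ℝ (Fin d)) (k : Fin d) :
    toTorus v k = (v k : UnitAddCircle) := rfl

lemma freeFlight_apply (u : ℝ) (Z : Fin n → Phase d) (i : Fin n) :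
    freeFlight u Z i = ((Z i).1 + toTorus (u • (Z i).2), (Z i).2) := rfl

@[simp] lemma freeFlight_zero (Z : Fin n → Phase d) : freeFlight 0 Z = Z := by
  funext i; simp [freeFlight_apply]

lemma freeFlight_add (u s : ℝ) (Z : Fin n → Phase d) :
    freeFlight u (freeFlight s Z) = freeFlight (u + s) Z := by
  funext i
  simp only [freeFlight_apply, add_smul, map_add]
  ext1
  · dsimp; abel
  · rfl

@[simp] lemma toTorus_disp (x y : Torus d) : toTorus (disp x y) = y - x := by
  funext k
  simp only [toTorus_apply, disp, Pi.sub_apply]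
  exact (AddCircle.equivIoc (1 : ℝ) (-1 / 2)).symm_apply_apply (y k - x k)

lemma disp_mem (x y : Torus d) (k : Fin d) : disp x y k ∈ Set.Ioc (-1 / 2 : ℝ) (1 / 2) := by
  have := ((AddCircle.equivIoc (1 : ℝ) (-1 / 2)) (y k - x k)).2
  simp only [disp]
  exact ⟨this.1, this.2.trans_eq (by norm_num)⟩

lemma disp_eq_of_mem {x y : Torus d} {v : EuclideanSpace ℝ (Fin d)} (h : toTorus v = y - x)
    (hv : ∀ k, v k ∈ Set.Ioc (-1 / 2 : ℝ) (1 / 2)) : disp x y = v := by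
  ext k
  have h1 := congrFun h k
  simp only [toTorus_apply, Pi.sub_apply] at h1
  simp only [disp, ← h1]
  have h2 : v k ∈ Set.Ioc (-1 / 2 : ℝ) (-1 / 2 + 1) := by
    rw [show (-1 / 2 + 1 : ℝ) = 1 / 2 by norm_num]; exact hv k
  exact congrArg Subtype.val ((AddCircle.equivIoc (1 : ℝ) (-1 / 2)).apply_symm_apply ⟨v k, h2⟩)

lemma abs_coord_le (v : EuclideanSpace ℝ (Fin d)) (k : Fin d) : |v k| ≤ ‖v‖ := by
  simpa using PiLp.norm_apply_le v k

lemma disp_eq_of_norm_lt {x y : Torus d} {v : EuclideanSpace ℝ (Fin d)} (h : toTorus v = y - x)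
    (hv : ‖v‖ < 1 / 2) : disp x y = v := by
  refine disp_eq_of_mem h fun k => ?_
  have := abs_lt.1 ((abs_coord_le v k).trans_lt hv)
  constructor <;> linarith

/-- Two lifts differ by integers in each coordinate, and adding a nonzero integer to a number in
`(-1/2, 1/2]` does not decrease its absolute value. -/
lemma torusDist_le {x y : Torus d} {v : EuclideanSpace ℝ (Fin d)} (h : toTorus v = y - x) :
    torusDist x y ≤ ‖v‖ := by
  rw [torusDist, EuclideanSpace.norm_eq, EuclideanSpace.norm_eq]
  refine Real.sqrt_le_sqrt (Finset.sum_le_sum fun k _ => ?_)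
  refine pow_le_pow_left₀ (norm_nonneg _) ?_ 2
  have h1 : ((disp x y k - v k : ℝ) : UnitAddCircle) = 0 := by
    have := congrFun (toTorus_disp x y) k
    have h' := congrFun h k
    rw [toTorus_apply] at this h'
    simp [this, h']
  obtain ⟨z, hz⟩ := (AddCircle.coe_eq_zero_iff (1 : ℝ)).1 h1
  obtain ⟨h2, h3⟩ := disp_mem x y k
  rw [Real.norm_eq_abs, Real.norm_eq_abs]
  simp only [zsmul_eq_mul, mul_one] at hz
  have hv : v k = disp x y k - z := by linarith
  rcases lt_trichotomy z 0 with hz0 | hz0 | hz0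
  · have : (z : ℝ) ≤ -1 := by exact_mod_cast Int.le_sub_one_of_lt hz0
    rw [hv, abs_of_nonneg (a := disp x y k - z) (by linarith), abs_le]
    constructor <;> linarith
  · simp [hv, hz0]
  · have : (1 : ℝ) ≤ z := by exact_mod_cast hz0
    rw [hv, abs_of_nonpos (a := disp x y k - z) (by linarith), abs_le]
    constructor <;> linarith

lemma torusDist_comm (x y : Torus d) : torusDist x y = torusDist y x := by
  have key : ∀ x y : Torus d, torusDist x y ≤ torusDist y x := fun x y => by
    have := torusDist_le (x := x) (y := y) (v := -disp y x) (by simp)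
    rwa [norm_neg] at this
  exact le_antisymm (key _ _) (key _ _)

/-- The bound keeps every coordinate away from `1/2`, the only value at which the half-open choice
of representatives is not antisymmetric. -/
lemma disp_comm {x y : Torus d} (h : torusDist x y < 1 / 2) : disp y x = -disp x y :=
  disp_eq_of_norm_lt (by simp) (by rwa [norm_neg])

lemma torusDist_add_le (x y : Torus d) (a b : EuclideanSpace ℝ (Fin d)) :
    torusDist (x + toTorus a) (y + toTorus b) ≤ torusDist x y + ‖b - a‖ := by
  refine (torusDist_le (v := disp x y + (b - a)) ?_).trans (norm_add_le _ _)
  simp only [map_add, toTorus_disp, map_sub]; abel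

/-! ### Scattering and relabelling -/

lemma scatter_of_ne {q q' a : Fin n} (Z : Fin n → Phase d) (h : a ≠ q) (h' : a ≠ q') :
    scatter q q' Z a = Z a := by simp [scatter, h, h']

lemma scatter_fst (q q' : Fin n) (Z : Fin n → Phase d) (a : Fin n) :
    (scatter q q' Z a).1 = (Z a).1 := by
  simp only [scatter]; split_ifs with h1 h2 <;> simp [*]

/-- Exchanging the two labels reverses both `ν` and the relative velocity, and these signs cancel.
This is needed because a relabelling can reverse the order `q < q'`. -/
lemma scatter_comm {q q' : Fin n} (hq : q ≠ q') {Z : Fin n → Phase d}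
    (h : torusDist (Z q).1 (Z q').1 < 1 / 2) : scatter q q' Z = scatter q' q Z := by
  have hd := disp_comm h
  have hc := torusDist_comm (Z q).1 (Z q').1
  have key : ∀ (D : EuclideanSpace ℝ (Fin d)) (c : ℝ) (u v : EuclideanSpace ℝ (Fin d)),
      inner ℝ (c • -D) (v - u) • (c • -D) = -(inner ℝ (c • D) (u - v) • (c • D)) := by
    intro D c u v
    rw [← neg_sub u v, smul_neg, inner_neg_neg, smul_neg]
  funext a
  simp only [scatter, ← hc, hd, key]
  by_cases h1 : a = q
  · subst h1
    simp [hq, sub_eq_add_neg]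
  · by_cases h2 : a = q'
    · subst h2
      simp [hq.symm]
    · simp [h1, h2]

lemma scatter_relabel {j : Fin n → Fin N} {q q' a : Fin n} (Z : Fin N → Phase d)
    (Y : Fin n → Phase d) (hq : Y q = Z (j q)) (hq' : Y q' = Z (j q')) (ha : Y a = Z (j a))
    (h1 : j a = j q → a = q) (h2 : j a = j q' → a = q') :
    scatter q q' Y a = scatter (j q) (j q') Z (j a) := by
  by_cases e1 : a = q
  · subst e1; simp [scatter, hq, hq']
  · by_cases e2 : a = q'
    · subst e2
      have : j a ≠ j q := fun h => e1 (h1 h)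
      simp [scatter, hq, hq', e1, this]
    · rw [scatter_of_ne _ e1 e2, scatter_of_ne _ (mt h1 e1) (mt h2 e2), ha]

lemma Separated.of_ne {A : Finset (Fin n)} {Z : Fin n → Phase d} (h : Separated ε A Z) {a b : Fin n}
    (ha : a ∈ A) (hb : b ∈ A) (hab : a ≠ b) : ε < torusDist (Z a).1 (Z b).1 := by
  rcases lt_or_gt_of_ne hab with h1 | h1
  · exact h a ha b hb h1
  · rw [torusDist_comm]; exact h b hb a ha h1

lemma Separated.mono {A B : Finset (Fin n)} {Z : Fin n → Phase d} (h : Separated ε B Z)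
    (hAB : A ⊆ B) : Separated ε A Z := fun a ha b hb hab => h a (hAB ha) b (hAB hb) hab

lemma Separated.relabel {j : Fin n ↪ Fin N} {A : Finset (Fin n)} {Z : Fin N → Phase d}
    {Y : Fin n → Phase d} (hY : ∀ a ∈ A, Y a = Z (j a)) (h : Separated ε (A.map j) Z) :
    Separated ε A Y := fun a ha b hb hab => by
  rw [hY a ha, hY b hb]
  exact h.of_ne (by simpa) (by simpa) (by simpa using hab.ne)

lemma Contact.of_ne {A : Finset (Fin n)} {Z : Fin n → Phase d} {q q' : Fin n}
    (h : Contact ε A q q' Z) {a b : Fin n}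
    (ha : a ∈ A) (hb : b ∈ A) (hab : a ≠ b) (h1 : (a, b) ≠ (q, q')) (h2 : (b, a) ≠ (q, q')) :
    ε < torusDist (Z a).1 (Z b).1 := by
  rcases lt_or_gt_of_ne hab with h3 | h3
  · exact h.2.2.2.2 a ha b hb h3 h1
  · rw [torusDist_comm]; exact h.2.2.2.2 b hb a ha h3 h2

lemma Contact.separated_of_notMem {A B : Finset (Fin n)} {Z : Fin n → Phase d} {q q' : Fin n}
    (h : Contact ε B q q' Z) (hAB : A ⊆ B) (hq : q ∉ A ∨ q' ∉ A) : Separated ε A Z := by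
  intro a ha b hb hab
  refine h.2.2.2.2 a (hAB ha) b (hAB hb) hab fun e => ?_
  simp only [Prod.mk.injEq] at e
  rcases hq with hq | hq
  · exact hq (e.1 ▸ ha)
  · exact hq (e.2 ▸ hb)

lemma Contact.mono {A B : Finset (Fin n)} {Z : Fin n → Phase d} {q q' : Fin n}
    (h : Contact ε B q q' Z) (hAB : A ⊆ B) (hq : q ∈ A) (hq' : q' ∈ A) : Contact ε A q q' Z :=
  ⟨hq, hq', h.2.2.1, h.2.2.2.1, fun a ha b hb => h.2.2.2.2 a (hAB ha) b (hAB hb)⟩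

/-- The embedding `j` need not be monotone, so the pair in contact may appear in the opposite order.
By `scatter_comm` this has no effect on the scattering, which is where `ε < 1/2` is used. -/
lemma Contact.relabel {j : Fin n ↪ Fin N} {A : Finset (Fin n)} {Z : Fin N → Phase d}
    {Y : Fin n → Phase d} (hε : ε < 1 / 2) (hY : ∀ a ∈ A, Y a = Z (j a)) {Q Q' : Fin N}
    (h : Contact ε (A.map j) Q Q' Z) :
    ∃ q q', Contact ε A q q' Y ∧ ((j q = Q ∧ j q' = Q') ∨ (j q = Q' ∧ j q' = Q)) ∧
      ∀ a ∈ A, scatter q q' Y a = scatter Q Q' Z (j a) := by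
  obtain ⟨hQ, hQ', hlt, hd, hs⟩ := h
  obtain ⟨q, hq, rfl⟩ := Finset.mem_map.1 hQ
  obtain ⟨q', hq', rfl⟩ := Finset.mem_map.1 hQ'
  have hne : q ≠ q' := fun e => hlt.ne (by rw [e])
  have hsep : ∀ a ∈ A, ∀ b ∈ A, a ≠ b → (a, b) ≠ (q, q') → (a, b) ≠ (q', q) →
      ε < torusDist (Y a).1 (Y b).1 := by
    intro a ha b hb hab h1 h2
    rw [hY a ha, hY b hb]
    refine Contact.of_ne ⟨hQ, hQ', hlt, hd, hs⟩ (by simpa) (by simpa) (by simpa) ?_ ?_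
    · simpa using h1
    · simpa [and_comm] using h2
  have hsc : ∀ a ∈ A, scatter q q' Y a = scatter (j q) (j q') Z (j a) := fun a ha =>
    scatter_relabel Z Y (hY q hq) (hY q' hq') (hY a ha) (fun h => j.injective h)
      (fun h => j.injective h)
  have hdY : torusDist (Y q).1 (Y q').1 = ε := by rw [hY q hq, hY q' hq', hd]
  rcases lt_or_gt_of_ne hne with h1 | h1
  · exact ⟨q, q', ⟨hq, hq', h1, hdY, fun a ha b hb hab e => hsep a ha b hb hab.ne e
      (by rintro ⟨⟩; exact absurd h1 hab.not_gt)⟩, Or.inl ⟨rfl, rfl⟩, hsc⟩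
  · refine ⟨q', q, ⟨hq', hq, h1, by rw [torusDist_comm, hdY], fun a ha b hb hab e =>
      hsep a ha b hb hab.ne (by rintro ⟨⟩; exact absurd h1 hab.not_gt) e⟩, Or.inr ⟨rfl, rfl⟩, ?_⟩
    rw [← scatter_comm hne (by rw [hdY]; exact hε)]
    exact hsc

lemma freeFlight_relabel {j : Fin n → Fin N} {A : Finset (Fin n)} {Z : Fin N → Phase d}
    {Y : Fin n → Phase d} (hY : ∀ a ∈ A, Y a = Z (j a)) (u : ℝ) :
    ∀ a ∈ A, freeFlight u Y a = freeFlight u Z (j a) := fun a ha => by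
  simp only [freeFlight_apply, hY a ha]

/-! ### Elastic dynamics of a set of particles and its tree of annihilations -/

/-- The elastic dynamics in which only the particles of `A` interact. -/
inductive Elastic (ε : ℝ) (A : Finset (Fin n)) :
    (Fin n → Phase d) → ℝ → (Fin n → Phase d) → Prop
  | free (Z : Fin n → Phase d) (t : ℝ) (ht : 0 ≤ t)
      (h : ∀ u ∈ Set.Ioc 0 t, Separated ε A (freeFlight u Z)) :
      Elastic ε A Z t (freeFlight t Z)
  | collision (Z : Fin n → Phase d) (t τ : ℝ) (q q' : Fin n) (Z' : Fin n → Phase d)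
      (hτ : 0 < τ) (hτt : τ ≤ t)
      (h : ∀ u ∈ Set.Ioo 0 τ, Separated ε A (freeFlight u Z))
      (hc : Contact ε A q q' (freeFlight τ Z))
      (hrest : Elastic ε A (scatter q q' (freeFlight τ Z)) (t - τ) Z') :
      Elastic ε A Z t Z'

/-- All the trajectories that start from `Z` with interacting particles `A`, and in which at each
collision one of the two particles may be removed, with or without scattering of the other one,
exist up to time `t`. -/
inductive Tame (ε : ℝ) : Finset (Fin n) → (Fin n → Phase d) → ℝ → Prop
  | free (A : Finset (Fin n)) (Z : Fin n → Phase d) (t : ℝ) (ht : 0 ≤ t)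
      (h : ∀ u ∈ Set.Ioc 0 t, Separated ε A (freeFlight u Z)) : Tame ε A Z t
  | collision (A : Finset (Fin n)) (Z : Fin n → Phase d) (t τ : ℝ) (q q' : Fin n)
      (hτ : 0 < τ) (hτt : τ ≤ t)
      (h : ∀ u ∈ Set.Ioo 0 τ, Separated ε A (freeFlight u Z))
      (hc : Contact ε A q q' (freeFlight τ Z))
      (hs : Tame ε A (scatter q q' (freeFlight τ Z)) (t - τ))
      (hp : ∀ p, p = q ∨ p = q' → Tame ε (A.erase p) (scatter q q' (freeFlight τ Z)) (t - τ))
      (hp' : ∀ p, p = q ∨ p = q' → Tame ε (A.erase p) (freeFlight τ Z) (t - τ)) :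
      Tame ε A Z t

lemma separated_append {A : Finset (Fin n)} {s t : ℝ} {Z : Fin n → Phase d}
    (hsep : ∀ u ∈ Set.Ioc 0 s, Separated ε A (freeFlight u Z))
    (h : ∀ u ∈ Set.Ioc 0 t, Separated ε A (freeFlight u (freeFlight s Z))) :
    ∀ u ∈ Set.Ioc 0 (t + s), Separated ε A (freeFlight u Z) := by
  intro u hu
  rcases le_or_gt u s with hus | hus
  · exact hsep u ⟨hu.1, hus⟩
  · simpa [freeFlight_add] using h (u - s) ⟨by linarith, by linarith [hu.2]⟩

lemma separated_append' {A : Finset (Fin n)} {s t : ℝ} {Z : Fin n → Phase d}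
    (hsep : ∀ u ∈ Set.Ioc 0 s, Separated ε A (freeFlight u Z))
    (h : ∀ u ∈ Set.Ioo 0 t, Separated ε A (freeFlight u (freeFlight s Z))) :
    ∀ u ∈ Set.Ioo 0 (t + s), Separated ε A (freeFlight u Z) := by
  intro u hu
  rcases le_or_gt u s with hus | hus
  · exact hsep u ⟨hu.1, hus⟩
  · simpa [freeFlight_add] using h (u - s) ⟨by linarith, by linarith [hu.2]⟩

/-- If `q, q'` is the first contact in `B`, and `A ⊆ B` misses one of the two, then the particles of
`A` are separated up to this time. -/
lemma Contact.separated_until {A B : Finset (Fin n)} {τ : ℝ} {Z : Fin n → Phase d} {q q' : Fin n}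
    (hc : Contact ε B q q' (freeFlight τ Z))
    (h : ∀ u ∈ Set.Ioo 0 τ, Separated ε B (freeFlight u Z)) (hAB : A ⊆ B) (hq : q ∉ A ∨ q' ∉ A) :
    ∀ u ∈ Set.Ioc 0 τ, Separated ε A (freeFlight u Z) := by
  intro u hu
  rcases hu.2.lt_or_eq with h1 | rfl
  · exact (h u ⟨hu.1, h1⟩).mono hAB
  · exact hc.separated_of_notMem hAB hq

theorem Elastic.unique {A : Finset (Fin n)} {t : ℝ} {Z Z₁ Z₂ : Fin n → Phase d}
    (h₁ : Elastic ε A Z t Z₁) (h₂ : Elastic ε A Z t Z₂) : Z₁ = Z₂ := by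
  induction h₁ with
  | free Z t ht h =>
    cases h₂ with
    | free _ _ _ _ => rfl
    | collision _ _ τ q q' _ hτ hτt _ hc _ => exact absurd (h τ ⟨hτ, hτt⟩) (no_contact hc)
  | collision Z t τ q q' Z' hτ hτt h hc _ ih =>
    cases h₂ with
    | free _ _ _ h' => exact absurd (h' τ ⟨hτ, hτt⟩) (no_contact hc)
    | collision _ _ τ' p p' _ hτ' _ h' hc' hrest' =>
      obtain hlt | rfl | hgt := lt_trichotomy τ τ'
      · exact absurd (h' τ ⟨hτ, hlt⟩) (no_contact hc)
      · obtain ⟨rfl, rfl⟩ := contact_unique hc hc'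
        exact ih hrest'
      · exact absurd (h τ' ⟨hτ', hgt⟩) (no_contact hc')

lemma Elastic.hardSphere {t : ℝ} {Z Z' : Fin n → Phase d}
    (h : Elastic ε Finset.univ Z t Z') : HardSphereEvolves ε Z t Z' := by
  induction h with
  | free Z t ht h => exact .free Z t ht h
  | collision Z t τ q q' Z' hτ hτt h hc _ ih => exact .collision Z t τ q q' Z' hτ hτt h hc ih

theorem Elastic.prepend {A : Finset (Fin n)} {s t : ℝ} {Z Z' : Fin n → Phase d} (hs : 0 ≤ s)
    (hsep : ∀ u ∈ Set.Ioc 0 s, Separated ε A (freeFlight u Z))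
    (h : Elastic ε A (freeFlight s Z) t Z') : Elastic ε A Z (t + s) Z' := by
  cases h with
  | free _ _ ht h =>
    rw [freeFlight_add]
    exact .free Z _ (by linarith) (separated_append hsep h)
  | collision _ _ τ q q' _ hτ hτt h hc hrest =>
    rw [freeFlight_add] at hc hrest
    exact .collision Z _ (τ + s) q q' _ (by linarith) (by linarith) (separated_append' hsep h) hc
      (by rwa [add_sub_add_right_eq_sub])

theorem Tame.prepend {A : Finset (Fin n)} {s t : ℝ} {Z : Fin n → Phase d} (hs : 0 ≤ s)
    (hsep : ∀ u ∈ Set.Ioc 0 s, Separated ε A (freeFlight u Z))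
    (h : Tame ε A (freeFlight s Z) t) : Tame ε A Z (t + s) := by
  cases h with
  | free _ _ _ ht h => exact .free A Z _ (by linarith) (separated_append hsep h)
  | collision _ _ _ τ q q' hτ hτt h hc h1 h2 h3 =>
    rw [freeFlight_add] at hc h1
    simp only [freeFlight_add] at h2 h3
    rw [← add_sub_add_right_eq_sub t τ s] at h1
    refine .collision A Z _ (τ + s) q q' (by linarith) (by linarith) (separated_append' hsep h) hc
      h1 (fun p hp => ?_) (fun p hp => ?_)
    · simpa using h2 p hp
    · simpa using h3 p hp

/-- The motion of `A` reads nothing but the coordinates of the particles in `A`. With `j` the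
identity, this says that the other coordinates are irrelevant. -/
theorem Elastic.relabel {j : Fin n ↪ Fin N} {A : Finset (Fin n)} {t : ℝ} (hε : ε < 1 / 2)
    {Z Z' : Fin N → Phase d} (h : Elastic ε (A.map j) Z t Z')
    {Y : Fin n → Phase d} (hY : ∀ a ∈ A, Y a = Z (j a)) :
    ∃ Y', Elastic ε A Y t Y' ∧ ∀ a ∈ A, Y' a = Z' (j a) := by
  induction h generalizing Y with
  | free Z t ht h =>
    exact ⟨_, .free Y t ht fun u hu => (h u hu).relabel (freeFlight_relabel hY u),
      freeFlight_relabel hY t⟩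
  | collision Z t τ q q' Z' hτ hτt h hc _ ih =>
    obtain ⟨p, p', hc', -, hs⟩ := hc.relabel hε (freeFlight_relabel hY τ)
    obtain ⟨Y', hY', hYZ⟩ := ih hs
    exact ⟨Y', .collision Y t τ p p' Y' hτ hτt
      (fun u hu => (h u hu).relabel (freeFlight_relabel hY u)) hc' hY', hYZ⟩

theorem Tame.relabel {j : Fin n ↪ Fin N} {B : Finset (Fin N)} {t : ℝ} (hε : ε < 1 / 2)
    {Z : Fin N → Phase d} (h : Tame ε B Z t) {A : Finset (Fin n)} (hB : B = A.map j)
    {Y : Fin n → Phase d} (hY : ∀ a ∈ A, Y a = Z (j a)) : Tame ε A Y t := by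
  induction h generalizing A Y with
  | free B Z t ht h =>
    subst hB
    exact .free A Y t ht fun u hu => (h u hu).relabel (freeFlight_relabel hY u)
  | collision B Z t τ q q' hτ hτt h hc _ _ _ ih ih1 ih2 =>
    subst hB
    obtain ⟨p, p', hc', hpq, hs⟩ := hc.relabel hε (freeFlight_relabel hY τ)
    have hor : ∀ a, a = p ∨ a = p' → j a = q ∨ j a = q' := by
      rintro a (rfl | rfl) <;> tauto
    refine .collision A Y t τ p p' hτ hτt
      (fun u hu => (h u hu).relabel (freeFlight_relabel hY u)) hc' (ih rfl hs) ?_ ?_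
    · intro a ha
      exact ih1 (j a) (hor a ha) (Finset.map_erase j A a).symm
        fun b hb => hs b (Finset.mem_of_mem_erase hb)
    · intro a ha
      exact ih2 (j a) (hor a ha) (Finset.map_erase j A a).symm
        fun b hb => freeFlight_relabel hY τ b (Finset.mem_of_mem_erase hb)

/-- The tree of `B` contains the elastic trajectory of each `A ⊆ B`. When a contact in `B` involves
a particle outside `A`, follow the branch that removes this particle and lets the other one go
straight on. -/
theorem Tame.exists_elastic {A B : Finset (Fin n)} {t : ℝ} {Z : Fin n → Phase d}
    (h : Tame ε B Z t) (hAB : A ⊆ B) : ∃ Z', Elastic ε A Z t Z' := by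
  induction h with
  | free B Z t ht h => exact ⟨_, .free Z t ht fun u hu => (h u hu).mono hAB⟩
  | collision B Z t τ q q' hτ hτt h hc _ _ _ ih _ ih2 =>
    by_cases hq : q ∈ A ∧ q' ∈ A
    · obtain ⟨Z', hZ'⟩ := ih hAB
      exact ⟨Z', .collision Z t τ q q' Z' hτ hτt (fun u hu => (h u hu).mono hAB)
        (hc.mono hAB hq.1 hq.2) hZ'⟩
    · have hq' : q ∉ A ∨ q' ∉ A := by tauto
      have : ∃ Z', Elastic ε A (freeFlight τ Z) (t - τ) Z' := by
        rcases hq' with h1 | h1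
        · exact ih2 q (Or.inl rfl) (Finset.subset_erase.2 ⟨hAB, h1⟩)
        · exact ih2 q' (Or.inr rfl) (Finset.subset_erase.2 ⟨hAB, h1⟩)
      obtain ⟨Z', hZ'⟩ := this
      exact ⟨Z', by simpa using hZ'.prepend hτ.le (hc.separated_until h hAB hq')⟩

end HardSpheres

/-! ### The sum over recollision indices and its recursion at a collision. -/

namespace HardSpheres

variable {d n N r : ℕ} {ε t τ : ℝ} {σ : Fin r → ℤˣ × ℤˣ} {A M : Finset (Fin n)}
  {z : Fin n → Phase d} {q q' : Fin n} {ι : ℕ} {κ : Fin n → ℕ}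

/-! ### Pseudotrajectories -/

lemma collide_of_pos (h : ι < r) (hκ : 0 < κ (if (σ ⟨ι, h⟩).1 = 1 then q else q')) :
    State.collide σ q q' ⟨A, z, ι, κ⟩ = ⟨A, scatter q q' z, ι,
      Function.update κ (if (σ ⟨ι, h⟩).1 = 1 then q else q')
        (κ (if (σ ⟨ι, h⟩).1 = 1 then q else q') - 1)⟩ := by
  simp only [State.collide, h, dif_pos, hκ, if_pos]

lemma collide_of_eq_zero (h : ι < r) (hκ : κ (if (σ ⟨ι, h⟩).1 = 1 then q else q') = 0) :
    State.collide σ q q' ⟨A, z, ι, κ⟩ = ⟨A.erase (if (σ ⟨ι, h⟩).1 = 1 then q else q'),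
      if (σ ⟨ι, h⟩).2 = 1 then scatter q q' z else z, ι + 1, κ⟩ := by
  simp only [State.collide, h, dif_pos, hκ, lt_irrefl, if_false]

lemma collide_of_ge (h : r ≤ ι) :
    State.collide σ q q' ⟨A, z, ι, κ⟩ = ⟨A, scatter q q' z, ι, κ⟩ := by
  simp only [State.collide, h.not_gt, dif_neg, not_false_eq_true]

lemma PseudoEvolves.collision_iff {S S' : State d n} (hτ : 0 < τ) (hτt : τ ≤ t)
    (h : ∀ u ∈ Set.Ioo 0 τ, Separated ε S.alive (freeFlight u S.z))
    (hc : Contact ε S.alive q q' (freeFlight τ S.z)) :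
    PseudoEvolves ε σ S t S' ↔ PseudoEvolves ε σ ((S.free τ).collide σ q q') (t - τ) S' := by
  refine ⟨fun h₂ => ?_, fun h₂ => .collision S t τ q q' S' hτ hτt h hc h₂⟩
  cases h₂ with
  | free _ _ _ h' => exact absurd (h' τ ⟨hτ, hτt⟩) (no_contact hc)
  | collision _ _ τ' p p' _ hτ' _ h' hc' hrest' =>
    obtain hlt | rfl | hgt := lt_trichotomy τ τ'
    · exact absurd (h' τ ⟨hτ, hlt⟩) (no_contact hc)
    · obtain ⟨rfl, rfl⟩ := contact_unique hc hc'
      exact hrest'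
    · exact absurd (h τ' ⟨hτ', hgt⟩) (no_contact hc')

/-- A removed particle takes part in no further collision, so its index is frozen. Hence an
admissible end state forces `κ_p = 0` already at the removal of `p`. -/
lemma PseudoEvolves.kappa_of_notMem {S S' : State d n} (h : PseudoEvolves ε σ S t S') {p : Fin n}
    (hp : p ∉ S.alive) : S'.kappa p = S.kappa p := by
  induction h with
  | free S t ht h => rfl
  | collision S t τ q q' S' hτ hτt h hc hrest ih =>
    obtain ⟨A, z, ι, κ⟩ := S
    have hpq : p ≠ q := fun e => hp (e ▸ hc.1)
    have hpq' : p ≠ q' := fun e => hp (e ▸ hc.2.1)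
    by_cases hι : ι < r
    · set a := if (σ ⟨ι, hι⟩).1 = 1 then q else q' with ha
      have hpa : p ≠ a := by rw [ha]; split_ifs <;> assumption
      rcases Nat.eq_zero_or_pos (κ a) with hκ | hκ
      · simp only [State.free, collide_of_eq_zero hι hκ] at ih
        exact ih (fun e => hp (Finset.mem_of_mem_erase e))
      · simp only [State.free, collide_of_pos hι hκ] at ih
        rw [ih hp, ← ha, Function.update_of_ne hpa]
    · simp only [State.free, collide_of_ge (not_lt.1 hι)] at ih
      exact ih hp

lemma Elastic.pseudoEvolves {z' : Fin n → Phase d} (h : Elastic ε A z t z') (hι : r ≤ ι) :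
    PseudoEvolves ε σ ⟨A, z, ι, κ⟩ t ⟨A, z', ι, κ⟩ := by
  induction h with
  | free z t ht h => exact .free (⟨A, z, ι, κ⟩ : State d n) t ht h
  | collision z t τ q q' z' hτ hτt h hc hrest ih =>
    refine .collision _ t τ q q' _ hτ hτt h hc ?_
    simpa only [State.free, collide_of_ge hι] using ih

theorem Tame.exists_pseudoEvolves (h : Tame ε A z t) (σ : Fin r → ℤˣ × ℤˣ) (ι : ℕ)
    (κ : Fin n → ℕ) : ∃ S, PseudoEvolves ε σ ⟨A, z, ι, κ⟩ t S := by
  induction h generalizing ι κ with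
  | free A z t ht h => exact ⟨_, .free (⟨A, z, ι, κ⟩ : State d n) t ht h⟩
  | collision A z t τ q q' hτ hτt h hc _ _ _ ih ih1 ih2 =>
    suffices ∃ S, PseudoEvolves ε σ (((⟨A, z, ι, κ⟩ : State d n).free τ).collide σ q q') (t - τ) S by
      obtain ⟨S, hS⟩ := this
      exact ⟨S, .collision _ t τ q q' _ hτ hτt h hc hS⟩
    by_cases hι : ι < r
    · rcases Nat.eq_zero_or_pos (κ (if (σ ⟨ι, hι⟩).1 = 1 then q else q')) with hκ | hκ
      · simp only [State.free, collide_of_eq_zero hι hκ]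
        split_ifs
        · exact ih1 q (Or.inl rfl) _ _
        · exact ih2 q (Or.inl rfl) _ _
        · exact ih1 q' (Or.inr rfl) _ _
        · exact ih2 q' (Or.inr rfl) _ _
      · simp only [State.free, collide_of_pos hι hκ]
        exact ih _ _
    · simp only [State.free, collide_of_ge (not_lt.1 hι)]
      exact ih _ _

theorem Tame.finite_kappa (h : Tame ε A z t) (σ : Fin r → ℤˣ × ℤˣ) (ι : ℕ) :
    {κ | ∃ S, PseudoEvolves ε σ ⟨A, z, ι, κ⟩ t S ∧ ∀ j, S.kappa j = 0}.Finite := by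
  induction h generalizing ι with
  | free A z t ht h =>
    refine (Set.finite_singleton (0 : Fin n → ℕ)).subset ?_
    rintro κ ⟨S, hS, hκ⟩
    obtain rfl := hS.unique (.free (⟨A, z, ι, κ⟩ : State d n) t ht h)
    exact funext hκ
  | collision A z t τ q q' hτ hτt h hc _ _ _ ih ih1 ih2 =>
    by_cases hι : ι < r
    · set p := if (σ ⟨ι, hι⟩).1 = 1 then q else q' with hp
      set z₁ := if (σ ⟨ι, hι⟩).2 = 1 then scatter q q' (freeFlight τ z) else freeFlight τ z with hz₁
      have hpq : p = q ∨ p = q' := by rw [hp]; split_ifs <;> simp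
      have hfin : {κ | ∃ S, PseudoEvolves ε σ ⟨A.erase p, z₁, ι + 1, κ⟩ (t - τ) S ∧
          ∀ j, S.kappa j = 0}.Finite := by
        rw [hz₁]
        split_ifs
        · exact ih1 p hpq _
        · exact ih2 p hpq _
      -- Indices with `κ_p > 0` are those admissible after scattering, raised by one at `p`; indices
      -- with `κ_p = 0` are admissible after the removal.
      refine (((ih ι).image fun κ => Function.update κ p (κ p + 1)).union hfin).subset ?_
      rintro κ ⟨S, hS, hκ⟩
      rw [PseudoEvolves.collision_iff hτ hτt h hc] at hS
      rcases Nat.eq_zero_or_pos (κ p) with h0 | h0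
      · rw [State.free, collide_of_eq_zero hι h0] at hS
        exact Or.inr ⟨S, hS, hκ⟩
      · rw [State.free, collide_of_pos hι h0] at hS
        refine Or.inl ⟨_, ⟨S, hS, hκ⟩, ?_⟩
        funext a
        by_cases ha : a = p
        · subst ha; simp [← hp]; omega
        · simp [← hp, ha]
    · refine (ih ι).subset ?_
      rintro κ ⟨S, hS, hκ⟩
      rw [PseudoEvolves.collision_iff hτ hτt h hc, State.free, collide_of_ge (not_lt.1 hι)] at hS
      exact ⟨S, hS, hκ⟩

/-! ### Sums over the recollision indices -/

open Classical in
/-- The value of `H` at the end of a pseudotrajectory, if the particles of `M` remain and all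
recollision indices vanish; otherwise zero. -/
noncomputable def terminalValue (ε : ℝ) (σ : Fin r → ℤˣ × ℤˣ) (M : Finset (Fin n))
    (H : (Fin n → Phase d) → ℝ) (S : State d n) (t : ℝ) : ℝ :=
  if h : ∃ S', PseudoEvolves ε σ S t S' ∧ S'.alive = M ∧ ∀ j, S'.kappa j = 0
  then H h.choose.z else 0

variable {H : (Fin n → Phase d) → ℝ}

open Classical in
lemma PseudoEvolves.terminalValue_eq {S S' : State d n} (h : PseudoEvolves ε σ S t S') :
    terminalValue ε σ M H S t = if S'.alive = M ∧ ∀ j, S'.kappa j = 0 then H S'.z else 0 := by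
  unfold terminalValue
  by_cases h1 : ∃ S', PseudoEvolves ε σ S t S' ∧ S'.alive = M ∧ ∀ j, S'.kappa j = 0
  · rw [dif_pos h1]
    have h2 := h1.choose_spec
    have e := h2.1.unique h
    rw [e] at h2 ⊢
    exact (if_pos h2.2).symm
  · rw [dif_neg h1, if_neg fun h2 => h1 ⟨S', h, h2⟩]

lemma terminalValue_collision {S : State d n} (hτ : 0 < τ) (hτt : τ ≤ t)
    (h : ∀ u ∈ Set.Ioo 0 τ, Separated ε S.alive (freeFlight u S.z))
    (hc : Contact ε S.alive q q' (freeFlight τ S.z)) :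
    terminalValue ε σ M H S t = terminalValue ε σ M H ((S.free τ).collide σ q q') (t - τ) := by
  have hiff := fun S' => PseudoEvolves.collision_iff (σ := σ) (S' := S') hτ hτt h hc
  by_cases hS : ∃ S', PseudoEvolves ε σ S t S'
  · obtain ⟨S', hS'⟩ := hS
    rw [hS'.terminalValue_eq, ((hiff S').1 hS').terminalValue_eq]
  · unfold terminalValue
    rw [dif_neg fun h' => hS ⟨_, h'.choose_spec.1⟩,
      dif_neg fun h' => hS ⟨_, (hiff _).2 h'.choose_spec.1⟩]

lemma exists_of_terminalValue_ne {S : State d n} (h : terminalValue ε σ M H S t ≠ 0) :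
    ∃ S', PseudoEvolves ε σ S t S' ∧ ∀ j, S'.kappa j = 0 := by
  unfold terminalValue at h
  split_ifs at h with h1
  · exact ⟨h1.choose, h1.choose_spec.1, h1.choose_spec.2.2⟩
  · exact absurd rfl h

/-- The sum over all recollision indices of the terminal values. -/
noncomputable def recollisionSum (ε : ℝ) (σ : Fin r → ℤˣ × ℤˣ) (M : Finset (Fin n))
    (H : (Fin n → Phase d) → ℝ) (A : Finset (Fin n)) (z : Fin n → Phase d) (ι : ℕ) (t : ℝ) : ℝ :=
  ∑' κ, terminalValue ε σ M H ⟨A, z, ι, κ⟩ t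

lemma Tame.finite_support (h : Tame ε A z t) :
    (Function.support fun κ => terminalValue ε σ M H ⟨A, z, ι, κ⟩ t).Finite :=
  (h.finite_kappa σ ι).subset fun _ hκ => exists_of_terminalValue_ne hκ

lemma Tame.summable (h : Tame ε A z t) :
    Summable fun κ => terminalValue ε σ M H ⟨A, z, ι, κ⟩ t :=
  summable_of_hasFiniteSupport h.finite_support

/-- After the last annihilation the indices no longer change, so only `κ = 0` contributes. -/
lemma recollisionSum_of_ge {z' : Fin n → Phase d} (h : Elastic ε A z t z') (hι : r ≤ ι) :
    recollisionSum ε σ M H A z ι t = if A = M then H z' else 0 := by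
  unfold recollisionSum
  rw [tsum_eq_single 0]
  · rw [(h.pseudoEvolves hι).terminalValue_eq]; simp
  · intro κ hκ
    rw [(h.pseudoEvolves hι).terminalValue_eq, if_neg]
    exact fun h' => hκ (funext h'.2)

lemma recollisionSum_free (ht : 0 ≤ t) (h : ∀ u ∈ Set.Ioc 0 t, Separated ε A (freeFlight u z))
    (hA : A ≠ M) : recollisionSum ε σ M H A z ι t = 0 := by
  unfold recollisionSum
  rw [← tsum_zero (α := ℝ) (β := Fin n → ℕ)]
  congr 1
  funext κ
  rw [(PseudoEvolves.free (⟨A, z, ι, κ⟩ : State d n) t ht h).terminalValue_eq, if_neg]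
  exact fun h' => hA h'.1

/-- The sum is split according to `κ_p`. Lowering `κ_p` by one maps the indices with `κ_p > 0`
bijectively onto all indices, which gives the full sum after scattering. The indices with `κ_p = 0`
give the full sum after the removal, since there the terms with `κ_p > 0` vanish by
`PseudoEvolves.kappa_of_notMem`. -/
theorem recollisionSum_collision (hι : ι < r) (hτ : 0 < τ) (hτt : τ ≤ t)
    (h : ∀ u ∈ Set.Ioo 0 τ, Separated ε A (freeFlight u z))
    (hc : Contact ε A q q' (freeFlight τ z))
    (h₁ : Tame ε A (scatter q q' (freeFlight τ z)) (t - τ)) {p : Fin n}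
    (hp : p = if (σ ⟨ι, hι⟩).1 = 1 then q else q') {z₁ : Fin n → Phase d}
    (hz₁ : z₁ = if (σ ⟨ι, hι⟩).2 = 1 then scatter q q' (freeFlight τ z) else freeFlight τ z)
    (h₂ : Tame ε (A.erase p) z₁ (t - τ)) :
    recollisionSum ε σ M H A z ι t =
      recollisionSum ε σ M H A (scatter q q' (freeFlight τ z)) ι (t - τ) +
        recollisionSum ε σ M H (A.erase p) z₁ (ι + 1) (t - τ) := by
  set f := fun κ => terminalValue ε σ M H ⟨A, scatter q q' (freeFlight τ z), ι, κ⟩ (t - τ) with hf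
  set g := fun κ => terminalValue ε σ M H ⟨A.erase p, z₁, ι + 1, κ⟩ (t - τ) with hg
  let inc : (Fin n → ℕ) → (Fin n → ℕ) := fun κ => Function.update κ p (κ p + 1)
  let dec : (Fin n → ℕ) → (Fin n → ℕ) := fun κ => Function.update κ p (κ p - 1)
  have hdi : ∀ κ, dec (inc κ) = κ := fun κ => by
    funext a; by_cases ha : a = p
    · subst ha; simp [inc, dec]
    · simp [inc, dec, ha]
  have hid : ∀ κ, 0 < κ p → inc (dec κ) = κ := fun κ hκ => by
    funext a; by_cases ha : a = p
    · subst ha; simp [inc, dec]; omega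
    · simp [inc, dec, ha]
  have hinj : Function.Injective inc := Function.LeftInverse.injective hdi
  let f₁ : (Fin n → ℕ) → ℝ := fun κ => if 0 < κ p then f (dec κ) else 0
  have hf₁ : ∀ κ, f₁ (inc κ) = f κ := fun κ => by simp [f₁, hdi]; simp [inc]
  have hsupp : Function.support f₁ ⊆ Set.range inc := by
    intro κ hκ
    by_cases h0 : 0 < κ p
    · exact ⟨dec κ, hid κ h0⟩
    · exact absurd (if_neg h0) hκ
  have hsum : Summable f := h₁.summable
  have hfin : (Function.support f₁).Finite := by
    refine (h₁.finite_support (σ := σ) (M := M) (H := H) (ι := ι)).image inc |>.subset ?_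
    intro κ hκ
    obtain ⟨κ', rfl⟩ := hsupp hκ
    refine ⟨κ', ?_, rfl⟩
    rw [Function.mem_support, hf₁] at hκ
    exact hκ
  have hsum₁ : Summable f₁ := summable_of_hasFiniteSupport hfin
  -- `f₁` is `f` transported along the injection `inc` and extended by zero outside its range.
  have e1 : ∑' κ, f κ = ∑' κ, f₁ κ := by
    rw [← hinj.tsum_eq hsupp]; simp only [hf₁]
  have e2 : ∀ κ, terminalValue ε σ M H ⟨A, z, ι, κ⟩ t = f₁ κ + g κ := by
    intro κ
    rw [terminalValue_collision hτ hτt h hc]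
    rcases Nat.eq_zero_or_pos (κ p) with h0 | h0
    · rw [hp] at h0
      rw [State.free, collide_of_eq_zero hι h0, ← hp, ← hz₁]
      rw [← hp] at h0
      simp [f₁, h0, hg]
    · have hg0 : g κ = 0 := by
        by_contra hne
        obtain ⟨S, hS, hS0⟩ := exists_of_terminalValue_ne hne
        have := hS.kappa_of_notMem (p := p) (by simp)
        rw [hS0] at this
        exact h0.ne this
      rw [hp] at h0
      rw [State.free, collide_of_pos hι h0, ← hp]
      rw [← hp] at h0
      simp [f₁, h0, hf, hg0, dec]
  unfold recollisionSum
  rw [e1, ← hsum₁.tsum_add h₂.summable]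
  exact tsum_congr e2

end HardSpheres

/-! ### Cumulants, and their equality with the signed sums over all parameters. -/

namespace HardSpheres

variable {d n N r : ℕ} {ε t τ : ℝ} {σ : Fin r → ℤˣ × ℤˣ} {A M : Finset (Fin n)}
  {z : Fin n → Phase d} {q q' : Fin n} {ι : ℕ} {κ : Fin n → ℕ} {H : (Fin n → Phase d) → ℝ}

/-! ### Cumulants of the elastic flows -/

open Classical in
/-- The flow of the elastic dynamics of the particles in `A`. -/
noncomputable def elasticFlow (ε : ℝ) (A : Finset (Fin n)) (t : ℝ) (z : Fin n → Phase d) :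
    Fin n → Phase d :=
  if h : ∃ z', Elastic ε A z t z' then h.choose else z

lemma Elastic.flow_eq {z' : Fin n → Phase d} (h : Elastic ε A z t z') :
    elasticFlow ε A t z = z' := by
  have h1 : ∃ z', Elastic ε A z t z' := ⟨z', h⟩
  rw [elasticFlow, dif_pos h1]
  exact h1.choose_spec.unique h

/-- The alternating sum of the values of `H` along the elastic flows of the sets between `M` and
`A`. -/
noncomputable def cumulant (ε : ℝ) (M : Finset (Fin n)) (H : (Fin n → Phase d) → ℝ)
    (A : Finset (Fin n)) (z : Fin n → Phase d) (t : ℝ) : ℝ :=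
  ∑ B ∈ Finset.Icc M A, (-1 : ℝ) ^ (A.card + B.card) * H (elasticFlow ε B t z)

/-- Adding or removing a fixed `x ∈ A \ M` is an involution of the interval that reverses the sign.
If `M ⊆ A` fails, the interval is empty. -/
lemma sum_Icc_neg_one_pow_card {α : Type*} [DecidableEq α] {M A : Finset α} (hMA : A ≠ M) :
    ∑ B ∈ Finset.Icc M A, (-1 : ℝ) ^ B.card = 0 := by
  by_cases hsub : M ⊆ A
  · obtain ⟨x, hxA, hxM⟩ := Finset.exists_of_ssubset (hsub.ssubset_of_ne hMA.symm)
    refine Finset.sum_involution (fun B _ => if x ∈ B then B.erase x else insert x B) ?_ ?_ ?_ ?_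
    · intro B hB
      by_cases hx : x ∈ B
      · have h1 := Finset.card_erase_add_one hx
        simp only [hx, if_true, ← h1, pow_succ]; ring
      · simp only [hx, if_false, Finset.card_insert_of_notMem hx, pow_succ]; ring
    · intro B hB _ h
      by_cases hx : x ∈ B
      · simp only [hx, if_true] at h
        exact Finset.notMem_erase x B (h.symm ▸ hx)
      · simp only [hx, if_false] at h
        exact hx (h ▸ Finset.mem_insert_self x B)
    · intro B hB
      rw [Finset.mem_Icc] at hB ⊢
      by_cases hx : x ∈ B
      · simp only [hx, if_true]
        exact ⟨Finset.subset_erase.2 ⟨hB.1, hxM⟩, (Finset.erase_subset _ _).trans hB.2⟩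
      · simp only [hx, if_false]
        exact ⟨hB.1.trans (Finset.subset_insert _ _), Finset.insert_subset hxA hB.2⟩
    · intro B hB
      by_cases hx : x ∈ B
      · simp [hx, Finset.insert_erase]
      · simp [hx]
  · rw [Finset.Icc_eq_empty hsub, Finset.sum_empty]

lemma cumulant_free (ht : 0 ≤ t) (h : ∀ u ∈ Set.Ioc 0 t, Separated ε A (freeFlight u z))
    (hA : A ≠ M) : cumulant ε M H A z t = 0 := by
  have h1 : ∀ B ∈ Finset.Icc M A, (-1 : ℝ) ^ (A.card + B.card) * H (elasticFlow ε B t z) =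
      (-1 : ℝ) ^ A.card * H (freeFlight t z) * (-1 : ℝ) ^ B.card := by
    intro B hB
    rw [(Elastic.free z t ht fun u hu => (h u hu).mono (Finset.mem_Icc.1 hB).2).flow_eq]
    ring
  rw [cumulant, Finset.sum_congr rfl h1, ← Finset.mul_sum, sum_Icc_neg_one_pow_card hA, mul_zero]

lemma cumulant_of_card_eq (hA : A.card = M.card) :
    cumulant ε M H A z t = if A = M then H (elasticFlow ε A t z) else 0 := by
  rw [cumulant]
  split_ifs with h
  · subst h
    simp [← two_mul]
  · rw [Finset.Icc_eq_empty, Finset.sum_empty]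
    exact fun hle => h (Finset.eq_of_subset_of_card_le hle hA.le).symm

/-- The identity holds for each `B` separately. If `B` contains both particles, it scatters and only
the first cumulant sees it. If it misses exactly one particle `p`, it goes straight on, and the two
terms of `A.erase p` replace the scattered value by the unscattered one. If it misses both,
scattering changes nothing that `B` can see. -/
theorem cumulant_collision (hε : ε < 1 / 2) (hH : ∀ z z', (∀ a ∈ M, z a = z' a) → H z = H z')
    (hτ : 0 < τ) (hτt : τ ≤ t)
    (h : ∀ u ∈ Set.Ioo 0 τ, Separated ε A (freeFlight u z))
    (hc : Contact ε A q q' (freeFlight τ z))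
    (hs : Tame ε A (scatter q q' (freeFlight τ z)) (t - τ))
    (hp' : ∀ p, p = q ∨ p = q' → Tame ε (A.erase p) (freeFlight τ z) (t - τ)) :
    cumulant ε M H A z t = cumulant ε M H A (scatter q q' (freeFlight τ z)) (t - τ) +
      ((cumulant ε M H (A.erase q) (scatter q q' (freeFlight τ z)) (t - τ) -
          cumulant ε M H (A.erase q) (freeFlight τ z) (t - τ)) +
        (cumulant ε M H (A.erase q') (scatter q q' (freeFlight τ z)) (t - τ) -
          cumulant ε M H (A.erase q') (freeFlight τ z) (t - τ))) := by
  set y := freeFlight τ z with hy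
  set y' := scatter q q' y with hy'
  let g : Finset (Fin n) → ℝ := fun B => H (elasticFlow ε B (t - τ) y')
  let g₀ : Finset (Fin n) → ℝ := fun B => H (elasticFlow ε B (t - τ) y)
  have hin : ∀ B ⊆ A, q ∈ B → q' ∈ B → H (elasticFlow ε B t z) = g B := by
    intro B hB hq hq'
    obtain ⟨z', hz'⟩ := hs.exists_elastic hB
    simp only [g, hz'.flow_eq]
    rw [(Elastic.collision z t τ q q' z' hτ hτt (fun u hu => (h u hu).mono hB)
      (hc.mono hB hq hq') hz').flow_eq]
  have hout : ∀ B ⊆ A, q ∉ B ∨ q' ∉ B → H (elasticFlow ε B t z) = g₀ B := by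
    intro B hB hq
    have : ∃ z', Elastic ε B y (t - τ) z' := by
      rcases hq with h1 | h1
      · exact (hp' q (Or.inl rfl)).exists_elastic (Finset.subset_erase.2 ⟨hB, h1⟩)
      · exact (hp' q' (Or.inr rfl)).exists_elastic (Finset.subset_erase.2 ⟨hB, h1⟩)
    obtain ⟨z', hz'⟩ := this
    simp only [g₀, hz'.flow_eq]
    have := hz'.prepend hτ.le (hc.separated_until h hB hq)
    rw [sub_add_cancel] at this
    rw [this.flow_eq]
  have hboth : ∀ B ⊆ A, M ⊆ B → q ∉ B → q' ∉ B → g B = g₀ B := by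
    intro B hB hM hq hq'
    obtain ⟨z', hz'⟩ := hs.exists_elastic hB
    have hYZ : ∀ a ∈ B, y a = y' (Function.Embedding.refl (Fin n) a) := by
      intro a ha
      exact (scatter_of_ne y (by rintro rfl; exact hq ha) (by rintro rfl; exact hq' ha)).symm
    have hz'' := hz'
    rw [← Finset.map_refl (s := B)] at hz''
    obtain ⟨z₁, hz₁, hz₁'⟩ := hz''.relabel hε hYZ
    simp only [g, g₀, hz'.flow_eq, hz₁.flow_eq]
    exact hH _ _ fun a ha => (hz₁' a (hM ha)).symm
  -- All five cumulants are written as sums over the same interval, so that they can be compared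
  -- term by term; the sign changes because `A.erase p` has one element fewer.
  have herase : ∀ (p : Fin n) (f : Finset (Fin n) → ℝ), p ∈ A →
      ∑ B ∈ Finset.Icc M (A.erase p), (-1 : ℝ) ^ ((A.erase p).card + B.card) * f B =
      ∑ B ∈ Finset.Icc M A, if p ∈ B then 0 else -((-1 : ℝ) ^ (A.card + B.card) * f B) := by
    intro p f hp
    rw [← Finset.sum_filter_add_sum_filter_not (Finset.Icc M A) (fun B => p ∈ B),
      Finset.sum_eq_zero (s := Finset.filter (fun B => p ∈ B) _), zero_add]
    · refine Finset.sum_congr ?_ ?_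
      · ext B
        simp only [Finset.mem_Icc, Finset.mem_filter, Finset.subset_erase]
        tauto
      · intro B hB
        rw [if_neg (Finset.mem_filter.1 hB).2, ← Finset.card_erase_add_one hp]
        ring
    · intro B hB
      exact if_pos (Finset.mem_filter.1 hB).2
  simp only [cumulant]
  rw [herase q _ hc.1, herase q _ hc.1, herase q' _ hc.2.1, herase q' _ hc.2.1,
    ← Finset.sum_sub_distrib, ← Finset.sum_sub_distrib, ← Finset.sum_add_distrib,
    ← Finset.sum_add_distrib]
  refine Finset.sum_congr rfl fun B hB => ?_
  obtain ⟨hM, hB⟩ := Finset.mem_Icc.1 hB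
  change _ = (-1 : ℝ) ^ _ * g B + ((_ - if q ∈ B then 0 else -(_ * g₀ B)) +
    (_ - if q' ∈ B then 0 else -(_ * g₀ B)))
  by_cases hq : q ∈ B <;> by_cases hq' : q' ∈ B
  · rw [hin B hB hq hq']; simp [hq, hq']
  · rw [hout B hB (Or.inr hq')]; simp [hq, hq', g]
  · rw [hout B hB (Or.inl hq)]; simp [hq, hq', g]
  · rw [hout B hB (Or.inl hq), hboth B hB hM hq hq']
    have := hboth B hB hM hq hq'
    simp only [hq, hq', if_false]
    change _ = _ + ((-(_ * g B) - _) + (-(_ * g B) - _))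
    rw [this]; ring

/-! ### Sums over the signs -/

/-- The sign sequences that agree with `σ` below `ι`. -/
def agreeing (ι : ℕ) (σ : Fin r → ℤˣ × ℤˣ) : Finset (Fin r → ℤˣ × ℤˣ) :=
  Finset.univ.filter fun σ' => ∀ i : Fin r, (i : ℕ) < ι → σ' i = σ i

/-- The product of the signs `s̄` from `ι` on. -/
def signWeight (ι : ℕ) (σ : Fin r → ℤˣ × ℤˣ) : ℝ :=
  ∏ i ∈ Finset.univ.filter fun i : Fin r => ι ≤ (i : ℕ), (((σ i).2 : ℤ) : ℝ)

/-- The signed sum of the terminal values over all remaining parameters. -/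
noncomputable def signedSum (ε : ℝ) (σ : Fin r → ℤˣ × ℤˣ) (M : Finset (Fin n))
    (H : (Fin n → Phase d) → ℝ) (A : Finset (Fin n)) (z : Fin n → Phase d) (ι : ℕ) (t : ℝ) : ℝ :=
  ∑ σ' ∈ agreeing ι σ, signWeight ι σ' * recollisionSum ε σ' M H A z ι t

lemma signWeight_succ (hι : ι < r) (σ : Fin r → ℤˣ × ℤˣ) :
    signWeight ι σ = (((σ ⟨ι, hι⟩).2 : ℤ) : ℝ) * signWeight (ι + 1) σ := by
  have : (Finset.univ.filter fun i : Fin r => ι ≤ (i : ℕ)) =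
      insert ⟨ι, hι⟩ (Finset.univ.filter fun i : Fin r => ι + 1 ≤ (i : ℕ)) := by
    ext i
    simp only [Finset.mem_filter, Finset.mem_univ, true_and, Finset.mem_insert, Fin.ext_iff]
    omega
  rw [signWeight, this, Finset.prod_insert (by simp)]; rfl

/-- The sum is fibred over the next sign pair, which is the only one that the next annihilation
reads. -/
lemma sum_agreeing (hι : ι < r) (σ : Fin r → ℤˣ × ℤˣ) (f : (Fin r → ℤˣ × ℤˣ) → ℝ) :
    ∑ σ' ∈ agreeing ι σ, f σ' =
      ∑ x : ℤˣ × ℤˣ, ∑ σ' ∈ agreeing (ι + 1) (Function.update σ ⟨ι, hι⟩ x), f σ' := by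
  rw [← Finset.sum_fiberwise (agreeing ι σ) (fun σ' => σ' ⟨ι, hι⟩) f]
  refine Finset.sum_congr rfl fun x _ => Finset.sum_congr ?_ fun _ _ => rfl
  ext σ'
  simp only [agreeing, Finset.mem_filter, Finset.mem_univ, true_and]
  constructor
  · rintro ⟨h1, rfl⟩ i hi
    by_cases h : i = ⟨ι, hι⟩
    · subst h; simp
    · rw [Function.update_of_ne h]
      exact h1 i (by rw [Fin.ext_iff] at h; simp only at h; omega)
  · intro h
    refine ⟨fun i hi => ?_, ?_⟩
    · rw [h i (by omega), Function.update_of_ne]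
      rintro rfl; simp at hi
    · rw [h ⟨ι, hι⟩ (by simp)]; simp

lemma apply_of_mem_agreeing (hι : ι < r) {σ σ' : Fin r → ℤˣ × ℤˣ} {x : ℤˣ × ℤˣ}
    (h : σ' ∈ agreeing (ι + 1) (Function.update σ ⟨ι, hι⟩ x)) : σ' ⟨ι, hι⟩ = x := by
  rw [(Finset.mem_filter.1 h).2 ⟨ι, hι⟩ (by simp)]; simp

lemma signedSum_last (h : Tame ε A z t) (hA : A.card = M.card) :
    signedSum ε σ M H A z r t = cumulant ε M H A z t := by
  obtain ⟨z', hz'⟩ := h.exists_elastic subset_rfl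
  have h1 : agreeing r σ = {σ} := by
    ext σ'
    simp only [agreeing, Finset.mem_filter, Finset.mem_univ, true_and, Finset.mem_singleton]
    exact ⟨fun h => funext fun i => h i i.2, fun h i _ => h ▸ rfl⟩
  rw [cumulant_of_card_eq hA, hz'.flow_eq, signedSum, h1, Finset.sum_singleton,
    recollisionSum_of_ge hz' le_rfl, signWeight, Finset.filter_false_of_mem, Finset.prod_empty,
    one_mul]
  intro i _
  exact i.2.not_ge

/-- Induction on the collision tree: both sides satisfy the same recursion and have the same
boundary values. The relation `hA` is preserved by each annihilation and says that exactly the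
surplus of `A` over `M` remains to be removed. -/
theorem signedSum_eq_cumulant (hε : ε < 1 / 2)
    (hH : ∀ z z', (∀ a ∈ M, z a = z' a) → H z = H z') (h : Tame ε A z t) (σ : Fin r → ℤˣ × ℤˣ)
    (hι : ι ≤ r) (hA : A.card + ι = M.card + r) :
    signedSum ε σ M H A z ι t = cumulant ε M H A z t := by
  induction h generalizing ι σ with
  | free A z t ht h =>
    rcases hι.eq_or_lt with rfl | hlt
    · exact signedSum_last (.free A z t ht h) (by omega)
    -- An annihilation is still due but no collision occurs: no pseudotrajectory ends with `M`, and
    -- the cumulant is an alternating sum of equal values.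
    · have hne : A ≠ M := by rintro rfl; omega
      rw [cumulant_free ht h hne, signedSum]
      exact Finset.sum_eq_zero fun σ' _ => by rw [recollisionSum_free ht h hne, mul_zero]
  | collision A z t τ q q' hτ hτt h hc hs hp hp' ih ih1 ih2 =>
    rcases hι.eq_or_lt with rfl | hlt
    · exact signedSum_last (.collision A z t τ q q' hτ hτt h hc hs hp hp') (by omega)
    · rw [cumulant_collision hε hH hτ hτt h hc hs hp', ← ih σ hι hA]
      have hcard : ∀ p, p = q ∨ p = q' → (A.erase p).card + (ι + 1) = M.card + r := by
        intro p hpq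
        have : p ∈ A := by
          rcases hpq with rfl | rfl
          exacts [hc.1, hc.2.1]
        have := Finset.card_erase_add_one this
        omega
      let Y : ℤˣ → Fin n → Phase d := fun s =>
        if s = 1 then scatter q q' (freeFlight τ z) else freeFlight τ z
      let P : ℤˣ → Fin n := fun s => if s = 1 then q else q'
      have hP : ∀ s, P s = q ∨ P s = q' := fun s => by simp only [P]; split_ifs <;> simp
      have hT : ∀ s s', Tame ε (A.erase (P s)) (Y s') (t - τ) := by
        intro s s'
        simp only [Y]
        split_ifs
        · exact hp _ (hP s)
        · exact hp' _ (hP s)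
      have hKC : ∀ (s s' : ℤˣ) (σ' : Fin r → ℤˣ × ℤˣ),
          signedSum ε σ' M H (A.erase (P s)) (Y s') (ι + 1) (t - τ) =
            cumulant ε M H (A.erase (P s)) (Y s') (t - τ) := by
        intro s s' σ'
        simp only [Y]
        split_ifs
        · exact ih1 _ (hP s) σ' hlt (hcard _ (hP s))
        · exact ih2 _ (hP s) σ' hlt (hcard _ (hP s))
      have hrec : ∀ σ' : Fin r → ℤˣ × ℤˣ, recollisionSum ε σ' M H A z ι t =
          recollisionSum ε σ' M H A (scatter q q' (freeFlight τ z)) ι (t - τ) +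
            recollisionSum ε σ' M H (A.erase (P (σ' ⟨ι, hlt⟩).1)) (Y (σ' ⟨ι, hlt⟩).2) (ι + 1)
              (t - τ) := fun σ' =>
        recollisionSum_collision hlt hτ hτt h hc hs rfl rfl (hT _ _)
      -- On each fibre the sign pair at `ι` is constant. Its `s̄` factors out of the weight, and the
      -- rest is the signed sum from `ι + 1` on, a cumulant of `A.erase p` by induction.
      have hstep : ∑ σ' ∈ agreeing ι σ, signWeight ι σ' *
          recollisionSum ε σ' M H (A.erase (P (σ' ⟨ι, hlt⟩).1)) (Y (σ' ⟨ι, hlt⟩).2) (ι + 1)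
              (t - τ) =
          ∑ x : ℤˣ × ℤˣ, ((x.2 : ℤ) : ℝ) *
            cumulant ε M H (A.erase (P x.1)) (Y x.2) (t - τ) := by
        rw [sum_agreeing hlt]
        refine Finset.sum_congr rfl fun x _ => ?_
        rw [← hKC x.1 x.2 (Function.update σ ⟨ι, hlt⟩ x), signedSum, Finset.mul_sum]
        refine Finset.sum_congr rfl fun σ' hσ' => ?_
        rw [signWeight_succ hlt, apply_of_mem_agreeing hlt hσ', mul_assoc]
      rw [signedSum, Finset.sum_congr rfl fun σ' _ => by rw [hrec σ', mul_add],
        Finset.sum_add_distrib, hstep, Fintype.sum_prod_type]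
      have hu : (Finset.univ : Finset ℤˣ) = {1, -1} := rfl
      rw [hu]
      simp only [Finset.sum_pair (show (1 : ℤˣ) ≠ -1 by decide)]
      have h2 : (-1 : ℤˣ) ≠ 1 := by decide
      simp [P, Y, h2, signedSum]
      ring

end HardSpheres

/-! ### Inclusion–exclusion over the sets of added particles. -/

namespace HardSpheres

variable {d n N m r : ℕ} {ε t τ : ℝ} {A M : Finset (Fin n)}
  {z : Fin n → Phase d} {H : (Fin n → Phase d) → ℝ}

/-! ### The development as a cumulant -/

lemma pseudoState_eq {p : Params r n} {S : State d n}
    (h : PseudoEvolves ε p.1 (initState p.2 z) t S) : pseudoState ε t p z = S := by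
  have h1 : ∃ S, PseudoEvolves ε p.1 (initState p.2 z) t S := ⟨S, h⟩
  rw [pseudoState, dif_pos h1]
  exact h1.choose_spec.unique h

/-- The first `m` of `m + r` particles. -/
def firstParticles (m r : ℕ) : Finset (Fin (m + r)) := Finset.univ.map (Fin.castAddEmb r)

lemma mem_firstParticles {a : Fin (m + r)} : a ∈ firstParticles m r ↔ (a : ℕ) < m := by
  simp only [firstParticles, Finset.mem_map, Finset.mem_univ, true_and, Fin.castAddEmb_apply]
  constructor
  · rintro ⟨k, rfl⟩; exact k.2
  · intro h; exact ⟨⟨a, h⟩, rfl⟩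

lemma Tame.finite_admissible {Z : Fin (m + r) → Phase d} (h : Tame ε Finset.univ Z t) :
    {p : Params r (m + r) | Z ∈ admissible m r ε t p}.Finite := by
  refine (Set.finite_iUnion fun σ => (h.finite_kappa σ 0).image (Prod.mk σ)).subset ?_
  rintro ⟨σ, κ⟩ ⟨-, ⟨S, hS⟩, -, hκ⟩
  rw [pseudoState_eq hS] at hκ
  exact Set.mem_iUnion.2 ⟨σ, κ, ⟨S, hS, hκ⟩, rfl⟩

lemma Tame.indicator_admissible {Z : Fin (m + r) → Phase d} (hZ : Z ∈ domain d ε (m + r))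
    (h : Tame ε Finset.univ Z t) (f : (Fin m → Phase d) → ℝ) (p : Params r (m + r)) :
    (admissible m r ε t p).indicator
        (fun Y => f fun k => (pseudoState ε t p Y).z (Fin.castAdd r k)) Z =
      terminalValue ε p.1 (firstParticles m r) (fun Y => f fun k => Y (Fin.castAdd r k))
        ⟨Finset.univ, Z, 0, p.2⟩ t := by
  classical
  obtain ⟨S, hS⟩ := h.exists_pseudoEvolves p.1 0 p.2
  have hS' : PseudoEvolves ε p.1 (initState p.2 Z) t S := hS
  rw [hS.terminalValue_eq, Set.indicator_apply, pseudoState_eq hS']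
  refine if_congr ?_ rfl rfl
  rw [admissible, Set.mem_ofPred_eq, pseudoState_eq hS']
  have : (S.alive = firstParticles m r) ↔ ∀ j : Fin (m + r), j ∈ S.alive ↔ (j : ℕ) < m := by
    rw [Finset.ext_iff]; simp only [mem_firstParticles]
  rw [this]
  exact ⟨fun h => h.2.2, fun h => ⟨hZ, ⟨S, hS'⟩, h⟩⟩

lemma card_firstParticles : (firstParticles m r).card = m := by
  rw [firstParticles, Finset.card_map, Finset.card_univ, Fintype.card_fin]

/-- Only finitely many parameters contribute, which permits summing first over `κ` and then over the
signs. -/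
lemma Tame.tsum_params {Z : Fin n → Phase d} (h : Tame ε Finset.univ Z t)
    {g : (Fin r → ℤˣ × ℤˣ) × (Fin n → ℕ) → ℝ}
    (hg : ∀ p, g p = terminalValue ε p.1 M H ⟨Finset.univ, Z, 0, p.2⟩ t)
    (c : (Fin r → ℤˣ × ℤˣ) → ℝ) :
    ∑' p : (Fin r → ℤˣ × ℤˣ) × (Fin n → ℕ), c p.1 * g p =
      ∑ σ, c σ * recollisionSum ε σ M H Finset.univ Z 0 t := by
  have hfin : (⋃ σ : Fin r → ℤˣ × ℤˣ, (Prod.mk σ) '' {κ : Fin n → ℕ |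
      ∃ S, PseudoEvolves ε σ ⟨Finset.univ, Z, 0, κ⟩ t S ∧ ∀ j, S.kappa j = 0}).Finite :=
    Set.finite_iUnion fun σ => (h.finite_kappa σ 0).image (Prod.mk σ)
  have hsupp : (Function.support fun p : (Fin r → ℤˣ × ℤˣ) × (Fin n → ℕ) => c p.1 * g p) ⊆
      ⋃ σ : Fin r → ℤˣ × ℤˣ, (Prod.mk σ) '' {κ : Fin n → ℕ |
      ∃ S, PseudoEvolves ε σ ⟨Finset.univ, Z, 0, κ⟩ t S ∧ ∀ j, S.kappa j = 0} := by
    intro p hp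
    have h1 : g p ≠ 0 := fun h0 => hp (by simp only [h0, mul_zero])
    rw [hg] at h1
    exact Set.mem_iUnion.2 ⟨p.1, p.2, exists_of_terminalValue_ne h1, rfl⟩
  have hsum : Summable fun p : (Fin r → ℤˣ × ℤˣ) × (Fin n → ℕ) => c p.1 * g p :=
    summable_of_hasFiniteSupport (hfin.subset hsupp)
  have hfib : ∀ σ, Summable fun κ => c σ * g (σ, κ) := fun σ => by
    simp only [hg]; exact h.summable.mul_left _
  refine (hsum.tsum_prod' hfib).trans ((tsum_fintype _).trans ?_)
  refine Finset.sum_congr rfl fun σ _ => ?_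
  simp only [hg, recollisionSum]
  exact tsum_mul_left

/-- A single pseudotrajectory depends on the order of the labels, through the role of `s`. The
cumulant does not, so developments of different families can be compared as functions of sets of
particles. -/
theorem development_eq_cumulant (hε : ε < 1 / 2) {Z : Fin (m + r) → Phase d}
    (hZ : Z ∈ domain d ε (m + r)) (h : Tame ε Finset.univ Z t) (f : (Fin m → Phase d) → ℝ) :
    development m r ε t f Z = 1 / (r.factorial : ℝ) *
      cumulant ε (firstParticles m r) (fun Y => f fun k => Y (Fin.castAdd r k)) Finset.univ Z t := by
  have hH : ∀ z z' : Fin (m + r) → Phase d, (∀ a ∈ firstParticles m r, z a = z' a) →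
      (fun Y : Fin (m + r) → Phase d => f fun k => Y (Fin.castAdd r k)) z =
        (fun Y : Fin (m + r) → Phase d => f fun k => Y (Fin.castAdd r k)) z' := by
    intro z z' hzz
    simp only
    congr 1
    funext k
    exact hzz _ (mem_firstParticles.2 k.2)
  have hag : agreeing 0 (fun _ : Fin r => (1 : ℤˣ × ℤˣ)) = Finset.univ := by
    simp [agreeing]
  have hw : ∀ σ : Fin r → ℤˣ × ℤˣ, signWeight 0 σ = ∏ i, (((σ i).2 : ℤ) : ℝ) := by
    simp [signWeight]
  rw [← signedSum_eq_cumulant hε hH h (fun _ => 1) (Nat.zero_le r)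
    (by simp [card_firstParticles]), development, signedSum, hag]
  simp only [hw]
  exact congrArg _ (h.tsum_params (h.indicator_admissible hZ f) fun σ => ∏ i, (((σ i).2 : ℤ) : ℝ))

lemma cumulant_relabel (hε : ε < 1 / 2) (j : Fin n ↪ Fin N) {Z : Fin N → Phase d}
    (h : Tame ε (A.map j) Z t) {H' : (Fin N → Phase d) → ℝ}
    (hH : ∀ Y Z', (∀ a ∈ M, Y a = Z' (j a)) → H Y = H' Z') :
    cumulant ε M H A (fun a => Z (j a)) t = cumulant ε (M.map j) H' (A.map j) Z t := by
  rw [cumulant, cumulant]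
  refine Finset.sum_bij (fun B _ => B.map j) ?_ ?_ ?_ ?_
  · intro B hB
    rw [Finset.mem_Icc] at hB ⊢
    exact ⟨Finset.map_subset_map.2 hB.1, Finset.map_subset_map.2 hB.2⟩
  · intro B _ B' _ hBB
    exact Finset.map_injective j hBB
  · intro B hB
    rw [Finset.mem_Icc] at hB
    obtain ⟨B', hB', rfl⟩ := Finset.subset_map_iff.1 hB.2
    exact ⟨B', Finset.mem_Icc.2 ⟨Finset.map_subset_map.1 hB.1, hB'⟩, rfl⟩
  · intro B hB
    rw [Finset.mem_Icc] at hB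
    obtain ⟨Z', hZ'⟩ := h.exists_elastic (Finset.map_subset_map.2 hB.2)
    obtain ⟨Y', hY', hYZ⟩ := hZ'.relabel hε (Y := fun a => Z (j a)) fun a _ => rfl
    rw [hZ'.flow_eq, hY'.flow_eq, hH Y' Z' fun a ha => hYZ a (hB.1 ha), Finset.card_map,
      Finset.card_map]

/-! ### Summation over the families of particles -/

/-- Such an extension amounts to an injection of `Fin r` into the set `B \ range i`, which has `r`
elements. -/
lemma card_extensions_range (i : Fin m ↪ Fin N) {B : Finset (Fin N)}
    (hM : Finset.univ.map i ⊆ B) (hB : B.card = m + r) :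
    ((extensions i r).filter fun j => Finset.univ.map j = B).card = r.factorial := by
  classical
  have hcard : Fintype.card (Fin r ↪ ↥(B \ Finset.univ.map i)) = r.factorial := by
    rw [Fintype.card_embedding_eq, Fintype.card_coe, Fintype.card_fin,
      Finset.card_sdiff_of_subset hM, Finset.card_map, Finset.card_univ, Fintype.card_fin, hB,
      Nat.add_sub_cancel_left, Nat.descFactorial_self]
  rw [← hcard, ← Finset.card_univ]
  symm
  have hnot : ∀ (e : Fin r ↪ ↥(B \ Finset.univ.map i)) k l, i k ≠ (e l : Fin N) := by
    intro e k l hkl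
    have := (Finset.mem_sdiff.1 (e l).2).2
    rw [← hkl] at this
    simp at this
  refine Finset.card_bij (fun e _ => ⟨Fin.append i fun l => (e l : Fin N), ?_⟩) ?_ ?_ ?_
  · rw [Fin.append_injective_iff]
    exact ⟨i.injective, Subtype.val_injective.comp e.injective, hnot e⟩
  · intro e _
    simp only [extensions, Finset.mem_filter, Finset.mem_univ, true_and,
      Function.Embedding.coeFn_mk, Fin.append_left, implies_true]
    -- The range lies in `B` and both have `m + r` elements.
    refine Finset.eq_of_subset_of_card_le ?_ (by simp [hB])
    intro x hx
    obtain ⟨a, -, rfl⟩ := Finset.mem_map.1 hx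
    simp only [Function.Embedding.coeFn_mk]
    refine Fin.addCases (fun k => ?_) (fun l => ?_) a
    · rw [Fin.append_left]; exact hM (by simp)
    · rw [Fin.append_right]; exact (Finset.mem_sdiff.1 (e l).2).1
  · intro e _ e' _ h
    refine Function.Embedding.ext fun l => Subtype.ext ?_
    have := DFunLike.congr_fun h (Fin.natAdd m l)
    simp only [Function.Embedding.coeFn_mk, Fin.append_right] at this
    exact this
  · intro j hj
    simp only [extensions, Finset.mem_filter, Finset.mem_univ, true_and] at hj
    refine ⟨⟨fun l => ⟨j (Fin.natAdd m l), ?_⟩, ?_⟩, Finset.mem_univ _, ?_⟩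
    · rw [Finset.mem_sdiff, ← hj.2]
      refine ⟨by simp, fun hmem => ?_⟩
      obtain ⟨k, -, hk⟩ := Finset.mem_map.1 hmem
      rw [← hj.1 k] at hk
      have := congrArg Fin.val (j.injective hk)
      simp at this
      omega
    · intro l l' hll
      simpa using congrArg Subtype.val hll
    · ext a
      simp only [Function.Embedding.coeFn_mk]
      refine Fin.addCases (fun k => ?_) (fun l => ?_) a
      · rw [Fin.append_left, hj.1]
      · rw [Fin.append_right]; rfl

lemma sum_extensions (i : Fin m ↪ Fin N) (c : Finset (Fin N) → ℝ) :
    ∑ j ∈ extensions i r, 1 / (r.factorial : ℝ) * c (Finset.univ.map j) =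
      ∑ B ∈ (Finset.Icc (Finset.univ.map i) Finset.univ).filter fun B => B.card = m + r, c B := by
  classical
  have hmaps : ∀ j ∈ extensions i r, Finset.univ.map j ∈
      (Finset.Icc (Finset.univ.map i) Finset.univ).filter fun B => B.card = m + r := by
    intro j hj
    simp only [Finset.mem_filter, Finset.mem_Icc, Finset.subset_univ, and_true]
    refine ⟨?_, by simp⟩
    intro x hx
    obtain ⟨k, -, rfl⟩ := Finset.mem_map.1 hx
    rw [← (Finset.mem_filter.1 hj).2 k]
    simp
  rw [← Finset.sum_fiberwise_of_maps_to hmaps]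
  refine Finset.sum_congr rfl fun B hB => ?_
  obtain ⟨hB, hcard⟩ := Finset.mem_filter.1 hB
  rw [Finset.sum_congr rfl fun j hj => by rw [(Finset.mem_filter.1 hj).2], Finset.sum_const,
    card_extensions_range i (Finset.mem_Icc.1 hB).1 hcard, nsmul_eq_mul]
  have : (r.factorial : ℝ) ≠ 0 := by positivity
  field_simp

/-- Möbius inversion: after exchanging the sums, the flow of `B` is multiplied by an alternating sum
over the sets between `B` and the whole, which vanishes unless `B` is everything. -/
lemma sum_cumulant {M : Finset (Fin N)} {H : (Fin N → Phase d) → ℝ} (Z : Fin N → Phase d) :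
    ∑ B ∈ Finset.Icc M Finset.univ, cumulant ε M H B Z t =
      H (elasticFlow ε Finset.univ t Z) := by
  simp only [cumulant]
  rw [Finset.sum_comm' (t' := Finset.Icc M Finset.univ)
    (s' := fun B => Finset.Icc B Finset.univ)]
  · rw [Finset.sum_eq_single Finset.univ]
    · simp [← two_mul]
    · intro B hB hne
      rw [Finset.sum_congr rfl fun B' _ => by rw [pow_add, mul_assoc], ← Finset.sum_mul,
        sum_Icc_neg_one_pow_card hne.symm, zero_mul]
    · simp
  · intro B B'
    simp only [Finset.mem_Icc, Finset.subset_univ, and_true]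
    exact ⟨fun h => ⟨h.2.2, h.2.1⟩, fun h => ⟨h.2.trans h.1, h.2, h.1⟩⟩

lemma Separated.domain_comp {Z : Fin N → Phase d} (hZ : Separated ε Finset.univ Z)
    (j : Fin n ↪ Fin N) : (fun a => Z (j a)) ∈ domain d ε n := fun _ _ hab =>
  hZ.of_ne (Finset.mem_univ _) (Finset.mem_univ _) (by simpa using hab.ne)

lemma Elastic.hardSphere_flow_eq {Z Z' : Fin n → Phase d} (h : Elastic ε Finset.univ Z t Z') :
    flow ε t Z = Z' := by
  have h1 : ∃ Z', HardSphereEvolves ε Z t Z' := ⟨Z', h.hardSphere⟩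
  rw [flow, dif_pos h1]
  exact h1.choose_spec.unique h.hardSphere

/-- Tameness of all sets of particles. -/
def AllTame (ε t : ℝ) (Z : Fin N → Phase d) : Prop :=
  Separated ε Finset.univ Z ∧ ∀ B, Tame ε B Z t

theorem AllTame.hasSum_extensions (hε : ε < 1 / 2) {Z : Fin N → Phase d} (h : AllTame ε t Z)
    (f : (Fin m → Phase d) → ℝ) (i : Fin m ↪ Fin N) :
    HasSum (fun r : ℕ => ∑ j ∈ extensions i r, development m r ε t f fun k => Z (j k))
      (f fun k => flow ε t Z (i k)) := by
  classical
  obtain ⟨Z', hZ'⟩ := (h.2 Finset.univ).exists_elastic subset_rfl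
  set M : Finset (Fin N) := Finset.univ.map i with hM
  let H' : (Fin N → Phase d) → ℝ := fun Y => f fun k => Y (i k)
  have hdev : ∀ r, ∑ j ∈ extensions i r, development m r ε t f (fun k => Z (j k)) =
      ∑ B ∈ (Finset.Icc M Finset.univ).filter fun B => B.card = m + r, cumulant ε M H' B Z t := by
    intro r
    rw [← sum_extensions i fun B => cumulant ε M H' B Z t]
    refine Finset.sum_congr rfl fun j hj => ?_
    have hji := (Finset.mem_filter.1 hj).2
    have hMj : (firstParticles m r).map j = M := by
      rw [firstParticles, Finset.map_map, hM]
      congr 1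
      ext k
      simp [hji]
    have hT := h.2 (Finset.univ.map j)
    rw [development_eq_cumulant hε (h.1.domain_comp j) (hT.relabel hε rfl fun a _ => rfl), ← hMj,
      cumulant_relabel hε j hT]
    intro Y Z' hYZ
    simp only [H']
    congr 1
    funext k
    rw [hYZ _ (mem_firstParticles.2 k.2), hji]
  -- For `r > N` there is no set of `m + r` particles, so the series is a finite sum.
  have hzero : ∀ r ∉ Finset.range (N + 1),
      ∑ j ∈ extensions i r, development m r ε t f (fun k => Z (j k)) = 0 := by
    intro r hr
    rw [hdev, Finset.sum_eq_zero]
    intro B hB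
    have h1 := (Finset.mem_filter.1 hB).2
    have h2 := B.card_le_univ
    simp at hr h2
    omega
  have hval : ∑ r ∈ Finset.range (N + 1),
      ∑ j ∈ extensions i r, development m r ε t f (fun k => Z (j k)) =
        f fun k => flow ε t Z (i k) := by
    rw [Finset.sum_congr rfl fun r _ => hdev r, hZ'.hardSphere_flow_eq]
    have := sum_cumulant (ε := ε) (t := t) (M := M) (H := H') Z
    rw [hZ'.flow_eq] at this
    change _ = H' Z'
    rw [← this, ← Finset.sum_fiberwise_of_maps_to (t := Finset.range (N + 1))
      (g := fun B : Finset (Fin N) => B.card - m)]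
    · refine Finset.sum_congr rfl fun r _ => Finset.sum_congr ?_ fun _ _ => rfl
      ext B
      simp only [Finset.mem_filter, and_congr_right_iff]
      intro hB
      have := Finset.card_le_card (Finset.mem_Icc.1 hB).1
      simp [hM] at this
      omega
    · intro B hB
      have := B.card_le_univ
      simp at this ⊢
      omega
  rw [← hval]
  exact hasSum_sum_of_ne_finset_zero hzero

/-- Each family of `m + r` particles extends exactly one family of `m` particles, namely its
restriction. -/
theorem AllTame.hasSum (hε : ε < 1 / 2) {Z : Fin N → Phase d} (h : AllTame ε t Z)
    (f : (Fin m → Phase d) → ℝ) :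
    HasSum (fun r : ℕ => ∑ j : Fin (m + r) ↪ Fin N, development m r ε t f fun k => Z (j k))
      (∑ i : Fin m ↪ Fin N, f fun k => flow ε t Z (i k)) := by
  have h1 := hasSum_sum fun i (_ : i ∈ (Finset.univ : Finset (Fin m ↪ Fin N))) =>
    h.hasSum_extensions hε f i
  convert h1 using 2 with r
  rw [← Finset.sum_fiberwise (Finset.univ : Finset (Fin (m + r) ↪ Fin N))
    (fun j => (Fin.castAddEmb r).trans j)]
  refine Finset.sum_congr rfl fun i _ => Finset.sum_congr ?_ fun _ _ => rfl
  ext j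
  simp only [extensions, Finset.mem_filter, Finset.mem_univ, true_and,
    Function.Embedding.ext_iff, Function.Embedding.trans_apply, Fin.castAddEmb_apply]

theorem AllTame.existence (hε : ε < 1 / 2) {Z : Fin N → Phase d} (h : AllTame ε t Z) (m : ℕ) :
    (∃ Z', HardSphereEvolves ε Z t Z') ∧ ∀ (r : ℕ) (j : Fin (m + r) ↪ Fin N),
      (∀ p : Params r (m + r), ∃ S,
        PseudoEvolves ε p.1 (initState p.2 fun k => Z (j k)) t S) ∧
      {p : Params r (m + r) | (fun k => Z (j k)) ∈ admissible m r ε t p}.Finite := by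
  refine ⟨?_, fun r j => ?_⟩
  · obtain ⟨Z', hZ'⟩ := (h.2 Finset.univ).exists_elastic subset_rfl
    exact ⟨Z', hZ'.hardSphere⟩
  · have hT : Tame ε Finset.univ (fun k => Z (j k)) t :=
      (h.2 (Finset.univ.map j)).relabel hε rfl fun a _ => rfl
    exact ⟨fun p => hT.exists_pseudoEvolves p.1 0 p.2, hT.finite_admissible⟩

end HardSpheres

/-! ### Scattering of one pair in Euclidean relative coordinates. -/

namespace HardSpheres

lemma lt_norm_of_sq {E : Type*} [SeminormedAddCommGroup E] {a ε : ℝ} {x : E} (ha : 0 < a) (h : 0 < a * (‖x‖ ^ 2 - ε ^ 2)) :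
    ε < ‖x‖ := by
  have := (pos_iff_pos_of_mul_pos h).1 ha
  exact lt_of_pow_lt_pow_left₀ 2 (norm_nonneg _) (by linarith)

section RelativeMotion

variable {V : Type*} [NormedAddCommGroup V] [InnerProductSpace ℝ V] {ε : ℝ}

/-! ### Scattering of two particles in relative coordinates -/

/-- A quarter of the discriminant of the equation `‖y + u • w‖ = ε` in `u`. -/
noncomputable def impactDisc (ε : ℝ) (p : V × V) : ℝ :=
  inner ℝ p.1 p.2 ^ 2 - ‖p.2‖ ^ 2 * (‖p.1‖ ^ 2 - ε ^ 2)

/-- The first time at which `‖y + u • w‖ = ε`. -/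
noncomputable def impactTime (ε : ℝ) (p : V × V) : ℝ :=
  (-inner ℝ p.1 p.2 - √(impactDisc ε p)) / ‖p.2‖ ^ 2

/-- The relative position at the time of impact. -/
noncomputable def impactPoint (ε : ℝ) (p : V × V) : V := p.1 + impactTime ε p • p.2

/-- The component of the relative velocity along the line of centres at the time of impact. -/
noncomputable def impulse (ε : ℝ) (p : V × V) : V :=
  (inner ℝ (impactPoint ε p) p.2 / ε ^ 2) • impactPoint ε p

/-- The relative position and velocity that lead, without scattering, to the motion after the
impact. -/
noncomputable def scatterMap (ε : ℝ) (p : V × V) : V × V :=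
  (p.1 + (2 * impactTime ε p) • impulse ε p, p.2 - (2 : ℝ) • impulse ε p)

/-- The relative positions and velocities that lead to a transversal impact. -/
def Impacting (ε : ℝ) (p : V × V) : Prop :=
  ε < ‖p.1‖ ∧ inner ℝ p.1 p.2 < 0 ∧ 0 < impactDisc ε p

lemma norm_add_smul_sq (p : V × V) (u : ℝ) : ‖p.1 + u • p.2‖ ^ 2 =
    ‖p.1‖ ^ 2 + 2 * u * inner ℝ p.1 p.2 + u ^ 2 * ‖p.2‖ ^ 2 := by
  rw [norm_add_sq_real, norm_smul, inner_smul_right, mul_pow, Real.norm_eq_abs, sq_abs]; ring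

/-- Completing the square: the sign of the right side tells whether the moving point is outside the
sphere at time `u`. -/
lemma norm_sq_mul_eq (p : V × V) (u : ℝ) : ‖p.2‖ ^ 2 * (‖p.1 + u • p.2‖ ^ 2 - ε ^ 2) =
    (‖p.2‖ ^ 2 * u + inner ℝ p.1 p.2) ^ 2 - impactDisc ε p := by
  rw [norm_add_smul_sq, impactDisc]; ring

lemma Impacting.norm_sq_pos {p : V × V} (h : Impacting ε p) : 0 < ‖p.2‖ ^ 2 := by
  have : p.2 ≠ 0 := by
    intro h0
    have := h.2.1
    simp [h0] at this
  positivity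

lemma Impacting.mul_impactTime {p : V × V} (h : Impacting ε p) :
    ‖p.2‖ ^ 2 * impactTime ε p = -inner ℝ p.1 p.2 - √(impactDisc ε p) := by
  rw [impactTime, mul_div_cancel₀ _ h.norm_sq_pos.ne']

lemma Impacting.norm_impactPoint {p : V × V} (hε : 0 < ε) (h : Impacting ε p) :
    ‖impactPoint ε p‖ = ε := by
  have h1 := norm_sq_mul_eq (ε := ε) p (impactTime ε p)
  rw [h.mul_impactTime] at h1
  have h2 := Real.sq_sqrt h.2.2.le
  have h3 : ‖impactPoint ε p‖ ^ 2 - ε ^ 2 = 0 := by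
    have h4 : ‖p.2‖ ^ 2 * (‖impactPoint ε p‖ ^ 2 - ε ^ 2) = 0 := by
      rw [impactPoint, h1]; linear_combination h2
    exact (mul_eq_zero.1 h4).resolve_left h.norm_sq_pos.ne'
  exact (sq_eq_sq₀ (norm_nonneg _) hε.le).1 (by linarith)

lemma Impacting.inner_impactPoint {p : V × V} (h : Impacting ε p) :
    inner ℝ (impactPoint ε p) p.2 = -√(impactDisc ε p) := by
  rw [impactPoint, inner_add_left, inner_smul_left, real_inner_self_eq_norm_sq]
  have := h.mul_impactTime
  simp only [conj_trivial]
  linarith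

lemma Impacting.inner_impactPoint_neg {p : V × V} (h : Impacting ε p) :
    inner ℝ (impactPoint ε p) p.2 < 0 := by
  rw [h.inner_impactPoint]
  linarith [Real.sqrt_pos.2 h.2.2]

lemma Impacting.impactTime_pos {p : V × V} (hε : 0 < ε) (h : Impacting ε p) :
    0 < impactTime ε p := by
  have h1 : √(impactDisc ε p) < -inner ℝ p.1 p.2 := by
    rw [Real.sqrt_lt' (by linarith [h.2.1]), impactDisc, neg_sq, sub_lt_self_iff]
    have : ε ^ 2 < ‖p.1‖ ^ 2 := pow_lt_pow_left₀ h.1 hε.le two_ne_zero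
    exact mul_pos h.norm_sq_pos (by linarith)
  exact div_pos (by linarith) h.norm_sq_pos

lemma Impacting.lt_norm_before {p : V × V} (h : Impacting ε p) {u : ℝ}
    (hu : u < impactTime ε p) : ε < ‖p.1 + u • p.2‖ := by
  refine lt_norm_of_sq h.norm_sq_pos ?_
  rw [norm_sq_mul_eq]
  have h1 := h.mul_impactTime
  have h2 := mul_lt_mul_of_pos_left hu h.norm_sq_pos
  have h3 := Real.sq_sqrt h.2.2.le
  have h4 := Real.sqrt_pos.2 h.2.2
  nlinarith

/-- Motion away from the point `x` of the sphere. -/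
lemma lt_norm_of_inner_nonneg {x w : V} (hx : ‖x‖ = ε) (hw : w ≠ 0)
    (h : 0 ≤ inner ℝ x w) {u : ℝ} (hu : 0 < u) : ε < ‖x + u • w‖ := by
  refine lt_norm_of_sq one_pos ?_
  rw [norm_add_smul_sq (x, w)]
  have : 0 < ‖w‖ := norm_pos_iff.2 hw
  simp only [hx]
  have : 0 < u ^ 2 * ‖w‖ ^ 2 := by positivity
  nlinarith [mul_nonneg hu.le h]

/-- The first impact of a moving point that starts outside of the ball. -/
lemma not_impacting {p : V × V} (hε : 0 < ε) (hp : ε < ‖p.1‖) (h : ¬ Impacting ε p) {u : ℝ}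
    (hu : 0 ≤ u) : ε < ‖p.1 + u • p.2‖ ∨
      (‖p.1 + u • p.2‖ = ε ∧ inner ℝ (p.1 + u • p.2) p.2 = 0) := by
  have hp2 : ε ^ 2 < ‖p.1‖ ^ 2 := pow_lt_pow_left₀ hp hε.le two_ne_zero
  by_cases hi : inner ℝ p.1 p.2 < 0
  · have hw : 0 < ‖p.2‖ ^ 2 := by
      have : p.2 ≠ 0 := by
        intro h0
        simp [h0] at hi
      positivity
    have hd : impactDisc ε p ≤ 0 := not_lt.1 fun h' => h ⟨hp, hi, h'⟩
    have h1 := norm_sq_mul_eq (ε := ε) p u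
    by_cases h2 : 0 < ‖p.2‖ ^ 2 * (‖p.1 + u • p.2‖ ^ 2 - ε ^ 2)
    · exact Or.inl (lt_norm_of_sq hw h2)
    · have h3 : (‖p.2‖ ^ 2 * u + inner ℝ p.1 p.2) ^ 2 = 0 := by
        nlinarith [sq_nonneg (‖p.2‖ ^ 2 * u + inner ℝ p.1 p.2)]
      have h4 : ‖p.2‖ ^ 2 * (‖p.1 + u • p.2‖ ^ 2 - ε ^ 2) = 0 := by
        nlinarith
      have h5 := (mul_eq_zero.1 h4).resolve_left hw.ne'
      refine Or.inr ⟨?_, ?_⟩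
      · exact (sq_eq_sq₀ (norm_nonneg _) hε.le).1 (by linarith)
      · rw [inner_add_left, inner_smul_left, real_inner_self_eq_norm_sq]
        have := pow_eq_zero_iff (two_ne_zero) |>.1 h3
        simp only [conj_trivial]; linarith
  · left
    refine lt_norm_of_sq one_pos ?_
    rw [norm_add_smul_sq]
    nlinarith [mul_nonneg hu (not_lt.1 hi), mul_nonneg (sq_nonneg u) (sq_nonneg ‖p.2‖)]

/-- The shift of the position in `scatterMap` is chosen so that the outgoing line, extended back to
time `0`, passes through the impact point at the impact time. -/
lemma scatterMap_fst_add (ε : ℝ) (p : V × V) (u : ℝ) :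
    (scatterMap ε p).1 + u • (scatterMap ε p).2 =
      impactPoint ε p + (u - impactTime ε p) • (scatterMap ε p).2 := by
  simp only [scatterMap, impactPoint]
  module

lemma Impacting.inner_scatterMap {p : V × V} (hε : 0 < ε) (h : Impacting ε p) :
    inner ℝ (impactPoint ε p) (scatterMap ε p).2 = -inner ℝ (impactPoint ε p) p.2 := by
  simp only [scatterMap, impulse]
  rw [inner_sub_right, inner_smul_right, inner_smul_right, real_inner_self_eq_norm_sq,
    h.norm_impactPoint hε]
  field_simp
  ring

lemma Impacting.scatterMap_ne_zero {p : V × V} (hε : 0 < ε) (h : Impacting ε p) :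
    (scatterMap ε p).2 ≠ 0 := by
  intro h0
  have h1 := h.inner_scatterMap hε
  rw [h0, inner_zero_right] at h1
  linarith [h.inner_impactPoint_neg]

lemma Impacting.lt_norm_after {p : V × V} (hε : 0 < ε) (h : Impacting ε p) {u : ℝ}
    (hu : impactTime ε p < u) : ε < ‖(scatterMap ε p).1 + u • (scatterMap ε p).2‖ := by
  rw [scatterMap_fst_add]
  refine lt_norm_of_inner_nonneg (h.norm_impactPoint hε) (h.scatterMap_ne_zero hε) ?_
    (by linarith)
  rw [h.inner_scatterMap hε]
  linarith [h.inner_impactPoint_neg]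

lemma Impacting.norm_at {p : V × V} (hε : 0 < ε) (h : Impacting ε p) :
    ‖(scatterMap ε p).1 + impactTime ε p • (scatterMap ε p).2‖ = ε := by
  rw [scatterMap_fst_add, sub_self, zero_smul, add_zero, h.norm_impactPoint hε]

/-- The outgoing line determines the impact time, as the last time at which it meets the sphere. It
then determines the impact point and the impulse, hence the incoming state. -/
lemma Impacting.eq_of_scatterMap_eq {p p' : V × V} (hε : 0 < ε) (h : Impacting ε p)
    (h' : Impacting ε p') (he : scatterMap ε p = scatterMap ε p') : p = p' := by
  have hle : ∀ {p p' : V × V}, Impacting ε p → Impacting ε p' →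
      scatterMap ε p = scatterMap ε p' → impactTime ε p' ≤ impactTime ε p := by
    intro p p' h h' he
    by_contra! hlt
    have h1 := h.lt_norm_after hε hlt
    rw [he, h'.norm_at hε] at h1
    exact lt_irrefl _ h1
  have ht : impactTime ε p = impactTime ε p' := le_antisymm (hle h' h he.symm) (hle h h' he)
  have hn : impactPoint ε p = impactPoint ε p' := by
    have h1 := scatterMap_fst_add ε p (impactTime ε p)
    have h2 := scatterMap_fst_add ε p' (impactTime ε p)
    rw [he, h2, ht] at h1
    simpa using h1.symm
  -- Scattering reverses the normal component of the relative velocity, so the outgoing velocity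
  -- determines the incoming normal component.
  have hg : impulse ε p = impulse ε p' := by
    have h1 := h.inner_scatterMap hε
    have h2 := h'.inner_scatterMap hε
    simp only [impulse]
    rw [← hn] at h2 ⊢
    rw [← he] at h2
    congr 2
    linarith
  have e1 := congrArg Prod.fst he
  have e2 := congrArg Prod.snd he
  simp only [scatterMap, ht, hg] at e1 e2
  exact Prod.ext (add_right_cancel e1) (sub_left_injective e2)

lemma Impacting.norm_impulse_le {p : V × V} (hε : 0 < ε) (h : Impacting ε p) :
    ‖impulse ε p‖ ≤ ‖p.2‖ := by
  rw [impulse, norm_smul, h.norm_impactPoint hε, Real.norm_eq_abs, abs_div, abs_of_pos (pow_pos hε 2)]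
  have := abs_real_inner_le_norm (impactPoint ε p) p.2
  rw [h.norm_impactPoint hε] at this
  rw [div_mul_eq_mul_div, div_le_iff₀ (by positivity)]
  nlinarith

/-! ### The scattering map preserves the volume -/

lemma Impacting.differentiableAt_impactTime {p : V × V} (h : Impacting ε p) :
    DifferentiableAt ℝ (impactTime ε) p := by
  have h1 : DifferentiableAt ℝ (fun p : V × V => (inner ℝ p.1 p.2 : ℝ)) p :=
    differentiableAt_fst.inner ℝ differentiableAt_snd
  have h2 : DifferentiableAt ℝ (impactDisc (V := V) ε) p :=
    (h1.pow 2).sub ((differentiableAt_snd.norm_sq ℝ).mul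
      ((differentiableAt_fst.norm_sq ℝ).sub_const _))
  have h3 : DifferentiableAt ℝ (fun p : V × V => ‖p.2‖ ^ 2) p := differentiableAt_snd.norm_sq ℝ
  have h4 : DifferentiableAt ℝ
      (fun p : V × V => -(inner ℝ p.1 p.2 : ℝ) - √(impactDisc ε p)) p :=
    h1.neg.sub (h2.sqrt h.2.2.ne')
  unfold impactTime
  simp only [div_eq_mul_inv]
  exact h4.mul (h3.fun_inv h.norm_sq_pos.ne')

lemma isOpen_impacting : IsOpen {p : V × V | Impacting ε p} := by
  have h1 : Continuous fun p : V × V => (inner ℝ p.1 p.2 : ℝ) := by fun_prop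
  have h2 : Continuous (impactDisc (V := V) ε) := by unfold impactDisc; fun_prop
  have h3 : Continuous fun p : V × V => ‖p.1‖ := by fun_prop
  exact (isOpen_lt continuous_const h3).inter
    ((isOpen_lt h1 continuous_const).inter (isOpen_lt continuous_const h2))

/-- The square of the determinant of the scattering map is one. Composed with shears and with a
reflection, its derivative `L` becomes an involution of the form `(ξ, η) ↦ (ξ, K ξ - η)`. -/
lemma det_sq_of_shear_reflection (L : V × V →ₗ[ℝ] V × V) (τ : ℝ)
    (ρ : V →ₗ[ℝ] V) (hρ : ∀ ξ, ρ (ρ ξ) = ξ) (K : V →ₗ[ℝ] V)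
    (hL1 : ∀ ξ η, (L (ρ ξ + τ • ρ η, -ρ η)).1 + τ • (L (ρ ξ + τ • ρ η, -ρ η)).2 = ξ)
    (hL2 : ∀ ξ η, (L (ρ ξ + τ • ρ η, -ρ η)).2 = K ξ - η) :
    LinearMap.det L ^ 2 = 1 := by
  let S : ℝ → Module.End ℝ (V × V) := fun u =>
    (LinearMap.fst ℝ V V + u • LinearMap.snd ℝ V V).prod (LinearMap.snd ℝ V V)
  let Q : Module.End ℝ (V × V) :=
    (ρ ∘ₗ LinearMap.fst ℝ V V).prod (-(ρ ∘ₗ LinearMap.snd ℝ V V))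
  have hS : S τ * S (-τ) = 1 := by
    ext x <;> simp [S]
  have hQ : Q * Q = 1 := by
    ext x <;> simp [Q, hρ]
  let T : Module.End ℝ (V × V) := S τ * L * S (-τ) * Q
  have hT1 : ∀ x, T x = (x.1, K x.1 - x.2) := by
    intro x
    have e : (S (-τ) * Q) x = (ρ x.1 + τ • ρ x.2, -ρ x.2) := by
      simp [S, Q]
    have e2 : T x = S τ (L ((S (-τ) * Q) x)) := rfl
    rw [e2, e]
    refine Prod.ext ?_ ?_
    · exact hL1 _ _
    · exact hL2 _ _
  have hT : T * T = 1 := by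
    refine LinearMap.ext fun x => ?_
    change T (T x) = x
    rw [hT1, hT1]
    simp
  have d1 : LinearMap.det (S τ) * LinearMap.det (S (-τ)) = 1 := by
    rw [← map_mul, hS, map_one]
  have d2 : LinearMap.det Q * LinearMap.det Q = 1 := by rw [← map_mul, hQ, map_one]
  have d3 : LinearMap.det T * LinearMap.det T = 1 := by rw [← map_mul, hT, map_one]
  have d4 : LinearMap.det T = LinearMap.det (S τ) * LinearMap.det L * LinearMap.det (S (-τ)) *
      LinearMap.det Q := by simp only [T, map_mul]
  rw [d4] at d3
  calc LinearMap.det L ^ 2 = (LinearMap.det (S τ) * LinearMap.det (S (-τ))) ^ 2 *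
        (LinearMap.det Q * LinearMap.det Q) * LinearMap.det L ^ 2 := by rw [d1, d2]; ring
    _ = 1 := by linear_combination d3

/-- The reflection along the line of the vector `n` of length `ε`. -/
noncomputable def reflectAlong (ε : ℝ) (n : V) : V →L[ℝ] V :=
  ContinuousLinearMap.id ℝ V - (2 / ε ^ 2) • (innerSL ℝ n).smulRight n

lemma reflectAlong_apply (ε : ℝ) (n ξ : V) :
    reflectAlong ε n ξ = ξ - (2 / ε ^ 2 * inner ℝ n ξ) • n := by
  simp [reflectAlong, smul_smul]

lemma reflectAlong_involutive {n : V} (hε : 0 < ε) (hn : ‖n‖ = ε) (ξ : V) :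
    reflectAlong ε n (reflectAlong ε n ξ) = ξ := by
  simp only [reflectAlong_apply, inner_sub_right, inner_smul_right, real_inner_self_eq_norm_sq, hn]
  rw [sub_sub, ← add_smul]
  have : 2 / ε ^ 2 * inner ℝ n ξ +
      2 / ε ^ 2 * (inner ℝ n ξ - 2 / ε ^ 2 * inner ℝ n ξ * ε ^ 2) = 0 := by
    field_simp; ring
  rw [this, zero_smul, sub_zero]

/-- The derivative is computed by the product rule from those of the impact time, the impact point
and the impulse. In the variables `x = (ρ ξ + τ • ρ η, -ρ η)`, with `ρ` the reflection along the
normal `n`, it takes the form required by `det_sq_of_shear_reflection`. -/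
theorem Impacting.exists_hasFDerivAt {p : V × V} (hε : 0 < ε) (h : Impacting ε p) :
    ∃ L : V × V →L[ℝ] V × V, HasFDerivAt (scatterMap ε) L p ∧ |L.det| = 1 := by
  set τ := impactTime ε p with hτ
  set n := impactPoint ε p with hn
  set w := p.2 with hw
  have hnn : ‖n‖ = ε := h.norm_impactPoint hε
  obtain ⟨τ', hτ'⟩ : ∃ τ', HasFDerivAt (impactTime (V := V) ε) τ' p :=
    ⟨_, h.differentiableAt_impactTime.hasFDerivAt⟩
  have hfst : HasFDerivAt (fun p : V × V => p.1) (ContinuousLinearMap.fst ℝ V V) p :=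
    hasFDerivAt_fst
  have hsnd : HasFDerivAt (fun p : V × V => p.2) (ContinuousLinearMap.snd ℝ V V) p :=
    hasFDerivAt_snd
  set n' : V × V →L[ℝ] V := ContinuousLinearMap.fst ℝ V V +
    (τ • ContinuousLinearMap.snd ℝ V V + τ'.smulRight w) with hn'
  have hnd : HasFDerivAt (impactPoint (V := V) ε) n' p := hfst.add (hτ'.smul hsnd)
  -- The impact point stays on the sphere of radius `ε`, so its derivative is tangent to the sphere.
  have hconstr : ∀ x, inner ℝ n (n' x) = 0 := by
    have h1 : HasFDerivAt (fun p : V × V => ‖impactPoint ε p‖ ^ 2) _ p := hnd.norm_sq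
    have h2 : (fun p : V × V => ‖impactPoint ε p‖ ^ 2) =ᶠ[nhds p] fun _ => ε ^ 2 := by
      filter_upwards [isOpen_impacting.mem_nhds h] with x hx
      rw [Impacting.norm_impactPoint hε hx]
    have h3 := h1.unique ((hasFDerivAt_const (ε ^ 2) p).congr_of_eventuallyEq h2)
    intro x
    have h4 := DFunLike.congr_fun h3 x
    simpa using h4
  set s : ℝ := inner ℝ n w with hs
  have hs0 : s ≠ 0 := h.inner_impactPoint_neg.ne
  obtain ⟨i', hi'd, hi'⟩ : ∃ i' : V × V →L[ℝ] ℝ,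
      HasFDerivAt (fun p : V × V => (inner ℝ (impactPoint ε p) p.2 : ℝ)) i' p ∧
        ∀ x, i' x = inner ℝ n x.2 + inner ℝ (n' x) w :=
    ⟨_, hnd.inner ℝ hsnd, fun x => by simp [fderivInnerCLM_apply, ← hn, ← hw]⟩
  set g := impulse ε p with hg
  set g' : V × V →L[ℝ] V := (s / ε ^ 2) • n' + ((ε ^ 2)⁻¹ • i').smulRight n with hg'
  have hgd : HasFDerivAt (impulse (V := V) ε) g' p := by
    have h1 : HasFDerivAt (fun p : V × V => (inner ℝ (impactPoint ε p) p.2 : ℝ) / ε ^ 2)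
        ((ε ^ 2)⁻¹ • i') p := by
      simpa [div_eq_inv_mul] using hi'd.const_mul (ε ^ 2)⁻¹
    exact h1.smul hnd
  refine ⟨(ContinuousLinearMap.fst ℝ V V +
      ((2 * τ) • g' + ((2 : ℝ) • τ').smulRight g)).prod
      (ContinuousLinearMap.snd ℝ V V - (2 : ℝ) • g'), ?_, ?_⟩
  · have h1 : HasFDerivAt (fun p : V × V => 2 * impactTime ε p) ((2 : ℝ) • τ') p :=
      hτ'.const_mul 2
    exact (hfst.add (h1.smul hgd)).prodMk (hsnd.sub (hgd.const_smul (2 : ℝ)))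
  · set ρ : V →ₗ[ℝ] V := (reflectAlong ε n : V →ₗ[ℝ] V) with hρ
    have hρa : ∀ ξ, ρ ξ = ξ - (2 / ε ^ 2 * inner ℝ n ξ) • n := reflectAlong_apply ε n
    have hnρ : ∀ ξ, inner ℝ n (ρ ξ) = -(inner ℝ n ξ : ℝ) := by
      intro ξ
      rw [hρa, inner_sub_right, inner_smul_right, real_inner_self_eq_norm_sq, hnn]
      field_simp; ring
    let T : V →ₗ[ℝ] V := ρ + (s⁻¹ • (innerₛₗ ℝ n)).smulRight w
    have hT : ∀ ξ, T ξ = ρ ξ + (s⁻¹ * inner ℝ n ξ) • w := fun ξ => by simp [T]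
    let K : V →ₗ[ℝ] V := -((2 * s / ε ^ 2) • T) - ((2 / ε ^ 2) • (innerₛₗ ℝ w ∘ₗ T)).smulRight n
    have hK : ∀ ξ, K ξ = -((2 * s / ε ^ 2) • T ξ) - (2 / ε ^ 2 * inner ℝ w (T ξ)) • n :=
      fun ξ => by simp [K]
    -- For this argument `n'` equals `ρ ξ + τ' • w`. The tangency `hconstr` then determines `τ'`,
    -- because transversality gives `s ≠ 0`.
    have hτx : ∀ ξ η, τ' (ρ ξ + τ • ρ η, -ρ η) = s⁻¹ * inner ℝ n ξ := by
      intro ξ η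
      have h1 := hconstr (ρ ξ + τ • ρ η, -ρ η)
      simp only [hn', add_apply, ContinuousLinearMap.coe_fst',
        smul_apply, ContinuousLinearMap.coe_snd',
        ContinuousLinearMap.smulRight_apply, inner_add_right, inner_smul_right, inner_neg_right,
        hnρ, ← hs] at h1
      field_simp
      linarith
    have hnx : ∀ ξ η, n' (ρ ξ + τ • ρ η, -ρ η) = T ξ := by
      intro ξ η
      simp only [hn', add_apply, ContinuousLinearMap.coe_fst',
        smul_apply, ContinuousLinearMap.coe_snd',
        ContinuousLinearMap.smulRight_apply, hτx, hT]
      module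
    have hsq := det_sq_of_shear_reflection (((ContinuousLinearMap.fst ℝ V V +
      ((2 * τ) • g' + ((2 : ℝ) • τ').smulRight g)).prod
      (ContinuousLinearMap.snd ℝ V V - (2 : ℝ) • g') : V × V →L[ℝ] V × V) : V × V →ₗ[ℝ] V × V) τ ρ
      (fun ξ => reflectAlong_involutive hε hnn ξ) K ?_ ?_
    · rw [ContinuousLinearMap.det]
      exact (pow_eq_one_iff_of_nonneg (abs_nonneg _) two_ne_zero).1 ((sq_abs _).trans hsq)
    · intro ξ η
      have hgs : g = (s / ε ^ 2) • n := rfl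
      simp only [ContinuousLinearMap.coe_coe, ContinuousLinearMap.prod_apply,
        add_apply, ContinuousLinearMap.coe_fst',
        smul_apply, ContinuousLinearMap.coe_snd',
        ContinuousLinearMap.smulRight_apply, sub_apply, hτx, hgs, smul_eq_mul]
      have : ρ ξ + (2 * (s⁻¹ * inner ℝ n ξ) * (s / ε ^ 2)) • n = ξ := by
        rw [hρa, show 2 * (s⁻¹ * inner ℝ n ξ) * (s / ε ^ 2) = 2 / ε ^ 2 * inner ℝ n ξ by
          field_simp]
        module
      refine Eq.trans ?_ this
      module
    · intro ξ η
      simp only [ContinuousLinearMap.coe_coe, ContinuousLinearMap.prod_apply,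
        smul_apply, ContinuousLinearMap.coe_snd',
        sub_apply, hg', add_apply, hnx,
        ContinuousLinearMap.smulRight_apply, hi', inner_neg_right, hnρ, smul_eq_mul, hK,
        real_inner_comm w (T ξ)]
      rw [hρa η]
      have : (2 / ε ^ 2 * inner ℝ n η : ℝ) = 2 * ((ε ^ 2)⁻¹ * inner ℝ n η) := by
        field_simp
      rw [this]
      module

end RelativeMotion
end HardSpheres

/-! ### Volume preservation on the torus and for maps that change one particle. -/

namespace HardSpheres

variable {d n : ℕ} {ε : ℝ}

/-! ### Volume on the phase space -/

instance : SigmaFinite (volume : Measure (Phase d)) :=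
  inferInstanceAs (SigmaFinite ((volume : Measure (Torus d)).prod
    (volume : Measure (EuclideanSpace ℝ (Fin d)))))

instance : (volume : Measure (Phase d)).IsAddLeftInvariant :=
  Measure.prod.instIsAddLeftInvariant (μ := (volume : Measure (Torus d)))
    (ν := (volume : Measure (EuclideanSpace ℝ (Fin d))))

instance : StandardBorelSpace (Fin n → Phase d) := by
  have : StandardBorelSpace (Phase d) := inferInstance
  exact StandardBorelSpace.pi_countable

lemma measurePreserving_restrict_image {α β : Type*} [MeasurableSpace α] [MeasurableSpace β]
    {μ : Measure α} {ν : Measure β} {f : α → β} (hf : Measurable f) {S : Set α}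
    (hS : MeasurableSet S)
    (himg : ∀ S' ⊆ S, MeasurableSet S' → ν (f '' S') = μ S') :
    MeasurePreserving f (μ.restrict S) (ν.restrict (f '' S)) := by
  refine ⟨hf, Measure.ext fun Q hQ => ?_⟩
  rw [Measure.map_apply hf hQ, Measure.restrict_apply (hf hQ), Measure.restrict_apply hQ,
    ← himg _ Set.inter_subset_right ((hf hQ).inter hS), Set.inter_comm, Set.image_inter_preimage,
    Set.inter_comm]

lemma measurable_impactDisc :
    Measurable (impactDisc (V := EuclideanSpace ℝ (Fin d)) ε) := by
  unfold impactDisc; fun_prop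

lemma measurable_impactTime :
    Measurable (impactTime (V := EuclideanSpace ℝ (Fin d)) ε) := by
  have := measurable_impactDisc (d := d) (ε := ε)
  unfold impactTime; fun_prop

lemma measurable_impactPoint :
    Measurable (impactPoint (V := EuclideanSpace ℝ (Fin d)) ε) := by
  have := measurable_impactTime (d := d) (ε := ε)
  unfold impactPoint; fun_prop

lemma measurable_impulse :
    Measurable (impulse (V := EuclideanSpace ℝ (Fin d)) ε) := by
  have := measurable_impactPoint (d := d) (ε := ε)
  unfold impulse; fun_prop

lemma measurable_scatterMap :
    Measurable (scatterMap (V := EuclideanSpace ℝ (Fin d)) ε) := by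
  have := measurable_impulse (d := d) (ε := ε)
  have := measurable_impactTime (d := d) (ε := ε)
  unfold scatterMap; fun_prop

/-- Change of variables for an injective map with Jacobian of absolute value one. -/
lemma volume_image_scatterMap (hε : 0 < ε)
    {S : Set (EuclideanSpace ℝ (Fin d) × EuclideanSpace ℝ (Fin d))} (hS : MeasurableSet S)
    (hSi : ∀ p ∈ S, Impacting ε p) : volume (scatterMap ε '' S) = volume S := by
  choose! L hL hdet using fun p (hp : p ∈ S) => (hSi p hp).exists_hasFDerivAt hε
  have hinj : Set.InjOn (scatterMap ε) S := fun p hp p' hp' he =>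
    (hSi p hp).eq_of_scatterMap_eq hε (hSi p' hp') he
  rw [Measure.volume_eq_prod, ← lintegral_abs_det_fderiv_eq_addHaar_image _ hS
    (fun p hp => (hL p hp).hasFDerivWithinAt) hinj,
    setLIntegral_congr_fun hS (g := fun _ => 1) (fun p hp => by simp [hdet p hp])]
  simp

/-! ### Passing to the torus -/

lemma measurable_disp : Measurable fun p : Torus d × Torus d => disp p.1 p.2 := by
  unfold disp
  refine (MeasurableEquiv.toLp 2 (Fin d → ℝ)).measurable.comp ?_
  refine measurable_pi_lambda _ fun k => ?_
  exact measurable_subtype_coe.comp ((AddCircle.measurableEquivIoc (1 : ℝ) (-1 / 2)).measurable.comp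
    (((measurable_pi_apply k).comp measurable_snd).sub ((measurable_pi_apply k).comp measurable_fst)))

lemma measurable_toTorus : Measurable (toTorus : EuclideanSpace ℝ (Fin d) → Torus d) := by
  refine measurable_pi_lambda _ fun k => ?_
  exact AddCircle.measurable_mk'.comp (by fun_prop)

lemma measurable_torusDist : Measurable fun p : Torus d × Torus d => torusDist p.1 p.2 :=
  measurable_disp.norm

/-- The cube of shortest representatives. -/
def cube (d : ℕ) : Set (EuclideanSpace ℝ (Fin d)) := {v | ∀ k, v k ∈ Set.Ioc (-1 / 2 : ℝ) (1 / 2)}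

lemma measurePreserving_toTorus :
    MeasurePreserving (toTorus : EuclideanSpace ℝ (Fin d) → Torus d)
      (volume.restrict (cube d)) volume := by
  have h1 : MeasurePreserving (MeasurableEquiv.toLp 2 (Fin d → ℝ)).symm
      (volume.restrict (cube d))
      (volume.restrict (Set.univ.pi fun _ : Fin d => Set.Ioc (-1 / 2 : ℝ) (-1 / 2 + 1))) := by
    have h2 := (EuclideanSpace.volume_preserving_symm_measurableEquiv_toLp (Fin d)).restrict_preimage
      (s := Set.univ.pi fun _ : Fin d => Set.Ioc (-1 / 2 : ℝ) (-1 / 2 + 1))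
      (MeasurableSet.univ_pi fun _ => measurableSet_Ioc)
    have h3 : cube d = (MeasurableEquiv.toLp 2 (Fin d → ℝ)).symm ⁻¹'
        (Set.univ.pi fun _ : Fin d => Set.Ioc (-1 / 2 : ℝ) (-1 / 2 + 1)) := by
      ext v
      rw [Set.mem_preimage, Set.mem_univ_pi, show (-1 / 2 + 1 : ℝ) = 1 / 2 by norm_num]
      rfl
    rwa [h3]
  have h3 : MeasurePreserving (fun (x : Fin d → ℝ) k => (x k : UnitAddCircle))
      (volume.restrict (Set.univ.pi fun _ : Fin d => Set.Ioc (-1 / 2 : ℝ) (-1 / 2 + 1)))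
      volume := by
    rw [volume_pi, Measure.restrict_pi_pi, volume_pi]
    exact measurePreserving_pi _ _ fun _ => AddCircle.measurePreserving_mk (1 : ℝ) (-1 / 2)
  exact h3.comp h1

/-- The relative position and velocity in `ℝ^d`. -/
noncomputable def relLift (b : Phase d) :
    EuclideanSpace ℝ (Fin d) × EuclideanSpace ℝ (Fin d) := (disp 0 b.1, b.2)

/-- The projection to the torus of a relative position and velocity. -/
noncomputable def relProj (p : EuclideanSpace ℝ (Fin d) × EuclideanSpace ℝ (Fin d)) : Phase d :=
  (toTorus p.1, p.2)

lemma measurable_relLift : Measurable (relLift (d := d)) :=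
  (measurable_disp.comp (measurable_const.prodMk measurable_fst)).prodMk measurable_snd

lemma measurable_relProj : Measurable (relProj (d := d)) :=
  (measurable_toTorus.comp measurable_fst).prodMk measurable_snd

@[simp] lemma relProj_relLift (b : Phase d) : relProj (relLift b) = b := by
  simp [relProj, relLift]

lemma relLift_relProj {p : EuclideanSpace ℝ (Fin d) × EuclideanSpace ℝ (Fin d)}
    (hp : p.1 ∈ cube d) : relLift (relProj p) = p :=
  Prod.ext (disp_eq_of_mem (by simp [relProj]) hp) rfl

lemma relLift_fst_mem (b : Phase d) : (relLift b).1 ∈ cube d := fun k => disp_mem _ _ k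

lemma mem_cube_of_norm_lt {v : EuclideanSpace ℝ (Fin d)} (hv : ‖v‖ < 1 / 2) : v ∈ cube d :=
  fun k => by
    have := abs_lt.1 ((abs_coord_le v k).trans_lt hv)
    constructor <;> linarith

lemma measurePreserving_relProj : MeasurePreserving (relProj (d := d))
    (volume.restrict (cube d ×ˢ Set.univ)) volume := by
  rw [Measure.volume_eq_prod, Measure.volume_eq_prod, ← Measure.prod_restrict, Measure.restrict_univ]
  exact measurePreserving_toTorus.prod (MeasurePreserving.id _)

lemma volume_image_relProj {W : Set (EuclideanSpace ℝ (Fin d) × EuclideanSpace ℝ (Fin d))}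
    (hW : MeasurableSet W) (hWc : ∀ p ∈ W, p.1 ∈ cube d) :
    volume (relProj '' W) = volume W := by
  have h1 : relProj '' W = relLift ⁻¹' W := by
    ext b
    constructor
    · rintro ⟨p, hp, rfl⟩
      rw [Set.mem_preimage, relLift_relProj (hWc p hp)]; exact hp
    · intro hb
      exact ⟨_, hb, relProj_relLift b⟩
  rw [h1, ← measurePreserving_relProj.measure_preimage (measurable_relLift hW).nullMeasurableSet,
    Measure.restrict_apply (measurable_relProj (measurable_relLift hW))]
  congr 1
  ext p
  constructor
  · rintro ⟨h2, h3⟩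
    rwa [Set.mem_preimage, Set.mem_preimage, relLift_relProj h3.1] at h2
  · intro hp
    refine ⟨?_, hWc p hp, Set.mem_univ _⟩
    rw [Set.mem_preimage, Set.mem_preimage, relLift_relProj (hWc p hp)]; exact hp

/-- The scattering map on the relative phase space of the torus. -/
noncomputable def torusScatter (ε : ℝ) (b : Phase d) : Phase d := relProj (scatterMap ε (relLift b))

/-- The states with a transversal impact, for which no other periodic image matters. -/
def impactSet (d : ℕ) (ε : ℝ) : Set (Phase d) :=
  {b | Impacting ε (relLift b) ∧ ‖(scatterMap ε (relLift b)).1‖ < 1 / 2}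

lemma measurableSet_impactSet : MeasurableSet (impactSet d ε) :=
  (measurable_relLift isOpen_impacting.measurableSet).inter
    (measurableSet_lt (measurable_scatterMap.comp measurable_relLift).fst.norm measurable_const)

/-- The map is lifted to the cube, which is a fundamental domain. The bound `1/2` in `impactSet`
keeps the image of the lift inside the cube, so projecting back loses no volume. -/
theorem measurePreserving_torusScatter (hε : 0 < ε) :
    MeasurePreserving (torusScatter (d := d) ε) (volume.restrict (impactSet d ε))
      (volume.restrict (torusScatter ε '' impactSet d ε)) := by
  refine measurePreserving_restrict_image (measurable_relProj.comp
    (measurable_scatterMap.comp measurable_relLift)) measurableSet_impactSet fun S hS hSm => ?_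
  have h1 : relLift '' S = relProj ⁻¹' S ∩ (cube d ×ˢ Set.univ) := by
    ext p
    constructor
    · rintro ⟨b, hb, rfl⟩
      exact ⟨by simpa using hb, relLift_fst_mem b, Set.mem_univ _⟩
    · rintro ⟨h2, h3⟩
      exact ⟨_, h2, relLift_relProj h3.1⟩
  have hcube : MeasurableSet (cube d) := by
    have : cube d = ⋂ k, {v : EuclideanSpace ℝ (Fin d) | v k ∈ Set.Ioc (-1 / 2 : ℝ) (1 / 2)} := by
      ext v; simp [cube]
    rw [this]
    exact MeasurableSet.iInter fun k => (by fun_prop : Measurable fun v : EuclideanSpace ℝ (Fin d) =>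
      v k) measurableSet_Ioc
  have h2 : MeasurableSet (relLift '' S) := by
    rw [h1]
    exact (measurable_relProj hSm).inter (hcube.prod MeasurableSet.univ)
  have h3 : ∀ p ∈ relLift '' S, Impacting ε p := by
    rintro _ ⟨b, hb, rfl⟩
    exact (hS hb).1
  have h4 : MeasurableSet (scatterMap ε '' (relLift '' S)) :=
    h2.image_of_measurable_injOn measurable_scatterMap fun p hp p' hp' he =>
      (h3 p hp).eq_of_scatterMap_eq hε (h3 p' hp') he
  have h5 : torusScatter ε '' S = relProj '' (scatterMap ε '' (relLift '' S)) := by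
    rw [Set.image_image, Set.image_image]; rfl
  change volume (torusScatter ε '' S) = _
  rw [h5, volume_image_relProj h4, volume_image_scatterMap hε h2 h3, h1,
    ← measurePreserving_relProj.measure_preimage hSm.nullMeasurableSet,
    Measure.restrict_apply (measurable_relProj hSm)]
  rintro _ ⟨_, ⟨b, hb, rfl⟩, rfl⟩
  exact mem_cube_of_norm_lt (hS hb).2

/-! ### Maps that change one particle -/

/-- A shear: with the other particles fixed, `hck` makes the increment constant, and particle `k` is
translated. -/
lemma measurePreserving_update_add (k : Fin n) {c : (Fin n → Phase d) → Phase d} (hc : Measurable c)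
    (hck : ∀ z x, c (Function.update z k x) = c z) :
    MeasurePreserving (fun z : Fin n → Phase d => Function.update z k (z k + c z)) := by
  cases n with
  | zero => exact k.elim0
  | succ n =>
    set e := MeasurableEquiv.piFinSuccAbove (fun _ : Fin (n + 1) => Phase d) k with he
    have hep : MeasurePreserving e := volume_preserving_piFinSuccAbove (fun _ => Phase d) k
    have hsw : MeasurePreserving (Prod.swap : Phase d × (Fin n → Phase d) → _)
      (volume.prod volume) (volume.prod volume) := Measure.measurePreserving_swap
    have hsw' : MeasurePreserving (Prod.swap : (Fin n → Phase d) × Phase d → _)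
      (volume.prod volume) (volume.prod volume) := Measure.measurePreserving_swap
    have hsk : MeasurePreserving (fun p : (Fin n → Phase d) × Phase d =>
        (p.1, p.2 + c (e.symm (0, p.1)))) (volume.prod volume) (volume.prod volume) := by
      refine (MeasurePreserving.id _).skew_product (g := fun r x => x + c (e.symm (0, r))) ?_ ?_
      · exact measurable_snd.add (hc.comp (e.symm.measurable.comp
          (measurable_const.prodMk measurable_fst)))
      · exact Filter.Eventually.of_forall fun r => (measurePreserving_add_right _ _).map_eq
    have := hep.symm.comp (hsw'.comp (hsk.comp (hsw.comp hep)))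
    convert this using 1
    funext z
    have h1 : c (e.symm (0, (e z).2)) = c z := by
      have : e.symm (0, (e z).2) = Function.update z k 0 := Fin.insertNth_removeNth k 0 z
      rw [this, hck]
    change _ = e.symm ((e z).1 + c (e.symm (0, (e z).2)), (e z).2)
    rw [h1]
    exact (Fin.insertNth_removeNth k _ z).symm

lemma measurePreserving_update_map (k : Fin n) {φ : Phase d → Phase d} {S S' : Set (Phase d)}
    (hφ : MeasurePreserving φ (volume.restrict S) (volume.restrict S')) :
    MeasurePreserving (fun z : Fin n → Phase d => Function.update z k (φ (z k)))
      (volume.restrict {z | z k ∈ S}) (volume.restrict {z | z k ∈ S'}) := by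
  cases n with
  | zero => exact k.elim0
  | succ n =>
    set e := MeasurableEquiv.piFinSuccAbove (fun _ : Fin (n + 1) => Phase d) k with he
    have hep : MeasurePreserving e := volume_preserving_piFinSuccAbove (fun _ => Phase d) k
    have hres : ∀ S : Set (Phase d), MeasurePreserving e (volume.restrict {z | z k ∈ S})
        ((volume.restrict S).prod volume) := by
      intro S
      have h1 := hep.restrict_preimage_emb e.measurableEmbedding (S ×ˢ Set.univ)
      rw [Measure.volume_eq_prod, ← Measure.prod_restrict, Measure.restrict_univ] at h1
      have h2 : {z : Fin (n + 1) → Phase d | z k ∈ S} = e ⁻¹' (S ×ˢ Set.univ) := by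
        ext z
        exact ⟨fun h => ⟨h, Set.mem_univ _⟩, fun h => h.1⟩
      rwa [h2]
    have := (hres S').symm.comp ((hφ.prod (MeasurePreserving.id volume)).comp (hres S))
    convert this using 1
    funext z
    exact (Fin.insertNth_removeNth k _ z).symm

end HardSpheres

/-! ### Scattering of one pair inside the phase space of all particles. -/

namespace HardSpheres

variable {d n : ℕ} {ε δ R : ℝ} {B : Finset (Fin n)} {q q' : Fin n} {z : Fin n → Phase d}

/-! ### Free flight and pair scattering preserve the volume -/

lemma measurePreserving_freeFlight (u : ℝ) :
    MeasurePreserving (freeFlight (d := d) (n := n) u) := by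
  have h1 : MeasurePreserving (fun p : Phase d => (p.1 + toTorus (u • p.2), p.2)) := by
    have hsw : MeasurePreserving (Prod.swap : Torus d × EuclideanSpace ℝ (Fin d) → _)
      (volume.prod volume) (volume.prod volume) := Measure.measurePreserving_swap
    have hsw' : MeasurePreserving (Prod.swap : EuclideanSpace ℝ (Fin d) × Torus d → _)
      (volume.prod volume) (volume.prod volume) := Measure.measurePreserving_swap
    have hsk : MeasurePreserving (fun p : EuclideanSpace ℝ (Fin d) × Torus d =>
        (p.1, p.2 + toTorus (u • p.1))) (volume.prod volume) (volume.prod volume) := by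
      refine (MeasurePreserving.id _).skew_product (g := fun v x => x + toTorus (u • v)) ?_ ?_
      · exact measurable_snd.add (measurable_toTorus.comp (measurable_fst.const_smul u))
      · exact Filter.Eventually.of_forall fun r => (measurePreserving_add_right _ _).map_eq
    exact hsw'.comp (hsk.comp hsw)
  exact volume_preserving_pi fun _ => h1

/-- The change of the first particle in a collision, as a function of the relative state. -/
noncomputable def kick (ε : ℝ) (b : Phase d) : Phase d :=
  (toTorus (impactTime ε (relLift b) • impulse ε (relLift b)), -impulse ε (relLift b))

lemma measurable_kick : Measurable (kick (d := d) ε) :=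
  (measurable_toTorus.comp ((measurable_impactTime.comp measurable_relLift).smul
    (measurable_impulse.comp measurable_relLift))).prodMk
    (measurable_impulse.comp measurable_relLift).neg

lemma torusScatter_eq (b : Phase d) : torusScatter ε b = b + kick ε b + kick ε b := by
  refine Prod.ext ?_ ?_
  · simp only [torusScatter, relProj, scatterMap, map_add, kick, Prod.fst_add, mul_smul, two_smul]
    simp only [relLift, toTorus_disp, sub_zero, add_assoc]
  · simp only [torusScatter, relProj, scatterMap, kick, Prod.snd_add, two_smul, relLift]
    abel

/-- The state whose free flight is the motion of the particles `q, q'` after their impact. -/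
noncomputable def pairScatter (ε : ℝ) (q q' : Fin n) (z : Fin n → Phase d) : Fin n → Phase d :=
  Function.update (Function.update z q (z q - kick ε (z q' - z q))) q' (z q' + kick ε (z q' - z q))

lemma measurable_pairScatter : Measurable (pairScatter (d := d) ε q q') := by
  have h1 : Measurable fun z : Fin n → Phase d => kick ε (z q' - z q) :=
    measurable_kick.comp ((measurable_pi_apply q').sub (measurable_pi_apply q))
  refine measurable_pi_lambda _ fun a => ?_
  by_cases ha : a = q'
  · subst ha
    have h2 : Measurable fun z : Fin n → Phase d => z a + kick ε (z a - z q) :=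
      (measurable_pi_apply a).add h1
    simpa [pairScatter] using h2
  · by_cases hb : a = q
    · subst hb
      have h2 : Measurable fun z : Fin n → Phase d => z a - kick ε (z q' - z a) :=
        (measurable_pi_apply a).sub h1
      simpa [pairScatter, ha] using h2
    · simpa [pairScatter, ha, hb] using measurable_pi_apply a

/-- Pair scattering factors into volume-preserving maps: pass to the relative state of `q'` (`f₁`),
shift `q` by a function of it (`f₂`), scatter the relative state (`f₃`), and return to the absolute
state (`f₄`). By `torusScatter_eq` the relative state changes by twice the kick, so `q'` is moved by
one kick in the end. Only `f₃` is restricted to impacting states, whence an inequality. -/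
lemma volume_pairScatter_le (hε : 0 < ε) (hq : q ≠ q') {Q : Set (Fin n → Phase d)}
    (hQ : MeasurableSet Q) :
    volume ({z | z q' - z q ∈ impactSet d ε} ∩ pairScatter ε q q' ⁻¹' Q) ≤ volume Q := by
  let f₁ : (Fin n → Phase d) → (Fin n → Phase d) := fun z => Function.update z q' (z q' + -z q)
  let f₂ : (Fin n → Phase d) → (Fin n → Phase d) := fun z =>
    Function.update z q (z q + -kick ε (z q'))
  let f₃ : (Fin n → Phase d) → (Fin n → Phase d) := fun z =>
    Function.update z q' (torusScatter ε (z q'))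
  let f₄ : (Fin n → Phase d) → (Fin n → Phase d) := fun z => Function.update z q' (z q' + z q)
  have h₁ : MeasurePreserving f₁ := measurePreserving_update_add q' (measurable_pi_apply q).neg
    fun z x => by simp [hq]
  have h₂ : MeasurePreserving f₂ := measurePreserving_update_add q
    (measurable_kick.comp (measurable_pi_apply q')).neg fun z x => by simp [hq.symm]
  have h₃ : MeasurePreserving f₃ _ _ :=
    measurePreserving_update_map (n := n) q' (measurePreserving_torusScatter (d := d) hε)
  have h₄ : MeasurePreserving f₄ := measurePreserving_update_add q' (measurable_pi_apply q)
    fun z x => by simp [hq]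
  have hcomp : ∀ z, f₄ (f₃ (f₂ (f₁ z))) = pairScatter ε q q' z := by
    intro z
    funext a
    by_cases ha : a = q'
    · subst ha
      simp only [f₁, f₂, f₃, f₄, pairScatter, Function.update_self, Function.update_of_ne hq,
        Function.update_of_ne hq.symm, torusScatter_eq]
      simp only [← sub_eq_add_neg]
      abel
    · by_cases hb : a = q
      · subst hb
        simp [f₁, f₂, f₃, f₄, pairScatter, ha, hq.symm, sub_eq_add_neg]
      · simp [f₁, f₂, f₃, f₄, pairScatter, ha, hb]
  set W : Set (Fin n → Phase d) := {z | z q' ∈ impactSet d ε} ∩ f₃ ⁻¹' (f₄ ⁻¹' Q) with hW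
  have hS : MeasurableSet {z : Fin n → Phase d | z q' ∈ impactSet d ε} :=
    measurable_pi_apply q' measurableSet_impactSet
  have hWm : MeasurableSet W := hS.inter (h₃.measurable (h₄.measurable hQ))
  have e1 : {z | z q' - z q ∈ impactSet d ε} ∩ pairScatter ε q q' ⁻¹' Q = f₁ ⁻¹' (f₂ ⁻¹' W) := by
    ext z
    simp only [Set.mem_inter_iff, Set.mem_preimage, hW, hcomp]
    refine and_congr_left fun _ => ?_
    simp [f₁, f₂, hq.symm, sub_eq_add_neg]
  rw [e1, h₁.measure_preimage (h₂.measurable hWm).nullMeasurableSet,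
    h₂.measure_preimage hWm.nullMeasurableSet, hW, Set.inter_comm,
    ← Measure.restrict_apply (h₃.measurable (h₄.measurable hQ)),
    h₃.measure_preimage (h₄.measurable hQ).nullMeasurableSet]
  exact (Measure.restrict_apply_le _ _).trans_eq (h₄.measure_preimage hQ.nullMeasurableSet)

/-! ### Kinematics of a short time step -/

lemma relLift_sub (z : Fin n → Phase d) (q q' : Fin n) :
    relLift (z q' - z q) = (disp (z q).1 (z q').1, (z q').2 - (z q).2) := by
  simp [relLift, disp]

lemma disp_freeFlight {u : ℝ}
    (h : ‖(relLift (z q' - z q)).1 + u • (relLift (z q' - z q)).2‖ < 1 / 2) :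
    disp (freeFlight u z q).1 (freeFlight u z q').1 =
      (relLift (z q' - z q)).1 + u • (relLift (z q' - z q)).2 := by
  refine disp_eq_of_norm_lt ?_ h
  simp only [relLift_sub, map_add, toTorus_disp, smul_sub, map_sub, freeFlight_apply]
  abel

lemma torusDist_freeFlight {u : ℝ}
    (h : ‖(relLift (z q' - z q)).1 + u • (relLift (z q' - z q)).2‖ < 1 / 2) :
    torusDist (freeFlight u z q).1 (freeFlight u z q').1 =
      ‖(relLift (z q' - z q)).1 + u • (relLift (z q' - z q)).2‖ := by
  rw [torusDist, disp_freeFlight h]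

lemma torusDist_le_freeFlight {u : ℝ} (hu : 0 ≤ u) (hq : ‖(z q).2‖ ≤ R) (hq' : ‖(z q').2‖ ≤ R) :
    torusDist (z q).1 (z q').1 ≤
      torusDist (freeFlight u z q).1 (freeFlight u z q').1 + 2 * R * u := by
  have h := torusDist_add_le (freeFlight u z q).1 (freeFlight u z q').1 (-(u • (z q).2))
    (-(u • (z q').2))
  simp only [freeFlight_apply, map_neg, add_neg_cancel_right] at h
  refine h.trans ?_
  have h2 : ‖-(u • (z q').2) - -(u • (z q).2)‖ ≤ 2 * R * u := by
    rw [show -(u • (z q').2) - -(u • (z q).2) = u • ((z q).2 - (z q').2) by module, norm_smul,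
      Real.norm_of_nonneg hu]
    have := norm_sub_le (z q).2 (z q').2
    nlinarith
  simp only [freeFlight_apply]
  linarith

/-- The kinetic energy, up to a factor. -/
noncomputable def energy (z : Fin n → Phase d) : ℝ := ∑ i, ‖(z i).2‖ ^ 2

lemma norm_le_of_energy (hR : 0 ≤ R) (h : energy z ≤ R ^ 2) (i : Fin n) : ‖(z i).2‖ ≤ R := by
  have : ‖(z i).2‖ ^ 2 ≤ energy z :=
    Finset.single_le_sum (f := fun i => ‖(z i).2‖ ^ 2) (fun j _ => sq_nonneg _) (Finset.mem_univ i)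
  exact (pow_le_pow_iff_left₀ (norm_nonneg _) hR two_ne_zero).1 (this.trans h)

@[simp] lemma energy_freeFlight (u : ℝ) : energy (freeFlight u z) = energy z := rfl

lemma pairScatter_left (hq : q ≠ q') : pairScatter ε q q' z q = z q - kick ε (z q' - z q) := by
  simp [pairScatter, hq]

lemma pairScatter_right : pairScatter ε q q' z q' = z q' + kick ε (z q' - z q) := by
  simp [pairScatter]

lemma pairScatter_of_ne {a : Fin n} (h : a ≠ q) (h' : a ≠ q') : pairScatter ε q q' z a = z a := by
  simp [pairScatter, h, h']

lemma relLift_pairScatter (hq : q ≠ q') (hz : z q' - z q ∈ impactSet d ε) :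
    relLift (pairScatter ε q q' z q' - pairScatter ε q q' z q) =
      scatterMap ε (relLift (z q' - z q)) := by
  rw [pairScatter_left hq, pairScatter_right,
    show z q' + kick ε (z q' - z q) - (z q - kick ε (z q' - z q)) =
      (z q' - z q) + kick ε (z q' - z q) + kick ε (z q' - z q) by abel, ← torusScatter_eq,
    torusScatter, relLift_relProj (mem_cube_of_norm_lt hz.2)]

/-- The motion after the impact. -/
lemma freeFlight_pairScatter (hε : 0 < ε) (hε' : ε < 1 / 2) (hq : q ≠ q')
    (hz : Impacting ε (relLift (z q' - z q))) (u : ℝ) :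
    freeFlight u (pairScatter ε q q' z) = freeFlight (u - impactTime ε (relLift (z q' - z q)))
      (scatter q q' (freeFlight (impactTime ε (relLift (z q' - z q))) z)) := by
  set b := relLift (z q' - z q) with hb
  set τ := impactTime ε b with hτ
  have hn : ‖b.1 + τ • b.2‖ = ε := hz.norm_impactPoint hε
  have hdisp := disp_freeFlight (z := z) (q := q) (q' := q') (u := τ) (by rw [← hb, hn]; exact hε')
  rw [← hb] at hdisp
  have hg : inner ℝ (ε⁻¹ • (b.1 + τ • b.2)) ((z q).2 - (z q').2) • (ε⁻¹ • (b.1 + τ • b.2)) =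
      -impulse ε b := by
    have hv : (z q).2 - (z q').2 = -b.2 := by rw [hb, relLift_sub]; simp
    rw [hv, inner_neg_right, inner_smul_left, smul_smul, impulse, ← neg_smul]
    congr 1
    simp only [conj_trivial, impactPoint, ← hτ]
    field_simp
  have hdist : torusDist (freeFlight τ z q).1 (freeFlight τ z q').1 = ε := by
    rw [torusDist, hdisp, hn]
  funext a
  by_cases ha : a = q
  · subst ha
    rw [freeFlight_apply, freeFlight_apply, pairScatter_left hq]
    simp only [scatter, if_pos, hdist, hdisp]
    simp only [freeFlight_apply, hg, kick, ← hb, ← hτ, Prod.fst_sub, Prod.snd_sub, sub_neg_eq_add]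
    refine Prod.ext ?_ rfl
    simp only [smul_add, sub_smul, map_add, map_sub]
    abel
  · by_cases ha' : a = q'
    · subst ha'
      rw [freeFlight_apply, freeFlight_apply, pairScatter_right]
      simp only [scatter, if_pos, if_neg ha, hdist, hdisp]
      simp only [freeFlight_apply, hg, kick, ← hb, ← hτ, Prod.fst_add, Prod.snd_add]
      refine Prod.ext ?_ rfl
      simp only [smul_add, sub_smul, map_add, map_sub, smul_neg, map_neg]
      abel
    · rw [freeFlight_apply, freeFlight_apply, scatter_of_ne _ ha ha', pairScatter_of_ne ha ha']
      simp only [freeFlight_apply]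
      refine Prod.ext ?_ rfl
      simp only [sub_smul, map_sub]
      abel

lemma energy_scatter (hq : q ≠ q') (h : torusDist (z q).1 (z q').1 ≠ 0) :
    energy (scatter q q' z) = energy z := by
  have key : ∀ y : Fin n → Phase d, energy y = ‖(y q).2‖ ^ 2 + (‖(y q').2‖ ^ 2 +
      ∑ i ∈ (Finset.univ.erase q).erase q', ‖(y i).2‖ ^ 2) := by
    intro y
    rw [energy, ← Finset.add_sum_erase _ _ (Finset.mem_univ q),
      ← Finset.add_sum_erase _ _ (Finset.mem_erase.2 ⟨hq.symm, Finset.mem_univ q'⟩)]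
  have hrest : ∑ i ∈ (Finset.univ.erase q).erase q', ‖(scatter q q' z i).2‖ ^ 2 =
      ∑ i ∈ (Finset.univ.erase q).erase q', ‖(z i).2‖ ^ 2 := by
    refine Finset.sum_congr rfl fun i hi => ?_
    simp only [Finset.mem_erase] at hi
    rw [scatter_of_ne _ hi.2.1 hi.1]
  rw [key, key z, hrest]
  have hν : ‖(torusDist (z q).1 (z q').1)⁻¹ • disp (z q).1 (z q').1‖ = 1 := by
    rw [torusDist] at h ⊢
    rw [norm_smul, norm_inv, norm_norm, inv_mul_cancel₀ h]
  simp only [scatter, if_pos, if_neg hq.symm]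
  generalize (torusDist (z q).1 (z q').1)⁻¹ • disp (z q).1 (z q').1 = ν at hν ⊢
  rw [norm_sub_sq_real, norm_add_sq_real, norm_smul, hν, inner_smul_right, inner_smul_right,
    mul_one, Real.norm_eq_abs, sq_abs, inner_sub_right, real_inner_comm ν, real_inner_comm ν]
  ring

lemma energy_pairScatter (hε : 0 < ε) (hε' : ε < 1 / 2) (hq : q ≠ q')
    (hz : Impacting ε (relLift (z q' - z q))) : energy (pairScatter ε q q' z) = energy z := by
  have hn := hz.norm_impactPoint hε
  rw [← energy_freeFlight (impactTime ε (relLift (z q' - z q))),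
    freeFlight_pairScatter hε hε' hq hz, sub_self, freeFlight_zero, energy_scatter hq,
    energy_freeFlight]
  rw [torusDist_freeFlight (by rw [← impactPoint, hn]; exact hε'), ← impactPoint, hn]
  exact hε.ne'

end HardSpheres

/-! ### A short time step from a regular configuration. -/

namespace HardSpheres

variable {d n : ℕ} {ε δ R : ℝ} {B : Finset (Fin n)} {q q' : Fin n} {z z' : Fin n → Phase d}

/-! ### One step of Alexander's construction -/

/-- At least one of two different pairs of particles in `B` is far from contact, and there is no
contact after free flight during the time `δ`. -/
def regular (ε δ R : ℝ) (B : Finset (Fin n)) : Set (Fin n → Phase d) :=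
  {z | energy z ≤ R ^ 2 ∧ Separated ε B z ∧
    (∀ i ∈ B, ∀ j ∈ B, i < j → ∀ k ∈ B, ∀ l ∈ B, k < l →
      torusDist (z i).1 (z j).1 ≤ ε + 2 * R * δ → torusDist (z k).1 (z l).1 ≤ ε + 2 * R * δ →
      (i, j) = (k, l)) ∧
    ∀ i ∈ B, ∀ j ∈ B, i < j → torusDist (freeFlight δ z i).1 (freeFlight δ z j).1 ≠ ε}

/-- The pair `q < q'` in `B` has a transversal impact before the time `δ`. -/
def Hits (ε δ : ℝ) (B : Finset (Fin n)) (q q' : Fin n) (z : Fin n → Phase d) : Prop :=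
  q ∈ B ∧ q' ∈ B ∧ q < q' ∧ Impacting ε (relLift (z q' - z q)) ∧
    impactTime ε (relLift (z q' - z q)) < δ

/-- There is at most one collision during the time `δ`, and the configuration becomes `z'`. -/
def OneStep (ε δ : ℝ) (B : Finset (Fin n)) (z z' : Fin n → Phase d) : Prop :=
  (z' = freeFlight δ z ∧ ∀ u ∈ Set.Ioc 0 δ, Separated ε B (freeFlight u z)) ∨
  ∃ τ q q', 0 < τ ∧ τ < δ ∧ (∀ u ∈ Set.Ioo 0 τ, Separated ε B (freeFlight u z)) ∧
    Contact ε B q q' (freeFlight τ z) ∧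
    z' = freeFlight (δ - τ) (scatter q q' (freeFlight τ z)) ∧
    (∀ u ∈ Set.Ioc 0 (δ - τ), Separated ε B (freeFlight u (scatter q q' (freeFlight τ z)))) ∧
    ∀ u ∈ Set.Ioc 0 (δ - τ), ∀ p, p = q ∨ p = q' →
      Separated ε (B.erase p) (freeFlight u (freeFlight τ z))

lemma Separated.congr_fst {A : Finset (Fin n)} (h : Separated ε A z)
    (hz : ∀ i ∈ A, (z i).1 = (z' i).1) : Separated ε A z' := fun i hi j hj hij => by
  rw [← hz i hi, ← hz j hj]; exact h i hi j hj hij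

/-- Scattering keeps the positions, hence `ν`, and reverses the normal relative velocity, so the
second exchange undoes the first. -/
lemma scatter_scatter (hε : 0 < ε) (hq : q ≠ q') (h : torusDist (z q).1 (z q').1 = ε) :
    scatter q q' (scatter q q' z) = z := by
  have hν : ‖(torusDist (z q).1 (z q').1)⁻¹ • disp (z q).1 (z q').1‖ = 1 := by
    rw [norm_smul, norm_inv, ← torusDist, h, Real.norm_of_nonneg hε.le, inv_mul_cancel₀ hε.ne']
  set ν := (torusDist (z q).1 (z q').1)⁻¹ • disp (z q).1 (z q').1 with hνdef
  have e1 : (scatter q q' z q).2 = (z q).2 - inner ℝ ν ((z q).2 - (z q').2) • ν := by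
    simp [scatter, ← hνdef]
  have e2 : (scatter q q' z q').2 = (z q').2 + inner ℝ ν ((z q).2 - (z q').2) • ν := by
    simp [scatter, hq.symm, ← hνdef]
  have e3 : inner ℝ ν ((scatter q q' z q).2 - (scatter q q' z q').2) =
      -(inner ℝ ν ((z q).2 - (z q').2) : ℝ) := by
    rw [e1, e2]
    simp only [inner_sub_right, inner_add_right, inner_smul_right, real_inner_self_eq_norm_sq, hν]
    ring
  funext a
  by_cases ha : a = q
  · subst ha
    have : scatter a q' (scatter a q' z) a = ((scatter a q' z a).1, (scatter a q' z a).2 -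
        inner ℝ ν ((scatter a q' z a).2 - (scatter a q' z q').2) • ν) := by
      conv_lhs => rw [scatter]
      simp only [if_pos, scatter_fst, ← hνdef]
    rw [this, e3, e1, scatter_fst]
    refine Prod.ext rfl ?_
    simp
  · by_cases ha' : a = q'
    · subst ha'
      have : scatter q a (scatter q a z) a = ((scatter q a z a).1, (scatter q a z a).2 +
          inner ℝ ν ((scatter q a z q).2 - (scatter q a z a).2) • ν) := by
        conv_lhs => rw [scatter]
        simp only [if_pos, if_neg ha, scatter_fst, ← hνdef]
      rw [this, e3, e2, scatter_fst]
      refine Prod.ext rfl ?_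
      simp
    · rw [scatter_of_ne _ ha ha', scatter_of_ne _ ha ha']

lemma freeFlight_injective (u : ℝ) :
    Function.Injective (freeFlight (d := d) (n := n) u) := fun z z' h => by
  have := congrArg (freeFlight (-u)) h
  simpa [freeFlight_add] using this

/-- A time step can be reversed. -/
theorem OneStep.injective (hε : 0 < ε) {z₁ z₂ : Fin n → Phase d} (h₁ : OneStep ε δ B z₁ z')
    (h₂ : OneStep ε δ B z₂ z') : z₁ = z₂ := by
  -- Flown back from the common end point, both trajectories have the same positions at time `τ`.
  -- One is in contact there and the other is separated.
  have hmixed : ∀ {z₁ z₂ : Fin n → Phase d} {τ : ℝ} {q q' : Fin n}, 0 < τ → τ < δ →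
      Contact ε B q q' (freeFlight τ z₁) →
      freeFlight (δ - τ) (scatter q q' (freeFlight τ z₁)) = freeFlight δ z₂ →
      (∀ u ∈ Set.Ioc 0 δ, Separated ε B (freeFlight u z₂)) → False := by
    intro z₁ z₂ τ q q' h0 hτ hc he hs
    have h3 : scatter q q' (freeFlight τ z₁) = freeFlight τ z₂ := by
      apply freeFlight_injective (δ - τ)
      rw [he, freeFlight_add, sub_add_cancel]
    refine no_contact hc ((hs τ ⟨h0, hτ.le⟩).congr_fst fun i _ => ?_)
    rw [← h3, scatter_fst]
  -- The later contact would lie on the collision-free outgoing stretch of the other trajectory.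
  have hboth : ∀ {z₁ z₂ : Fin n → Phase d} {τ₁ τ₂ : ℝ} {q q' p p' : Fin n}, τ₁ < τ₂ → τ₂ < δ →
      Contact ε B p p' (freeFlight τ₂ z₂) →
      freeFlight (δ - τ₁) (scatter q q' (freeFlight τ₁ z₁)) =
        freeFlight (δ - τ₂) (scatter p p' (freeFlight τ₂ z₂)) →
      (∀ u ∈ Set.Ioc 0 (δ - τ₁), Separated ε B (freeFlight u (scatter q q' (freeFlight τ₁ z₁)))) →
      False := by
    intro z₁ z₂ τ₁ τ₂ q q' p p' h12 h2 hc he hs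
    have h3 : freeFlight (τ₂ - τ₁) (scatter q q' (freeFlight τ₁ z₁)) =
        scatter p p' (freeFlight τ₂ z₂) := by
      apply freeFlight_injective (δ - τ₂)
      rw [← he, freeFlight_add]
      congr 1; ring
    refine no_contact hc ((hs (τ₂ - τ₁) ⟨by linarith, by linarith⟩).congr_fst fun i _ => ?_)
    rw [h3, scatter_fst]
  rcases h₁ with ⟨rfl, h1⟩ | ⟨τ, q, q', h0, h1, h2, h3, h4, h5, h6⟩
  · rcases h₂ with ⟨h7, h8⟩ | ⟨τ', p, p', h0', h1', h2', h3', h4', h5', h6'⟩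
    · exact freeFlight_injective δ h7
    · exact (hmixed h0' h1' h3' h4'.symm h1).elim
  · rcases h₂ with ⟨h7, h8⟩ | ⟨τ', p, p', h0', h1', h2', h3', h4', h5', h6'⟩
    · exact (hmixed h0 h1 h3 (h4.symm.trans h7) h8).elim
    · rcases lt_trichotomy τ τ' with hlt | rfl | hlt
      · exact (hboth hlt h1' h3' (h4.symm.trans h4') h5).elim
      · have h7 := freeFlight_injective _ (h4.symm.trans h4')
        have h8 : Contact ε B p p' (freeFlight τ z₁) := by
          have : ∀ i, (freeFlight τ z₁ i).1 = (freeFlight τ z₂ i).1 := fun i => by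
            rw [← scatter_fst q q', h7, scatter_fst]
          obtain ⟨a1, a2, a3, a4, a5⟩ := h3'
          exact ⟨a1, a2, a3, by rw [this, this, a4], fun i hi j hj hij hne => by
            rw [this, this]; exact a5 i hi j hj hij hne⟩
        obtain ⟨rfl, rfl⟩ := contact_unique h3 h8
        apply freeFlight_injective τ
        rw [← scatter_scatter hε h3.2.2.1.ne h3.2.2.2.1, h7,
          scatter_scatter hε h3.2.2.1.ne h3'.2.2.2.1]
      · exact (hboth hlt h1 h3 (h4'.symm.trans h4) h5').elim

/-- Tameness is inherited backwards along a time step. -/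
theorem OneStep.tame {s : ℝ} (hδ : 0 ≤ δ) (h : OneStep ε δ B z z') (h₁ : Tame ε B z' s)
    (h₂ : ∀ p ∈ B, Tame ε (B.erase p) z' s)
    (h₃ : ∀ p ∈ B, Separated ε (B.erase p) (freeFlight δ z) →
      Tame ε (B.erase p) (freeFlight δ z) s) : Tame ε B z (s + δ) := by
  rcases h with ⟨rfl, h⟩ | ⟨τ, q, q', h0, h1, h2, h3, rfl, h5, h6⟩
  · exact h₁.prepend hδ h
  · have hs : 0 ≤ s := by
      cases h₁ with
      | free _ _ _ ht _ => exact ht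
      | collision _ _ _ τ _ _ hτ hτt _ _ _ _ _ => exact hτ.le.trans hτt
    have hB : ∀ p, p = q ∨ p = q' → p ∈ B := by
      rintro p (rfl | rfl)
      exacts [h3.1, h3.2.1]
    have e : s + δ - τ = s + (δ - τ) := by ring
    have hpos : 0 ≤ δ - τ := by linarith
    refine .collision B z _ τ q q' h0 (by linarith) h2 h3 ?_ (fun p hp => ?_) (fun p hp => ?_)
    · rw [e]; exact h₁.prepend hpos h5
    · rw [e]
      exact (h₂ p (hB p hp)).prepend hpos fun u hu => (h5 u hu).mono (Finset.erase_subset _ _)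
    · rw [e]
      -- When `p` is removed without scattering, the step ends at `freeFlight δ z` and not at `z'`;
      -- this is the role of `h₃`.
      refine Tame.prepend hpos (fun u hu => h6 u hu p hp) ?_
      have h7 := h6 (δ - τ) ⟨by linarith, le_rfl⟩ p hp
      rw [freeFlight_add, sub_add_cancel] at h7 ⊢
      exact h₃ p (hB p hp) h7

lemma OneStep.separated (hδ : 0 < δ) (h : OneStep ε δ B z z') : Separated ε B z' := by
  rcases h with ⟨rfl, h⟩ | ⟨τ, q, q', h0, h1, h2, h3, rfl, h5, h6⟩
  · exact h δ ⟨hδ, le_rfl⟩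
  · exact h5 _ ⟨by linarith, le_rfl⟩

lemma OneStep.energy_eq (hε : 0 < ε) (h : OneStep ε δ B z z') : energy z' = energy z := by
  rcases h with ⟨rfl, h⟩ | ⟨τ, q, q', h0, h1, h2, h3, rfl, h5, h6⟩
  · rfl
  · rw [energy_freeFlight, energy_scatter h3.2.2.1.ne (by rw [h3.2.2.2.1]; exact hε.ne'),
      energy_freeFlight]

lemma far_of_mem_regular (hz : z ∈ regular ε δ R B) (hq : q ∈ B) (hq' : q' ∈ B) (hlt : q < q')
    (hc : torusDist (z q).1 (z q').1 ≤ ε + 2 * R * δ) {i j : Fin n} (hi : i ∈ B) (hj : j ∈ B)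
    (hij : i < j) (hne : (i, j) ≠ (q, q')) : ε + 2 * R * δ < torusDist (z i).1 (z j).1 := by
  by_contra! h
  exact hne (hz.2.2.1 i hi j hj hij q hq q' hq' hlt h hc)

lemma norm_relLift_snd_le (hv : ∀ i, ‖(z i).2‖ ≤ R) : ‖(relLift (z q' - z q)).2‖ ≤ 2 * R := by
  rw [relLift_sub]
  exact (norm_sub_le _ _).trans (by linarith [hv q, hv q'])

lemma norm_add_smul_le {E : Type*} [SeminormedAddCommGroup E] [NormedSpace ℝ E] {y w : E}
    {a b u : ℝ} (hy : ‖y‖ ≤ a) (hw : ‖w‖ ≤ b) (hu : |u| ≤ δ) :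
    ‖y + u • w‖ ≤ a + δ * b := by
  refine (norm_add_le _ _).trans (add_le_add hy ?_)
  rw [norm_smul, Real.norm_eq_abs]
  exact mul_le_mul hu hw (norm_nonneg _) ((abs_nonneg u).trans hu)

lemma Hits.close (hε : 0 < ε) (hv : ∀ i, ‖(z i).2‖ ≤ R) (h : Hits ε δ B q q' z) :
    torusDist (z q).1 (z q').1 ≤ ε + 2 * R * δ := by
  obtain ⟨-, -, -, h, hτ⟩ := h
  have h0 := h.impactTime_pos hε
  set b := relLift (z q' - z q) with hb
  have h2 : torusDist (z q).1 (z q').1 = ‖b.1‖ := by rw [hb, relLift_sub]; rfl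
  rw [h2, show b.1 = impactPoint ε b + (-impactTime ε b) • b.2 by simp [impactPoint]]
  refine (norm_add_smul_le (h.norm_impactPoint hε).le (norm_relLift_snd_le hv)
    (δ := δ) ?_).trans (by linarith)
  rw [abs_neg, abs_of_pos h0]
  exact hτ.le

lemma norm_scatterMap_snd_le (hε : 0 < ε) (hv : ∀ i, ‖(z i).2‖ ≤ R)
    (h : Impacting ε (relLift (z q' - z q))) :
    ‖(scatterMap ε (relLift (z q' - z q))).2‖ ≤ 6 * R := by
  have h1 := norm_relLift_snd_le (q := q) (q' := q') hv
  have h2 := h.norm_impulse_le hε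
  refine (norm_sub_le _ _).trans ?_
  rw [norm_smul, Real.norm_of_nonneg (by norm_num : (0 : ℝ) ≤ 2)]
  -- The relative speed and the impulse are each at most `2 * R`, and `2 * R + 2 * (2 * R) = 6 * R`.
  linarith

lemma Hits.norm_scatterMap_lt (hε : 0 < ε) (hR : 0 ≤ R) (hsmall : ε + 8 * R * δ < 1 / 2)
    (hv : ∀ i, ‖(z i).2‖ ≤ R) (h : Hits ε δ B q q' z) {u : ℝ} (hu : 0 ≤ u) (huδ : u ≤ δ) :
    ‖(scatterMap ε (relLift (z q' - z q))).1 + u • (scatterMap ε (relLift (z q' - z q))).2‖ <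
      1 / 2 := by
  obtain ⟨-, -, -, h, hτ⟩ := h
  have h0 := h.impactTime_pos hε
  rw [scatterMap_fst_add]
  refine (norm_add_smul_le (h.norm_impactPoint hε).le (norm_scatterMap_snd_le hε hv h)
    (δ := δ) ?_).trans_lt ?_
  · rw [abs_le]; constructor <;> linarith
  · have : 0 ≤ R * δ := mul_nonneg hR (by linarith)
    linarith

lemma Hits.mem_impactSet (hε : 0 < ε) (hR : 0 ≤ R) (hsmall : ε + 8 * R * δ < 1 / 2)
    (hv : ∀ i, ‖(z i).2‖ ≤ R) (h : Hits ε δ B q q' z) : z q' - z q ∈ impactSet d ε := by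
  refine ⟨h.2.2.2.1, ?_⟩
  have h0 := h.2.2.2.1.impactTime_pos hε
  simpa using h.norm_scatterMap_lt hε hR hsmall hv le_rfl (h0.trans h.2.2.2.2).le

/-- The colliding pair is the only one within `2 * R * δ` of contact, so the other pairs have no
time to meet, and the pair itself separates after its impact. The smallness assumption keeps all
relative displacements below `1/2`, where the torus looks Euclidean. -/
theorem Hits.oneStep (hε : 0 < ε) (hR : 0 ≤ R) (hsmall : ε + 8 * R * δ < 1 / 2)
    (hz : z ∈ regular ε δ R B) (h : Hits ε δ B q q' z) :
    OneStep ε δ B z (freeFlight δ (pairScatter ε q q' z)) := by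
  have hv := norm_le_of_energy hR hz.1
  have hc := h.close hε hv
  have hmem := h.mem_impactSet hε hR hsmall hv
  have hnorm := fun u => h.norm_scatterMap_lt hε hR hsmall hv (u := u)
  obtain ⟨hq, hq', hlt, hi, hτδ⟩ := h
  have h0 := hi.impactTime_pos hε
  have hRδ : 0 ≤ R * δ := mul_nonneg hR (by linarith)
  have hε' : ε < 1 / 2 := by linarith
  have hv' : ∀ i, ‖(pairScatter ε q q' z i).2‖ ≤ R :=
    norm_le_of_energy hR ((energy_pairScatter hε hε' hlt.ne hi).trans_le hz.1)
  have hpost := freeFlight_pairScatter hε hε' hlt.ne hi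
  have hrel := relLift_pairScatter hlt.ne hmem
  set b := relLift (z q' - z q) with hb
  set τ := impactTime ε b with hτ
  set y := freeFlight τ z with hy
  have hy' : freeFlight τ (pairScatter ε q q' z) = scatter q q' y := by
    rw [hpost, sub_self, freeFlight_zero]
  have hvs : ∀ i, ‖(scatter q q' y i).2‖ ≤ R := fun i => by rw [← hy']; exact hv' i
  have hb1 : ‖b.1‖ ≤ ε + 2 * R * δ := by
    have : ‖b.1‖ = torusDist (z q).1 (z q').1 := by rw [hb, relLift_sub]; rfl
    rwa [this]
  have hnb : ∀ u, 0 ≤ u → u ≤ δ → ‖b.1 + u • b.2‖ < 1 / 2 := by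
    intro u hu huδ
    refine (norm_add_smul_le hb1 (norm_relLift_snd_le hv) (δ := δ)
      (by rwa [abs_of_nonneg hu])).trans_lt ?_
    linarith
  -- The margin `2 * R * (δ - u)` left at time `u` is what is needed after the scattering, when by
  -- conservation of energy all speeds are still at most `R`.
  have hfar : ∀ i ∈ B, ∀ j ∈ B, i < j → (i, j) ≠ (q, q') → ∀ u, 0 ≤ u → u ≤ δ →
      ε + 2 * R * (δ - u) < torusDist (freeFlight u z i).1 (freeFlight u z j).1 := by
    intro i hi j hj hij hne u hu huδ
    have h1 := far_of_mem_regular hz hq hq' hlt hc hi hj hij hne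
    have h2 := torusDist_le_freeFlight hu (hv i) (hv j)
    linarith
  have hfar' : ∀ i ∈ B, ∀ j ∈ B, i < j → (i, j) ≠ (q, q') → ∀ u, 0 ≤ u → u ≤ δ →
      ε < torusDist (freeFlight u z i).1 (freeFlight u z j).1 := by
    intro i hi j hj hij hne u hu huδ
    have := hfar i hi j hj hij hne u hu huδ
    have : 0 ≤ R * (δ - u) := mul_nonneg hR (by linarith)
    linarith
  refine Or.inr ⟨τ, q, q', h0, hτδ, ?_, ?_, hpost δ, ?_, ?_⟩
  · intro u hu i hi' j hj hij
    by_cases hne : (i, j) = (q, q')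
    · obtain ⟨rfl, rfl⟩ := Prod.mk.inj hne
      rw [torusDist_freeFlight (hnb u hu.1.le (by linarith [hu.2]))]
      exact hi.lt_norm_before hu.2
    · exact hfar' i hi' j hj hij hne u hu.1.le (by linarith [hu.2])
  · refine ⟨hq, hq', hlt, ?_, fun i hi' j hj hij hne => hfar' i hi' j hj hij hne τ h0.le hτδ.le⟩
    rw [torusDist_freeFlight (hnb τ h0.le hτδ.le)]
    exact hi.norm_impactPoint hε
  · intro u hu i hi' j hj hij
    by_cases hne : (i, j) = (q, q')
    · obtain ⟨rfl, rfl⟩ := Prod.mk.inj hne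
      have h1 : freeFlight u (scatter i j y) = freeFlight (u + τ) (pairScatter ε i j z) := by
        rw [hpost, add_sub_cancel_right]
      have h2 := hnorm (u + τ) (by linarith [hu.1]) (by linarith [hu.2])
      rw [← hrel] at h2
      rw [h1, torusDist_freeFlight h2, hrel]
      exact hi.lt_norm_after hε (by linarith [hu.1])
    · have h1 := hfar i hi' j hj hij hne τ h0.le hτδ.le
      have h2 := torusDist_le_freeFlight hu.1.le (hvs i) (hvs j)
      rw [scatter_fst, scatter_fst] at h2
      have : 0 ≤ R * (δ - τ - u) := mul_nonneg hR (by linarith [hu.2])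
      linarith
  · intro u hu p hp i hi' j hj hij
    rw [freeFlight_add]
    refine hfar' i (Finset.mem_of_mem_erase hi') j (Finset.mem_of_mem_erase hj) hij ?_ (u + τ)
      (by linarith [hu.1]) (by linarith [hu.2])
    intro hne
    obtain ⟨rfl, rfl⟩ := Prod.mk.inj hne
    rcases hp with rfl | rfl
    · exact Finset.notMem_erase _ _ hi'
    · exact Finset.notMem_erase _ _ hj

/-- Without a transversal impact, a contact can only be grazing. The dynamics counts it as a
collision, but its normal relative velocity is zero and scattering is the identity, so the
configuration still moves by free flight. Grazing data therefore need not be excluded. -/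
theorem oneStep_of_not_hits (hε : 0 < ε) (hR : 0 ≤ R) (hδ : 0 < δ)
    (hsmall : ε + 8 * R * δ < 1 / 2)
    (hz : z ∈ regular ε δ R B) (h : ∀ q q', ¬ Hits ε δ B q q' z) :
    OneStep ε δ B z (freeFlight δ z) := by
  by_cases hsep : ∀ u ∈ Set.Ioc 0 δ, Separated ε B (freeFlight u z)
  · exact Or.inl ⟨rfl, hsep⟩
  right
  have hv := norm_le_of_energy hR hz.1
  have hRδ : 0 ≤ R * δ := mul_nonneg hR hδ.le
  simp only [Separated, not_forall, not_lt] at hsep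
  obtain ⟨u₀, hu₀, q, hq, q', hq', hlt, hle⟩ := hsep
  have hc : torusDist (z q).1 (z q').1 ≤ ε + 2 * R * δ := by
    have h1 := torusDist_le_freeFlight hu₀.1.le (hv q) (hv q')
    have : 0 ≤ R * (δ - u₀) := mul_nonneg hR (by linarith [hu₀.2])
    linarith
  have hsq := hz.2.1 q hq q' hq' hlt
  have hnot := h q q'
  set b := relLift (z q' - z q) with hb
  have hbd : ‖b.1‖ = torusDist (z q).1 (z q').1 := by rw [hb, relLift_sub]; rfl
  have hb1 : ‖b.1‖ ≤ ε + 2 * R * δ := by rwa [hbd]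
  rw [← hbd] at hsq
  have hnb : ∀ u, 0 ≤ u → u ≤ δ → ‖b.1 + u • b.2‖ < 1 / 2 := by
    intro u hu huδ
    refine (norm_add_smul_le hb1 (norm_relLift_snd_le hv) (δ := δ)
      (by rwa [abs_of_nonneg hu])).trans_lt ?_
    linarith
  have hfar : ∀ i ∈ B, ∀ j ∈ B, i < j → (i, j) ≠ (q, q') → ∀ u, 0 ≤ u → u ≤ δ →
      ε < torusDist (freeFlight u z i).1 (freeFlight u z j).1 := by
    intro i hi j hj hij hne u hu huδ
    have h1 := far_of_mem_regular hz hq hq' hlt hc hi hj hij hne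
    have h2 := torusDist_le_freeFlight hu (hv i) (hv j)
    have : 0 ≤ R * (δ - u) := mul_nonneg hR (by linarith)
    linarith
  have hle' : ‖b.1 + u₀ • b.2‖ ≤ ε := by
    rwa [torusDist_freeFlight (hnb u₀ hu₀.1.le hu₀.2)] at hle
  -- The last condition in `regular` forbids a contact exactly at the end of the step.
  have hne : u₀ ≠ δ ∨ ‖b.1 + u₀ • b.2‖ ≠ ε := by
    by_contra! hcon
    obtain ⟨rfl, h2⟩ := hcon
    refine hz.2.2.2 q hq q' hq' hlt ?_
    rw [torusDist_freeFlight (hnb u₀ hu₀.1.le hu₀.2), ← hb, h2]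
  have hni : ¬ Impacting ε b := by
    intro hi
    have h1 : δ ≤ impactTime ε b := by
      by_contra! h2
      exact hnot ⟨hq, hq', hlt, hi, h2⟩
    rcases (hu₀.2.trans h1).lt_or_eq with h2 | h2
    · exact (hi.lt_norm_before h2).not_ge hle'
    · rcases hne with h3 | h3
      · exact h3 (le_antisymm hu₀.2 (h2 ▸ h1))
      · exact h3 (h2 ▸ hi.norm_impactPoint hε)
  obtain ⟨hn, hin⟩ := (not_impacting hε hsq hni hu₀.1.le).resolve_left hle'.not_gt
  have hlt₀ : u₀ < δ := hu₀.2.lt_of_ne (hne.resolve_right (not_not.2 hn))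
  have hw : b.2 ≠ 0 := by
    intro h0
    rw [h0, smul_zero, add_zero] at hn
    exact hsq.ne' hn
  -- A line tangent to the sphere leaves the ball in both directions of time.
  have hgraze : ∀ u, u ≠ u₀ → ε < ‖b.1 + u • b.2‖ := by
    intro u hu
    rcases lt_or_gt_of_ne hu with h1 | h1
    · rw [show b.1 + u • b.2 = (b.1 + u₀ • b.2) + (u₀ - u) • (-b.2) by module]
      exact lt_norm_of_inner_nonneg hn (neg_ne_zero.2 hw) (by rw [inner_neg_right, hin, neg_zero])
        (by linarith)
    · rw [show b.1 + u • b.2 = (b.1 + u₀ • b.2) + (u - u₀) • b.2 by module]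
      exact lt_norm_of_inner_nonneg hn hw hin.ge (by linarith)
  have hsc : scatter q q' (freeFlight u₀ z) = freeFlight u₀ z := by
    have hd := disp_freeFlight (hnb u₀ hu₀.1.le hu₀.2)
    rw [← hb] at hd
    have h1 : ∀ c : ℝ, inner ℝ (c • disp (freeFlight u₀ z q).1 (freeFlight u₀ z q').1)
        ((freeFlight u₀ z q).2 - (freeFlight u₀ z q').2) = (0 : ℝ) := by
      intro c
      have : (freeFlight u₀ z q).2 - (freeFlight u₀ z q').2 = -b.2 := by
        rw [hb, relLift_sub]; simp [freeFlight_apply]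
      rw [hd, this, inner_smul_left, inner_neg_right, hin]; simp
    funext a
    simp only [scatter, h1, zero_smul, sub_zero, add_zero]
    split_ifs with h2 h3
    · rw [h2]
    · rw [h3]
    · rfl
  have hsepne : ∀ u, 0 ≤ u → u ≤ δ → u ≠ u₀ → Separated ε B (freeFlight u z) := by
    intro u hu huδ hu' i hi j hj hij
    by_cases h1 : (i, j) = (q, q')
    · obtain ⟨rfl, rfl⟩ := Prod.mk.inj h1
      rw [torusDist_freeFlight (hnb u hu huδ)]
      exact hgraze u hu'
    · exact hfar i hi j hj hij h1 u hu huδ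
  refine ⟨u₀, q, q', hu₀.1, hlt₀, fun u hu => hsepne u hu.1.le (by linarith [hu.2]) hu.2.ne, ?_, ?_,
    ?_, ?_⟩
  · refine ⟨hq, hq', hlt, ?_, fun i hi j hj hij h1 => hfar i hi j hj hij h1 u₀ hu₀.1.le hu₀.2⟩
    rw [torusDist_freeFlight (hnb u₀ hu₀.1.le hu₀.2)]
    exact hn
  · rw [hsc, freeFlight_add, sub_add_cancel]
  · intro u hu
    rw [hsc, freeFlight_add]
    exact hsepne _ (by linarith [hu.1, hu₀.1]) (by linarith [hu.2]) (by linarith [hu.1])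
  · intro u hu p _
    rw [freeFlight_add]
    exact (hsepne _ (by linarith [hu.1, hu₀.1]) (by linarith [hu.2])
      (by linarith [hu.1])).mono (Finset.erase_subset _ _)

end HardSpheres

/-! ### Measure estimates for one time step. -/

namespace HardSpheres

variable {d n : ℕ} {ε δ R : ℝ} {B : Finset (Fin n)} {q q' : Fin n} {z z' : Fin n → Phase d}

/-! ### A time step does not increase the volume -/

lemma measurable_torusDist_apply (i j : Fin n) :
    Measurable fun z : Fin n → Phase d => torusDist (z i).1 (z j).1 := by
  have h : Measurable fun z : Fin n → Phase d => ((z i).1, (z j).1) :=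
    (measurable_pi_apply i).fst.prodMk (measurable_pi_apply j).fst
  have h' := measurable_torusDist (d := d)
  generalize (torusDist : Torus d → Torus d → ℝ) = f at h' ⊢
  exact h'.comp h

lemma measurable_energy : Measurable (energy (d := d) (n := n)) := by
  unfold energy; fun_prop

lemma measurableSet_separated (B : Finset (Fin n)) :
    MeasurableSet {z : Fin n → Phase d | Separated ε B z} := by
  have h := fun i j => measurableSet_lt (measurable_const (a := ε))
    (measurable_torusDist_apply (d := d) (n := n) i j)
  exact measurableSet_setOfPred.2 <| .forall fun i => .imp measurable_const <| .forall fun j =>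
    .imp measurable_const <| .imp measurable_const <| measurableSet_setOfPred.1 (h i j)

lemma measurableSet_regular : MeasurableSet (regular (d := d) ε δ R B) := by
  have h1 := fun i j => measurable_torusDist_apply (d := d) (n := n) i j
  have h2 := fun i j => measurableSet_le (h1 i j) (measurable_const (a := ε + 2 * R * δ))
  refine .inter (measurableSet_le measurable_energy measurable_const) <|
    .inter (measurableSet_separated B) <| .inter (measurableSet_setOfPred.2 ?_) (measurableSet_setOfPred.2 ?_)
  · exact .forall fun i => .imp measurable_const <| .forall fun j => .imp measurable_const <|
      .imp measurable_const <| .forall fun k => .imp measurable_const <| .forall fun l => .imp measurable_const <|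
      .imp measurable_const <| .imp (measurableSet_setOfPred.1 (h2 i j)) <|
      .imp (measurableSet_setOfPred.1 (h2 k l)) measurable_const
  · exact .forall fun i => .imp measurable_const <| .forall fun j => .imp measurable_const <|
      .imp measurable_const <| measurableSet_setOfPred.1
        (measurableSet_eq_fun ((h1 i j).comp (measurePreserving_freeFlight δ).measurable)
          measurable_const).compl

lemma measurableSet_hits (q q' : Fin n) :
    MeasurableSet {z : Fin n → Phase d | Hits ε δ B q q' z} := by
  have h1 : Measurable fun z : Fin n → Phase d => relLift (z q' - z q) :=
    measurable_relLift.comp ((measurable_pi_apply q').sub (measurable_pi_apply q))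
  exact .inter (.const _) <| .inter (.const _) <| .inter (.const _) <|
    .inter (h1 isOpen_impacting.measurableSet)
      (measurableSet_lt (measurable_impactTime.comp h1) measurable_const)

/-- The regular configurations, according to the pair that collides during the time `δ`. -/
def stepSet (ε δ R : ℝ) (B : Finset (Fin n)) : Option (Fin n × Fin n) → Set (Fin n → Phase d)
  | none => regular ε δ R B ∩ {z | ∀ q q', ¬ Hits ε δ B q q' z}
  | some π => regular ε δ R B ∩ {z | Hits ε δ B π.1 π.2 z}

/-- The time step on regular configurations, according to the pair that collides. -/
noncomputable def stepMap (ε δ : ℝ) : Option (Fin n × Fin n) → (Fin n → Phase d) → Fin n → Phase d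
  | none => freeFlight δ
  | some π => freeFlight δ ∘ pairScatter ε π.1 π.2

lemma measurableSet_stepSet (π : Option (Fin n × Fin n)) :
    MeasurableSet (stepSet (d := d) ε δ R B π) := by
  cases π with
  | none =>
    refine measurableSet_regular.inter ?_
    exact measurableSet_setOfPred.2 <| .forall fun q => .forall fun q' =>
      measurableSet_setOfPred.1 (measurableSet_hits q q').compl
  | some π => exact measurableSet_regular.inter (measurableSet_hits π.1 π.2)

lemma measurable_stepMap (π : Option (Fin n × Fin n)) :
    Measurable (stepMap (d := d) ε δ π) := by
  cases π with
  | none => exact (measurePreserving_freeFlight δ).measurable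
  | some π => exact (measurePreserving_freeFlight δ).measurable.comp measurable_pairScatter

lemma oneStep_stepMap (hε : 0 < ε) (hR : 0 ≤ R) (hδ : 0 < δ) (hsmall : ε + 8 * R * δ < 1 / 2)
    {π : Option (Fin n × Fin n)} (hz : z ∈ stepSet ε δ R B π) :
    OneStep ε δ B z (stepMap ε δ π z) := by
  cases π with
  | none => exact oneStep_of_not_hits hε hR hδ hsmall hz.1 hz.2
  | some π => exact Hits.oneStep hε hR hsmall hz.1 hz.2

lemma stepSet_unique (hε : 0 < ε) (hR : 0 ≤ R) {π ρ : Option (Fin n × Fin n)}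
    (hπ : z ∈ stepSet ε δ R B π) (hρ : z ∈ stepSet ε δ R B ρ) : π = ρ := by
  cases π with
  | none =>
    cases ρ with
    | none => rfl
    | some ρ => exact (hπ.2 _ _ hρ.2).elim
  | some π =>
    cases ρ with
    | none => exact (hρ.2 _ _ hπ.2).elim
    | some ρ =>
      obtain ⟨hz, h1⟩ := hπ
      obtain ⟨-, h2⟩ := hρ
      have hv := norm_le_of_energy hR hz.1
      exact congrArg some (hz.2.2.1 _ h1.1 _ h1.2.1 h1.2.2.1 _ h2.1 _ h2.2.1 h2.2.2.1
        (h1.close hε hv) (h2.close hε hv))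

lemma exists_mem_stepSet (hz : z ∈ regular ε δ R B) : ∃ π, z ∈ stepSet ε δ R B π := by
  by_cases h : ∃ q q', Hits ε δ B q q' z
  · obtain ⟨q, q', h⟩ := h
    exact ⟨some (q, q'), hz, h⟩
  · exact ⟨none, hz, by simpa using h⟩

lemma volume_stepSet_inter_le (hε : 0 < ε) (hR : 0 ≤ R) (hsmall : ε + 8 * R * δ < 1 / 2)
    (π : Option (Fin n × Fin n)) {Q : Set (Fin n → Phase d)} (hQ : MeasurableSet Q) :
    volume (stepSet ε δ R B π ∩ stepMap ε δ π ⁻¹' Q) ≤ volume Q := by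
  cases π with
  | none =>
    exact (measure_mono Set.inter_subset_right).trans_eq
      ((measurePreserving_freeFlight δ).measure_preimage hQ.nullMeasurableSet)
  | some π =>
    by_cases hne : π.1 = π.2
    · have : stepSet (d := d) ε δ R B (some π) = ∅ :=
        Set.eq_empty_of_forall_notMem fun z hz => hz.2.2.2.1.ne hne
      simp [this]
    · refine le_trans (measure_mono ?_) ((volume_pairScatter_le hε hne
        ((measurePreserving_freeFlight δ).measurable hQ)).trans_eq
        ((measurePreserving_freeFlight δ).measure_preimage hQ.nullMeasurableSet))
      rintro z ⟨hz, hzQ⟩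
      exact ⟨hz.2.mem_impactSet hε hR hsmall (norm_le_of_energy hR hz.1.1), hzQ⟩

/-- The regular set is split according to the colliding pair. Each piece satisfies the volume bound
separately, and the images of the pieces are disjoint since a step is reversible, so the bounds add
up to one copy of the volume of `U`. -/
theorem volume_step_le (hε : 0 < ε) (hR : 0 ≤ R) (hδ : 0 < δ) (hsmall : ε + 8 * R * δ < 1 / 2)
    (U : Set (Fin n → Phase d)) :
    volume {z | z ∈ regular ε δ R B ∧ ∀ z', OneStep ε δ B z z' → z' ∈ U} ≤ volume U := by
  -- `U` need not be measurable, so it is replaced by a measurable hull of the same volume.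
  set V := toMeasurable volume U with hV
  have hVm : MeasurableSet V := measurableSet_toMeasurable _ _
  have hstep := fun {z : Fin n → Phase d} π =>
    oneStep_stepMap (B := B) hε hR hδ hsmall (z := z) (π := π)
  set F : Option (Fin n × Fin n) → Set (Fin n → Phase d) := fun π =>
    stepMap ε δ π '' stepSet ε δ R B π with hF
  -- Injective measurable images of measurable sets are measurable in a standard Borel space.
  have hFm : ∀ π, MeasurableSet (F π) := fun π =>
    (measurableSet_stepSet π).image_of_measurable_injOn (measurable_stepMap π) fun z hz w hw he =>
      (hstep π hz).injective hε (he ▸ hstep π hw)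
  have hdisj : Pairwise (Function.onFun Disjoint fun π => F π ∩ V) := by
    intro π ρ hne
    refine Set.disjoint_left.2 ?_
    rintro _ ⟨⟨z, hz, rfl⟩, -⟩ ⟨⟨w, hw, he⟩, -⟩
    have := (hstep π hz).injective hε (he ▸ hstep ρ hw)
    subst this
    exact hne (stepSet_unique hε hR hz hw)
  calc volume {z | z ∈ regular ε δ R B ∧ ∀ z', OneStep ε δ B z z' → z' ∈ U}
      ≤ volume (⋃ π, stepSet ε δ R B π ∩ stepMap ε δ π ⁻¹' (F π ∩ V)) := by
        refine measure_mono fun z hz => ?_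
        obtain ⟨π, hπ⟩ := exists_mem_stepSet hz.1
        exact Set.mem_iUnion.2 ⟨π, hπ, ⟨z, hπ, rfl⟩, subset_toMeasurable _ _ (hz.2 _ (hstep π hπ))⟩
    _ ≤ ∑ π, volume (stepSet ε δ R B π ∩ stepMap ε δ π ⁻¹' (F π ∩ V)) :=
        measure_iUnion_fintype_le _ _
    _ ≤ ∑ π, volume (F π ∩ V) := Finset.sum_le_sum fun π _ =>
        volume_stepSet_inter_le hε hR hsmall π ((hFm π).inter hVm)
    _ = volume (⋃ π, F π ∩ V) := by
        rw [measure_iUnion hdisj fun π => (hFm π).inter hVm, tsum_fintype]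
    _ ≤ volume V := measure_mono (Set.iUnion_subset fun π => Set.inter_subset_right)
    _ = volume U := measure_toMeasurable U

/-! ### Irregular configurations -/

/-- The positions whose distance from the origin belongs to `I`. -/
def shell (d : ℕ) (I : Set ℝ) : Set (Torus d) := {x | torusDist 0 x ∈ I}

lemma measurableSet_shell {I : Set ℝ} (hI : MeasurableSet I) : MeasurableSet (shell d I) :=
  measurable_torusDist.comp (measurable_const.prodMk measurable_id) hI

lemma torusDist_eq_zero_sub (x y : Torus d) : torusDist x y = torusDist 0 (y - x) := by
  simp [torusDist, disp]

lemma volume_shell_le {I : Set ℝ} (hI : MeasurableSet I) :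
    volume (shell d I) ≤ volume {v : EuclideanSpace ℝ (Fin d) | ‖v‖ ∈ I} := by
  have hm := measurePreserving_toTorus.measurable (measurableSet_shell (d := d) hI)
  rw [← measurePreserving_toTorus.measure_preimage (measurableSet_shell hI).nullMeasurableSet,
    Measure.restrict_apply hm]
  refine measure_mono ?_
  rintro v ⟨hv, hc⟩
  have h1 : disp 0 (toTorus v) = v := disp_eq_of_mem (by simp) hc
  rwa [Set.mem_preimage, shell, Set.mem_ofPred_eq, torusDist, h1] at hv

lemma volume_shell_singleton (hε : ε ≠ 0) : volume (shell d {ε}) = 0 := by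
  refine le_antisymm ((volume_shell_le (measurableSet_singleton ε)).trans_eq ?_) zero_le
  rw [← Measure.addHaar_sphere_of_ne_zero volume (0 : EuclideanSpace ℝ (Fin d)) hε]
  congr 1
  ext v
  simp

/-- A difference of two balls, with `(ε + x) ^ d - ε ^ d ≤ d * x` because `ε + x ≤ 1`. -/
lemma exists_volume_shell_le (d : ℕ) : ∃ C : ENNReal, C ≠ ⊤ ∧ ∀ ε x : ℝ, 0 ≤ ε → 0 ≤ x →
    ε + x ≤ 1 → volume (shell d (Set.Ioc ε (ε + x))) ≤ C * ENNReal.ofReal x := by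
  refine ⟨ENNReal.ofReal d * volume (Metric.ball (0 : EuclideanSpace ℝ (Fin d)) 1),
    ENNReal.mul_ne_top ENNReal.ofReal_ne_top measure_ball_lt_top.ne, fun ε x hε hx h1 => ?_⟩
  refine (volume_shell_le measurableSet_Ioc).trans ?_
  have h2 : {v : EuclideanSpace ℝ (Fin d) | ‖v‖ ∈ Set.Ioc ε (ε + x)} =
      Metric.closedBall 0 (ε + x) \ Metric.closedBall 0 ε := by
    ext v
    simp [and_comm]
  rw [h2, measure_sdiff (Metric.closedBall_subset_closedBall (by linarith))
    Metric.isClosed_closedBall.nullMeasurableSet measure_closedBall_lt_top.ne,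
    Measure.addHaar_closedBall _ _ (by positivity), Measure.addHaar_closedBall _ _ hε,
    ← ENNReal.sub_mul fun _ _ => measure_ball_lt_top.ne, ← ENNReal.ofReal_sub _ (by positivity),
    mul_right_comm, ← ENNReal.ofReal_mul (by positivity), finrank_euclideanSpace_fin]
  gcongr
  have h3 := (le_abs_self _).trans (abs_pow_sub_pow_le (ε + x) ε d)
  rw [add_sub_cancel_left, abs_of_nonneg hx, abs_of_nonneg hε, abs_of_nonneg (by positivity),
    max_eq_left (by linarith), mul_comm x] at h3
  exact h3.trans (mul_le_of_le_one_right (by positivity) (pow_le_one₀ (by positivity) h1))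

/-- Particles `b` and `e` are replaced by their states relative to `a` and `c`, which makes the two
conditions independent. The pairs may share a particle: `b` is outside the pair `c, e`, and it is
replaced before `e` is changed. The radius `2 * R` bounds absolute and relative velocities alike. -/
lemma volume_two_pairs_le {S : Set (Torus d)} (hS : MeasurableSet S) {a b c e : Fin n}
    (hab : a ≠ b) (hce : c ≠ e) (hbc : b ≠ c) (hbe : b ≠ e) :
    volume {z : Fin n → Phase d | (∀ i, ‖(z i).2‖ ≤ R) ∧ (z b - z a).1 ∈ S ∧ (z e - z c).1 ∈ S} ≤
      volume S ^ 2 * volume (Metric.closedBall (0 : EuclideanSpace ℝ (Fin d)) (2 * R)) ^ n := by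
  set f : (Fin n → Phase d) → (Fin n → Phase d) := fun z => Function.update z b (z b + -z a) with hf
  set g : (Fin n → Phase d) → (Fin n → Phase d) := fun z => Function.update z e (z e + -z c) with hg
  have hfm : MeasurePreserving f := measurePreserving_update_add b (measurable_pi_apply a).neg
    fun z x => by simp [hab]
  have hgm : MeasurePreserving g := measurePreserving_update_add e (measurable_pi_apply c).neg
    fun z x => by simp [hce]
  set V := Metric.closedBall (0 : EuclideanSpace ℝ (Fin d)) (2 * R) with hV
  set P : Fin n → Set (Phase d) := fun k => (if k = b ∨ k = e then S else Set.univ) ×ˢ V with hP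
  have hPm : MeasurableSet (Set.univ.pi P) := MeasurableSet.univ_pi fun k =>
    MeasurableSet.prod (by split_ifs; exacts [hS, .univ]) Metric.isClosed_closedBall.measurableSet
  have hvol : volume (Set.univ.pi P) = volume S ^ 2 * volume V ^ n := by
    have h1 : ∀ k, volume (P k) = (if k = b ∨ k = e then volume S else 1) * volume V := by
      intro k
      rw [hP, Measure.volume_eq_prod, Measure.prod_prod]
      split_ifs
      · rfl
      · rw [volume_pi, Measure.pi_univ]
        simp
    rw [volume_pi, Measure.pi_pi, Finset.prod_congr rfl fun k _ => h1 k, Finset.prod_mul_distrib,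
      Finset.prod_const, Finset.card_univ, Fintype.card_fin, Finset.prod_ite, Finset.prod_const_one,
      mul_one, Finset.prod_const]
    congr 2
    have : Finset.univ.filter (fun k => k = b ∨ k = e) = {b, e} := by ext; simp
    rw [this, Finset.card_pair hbe]
  rw [← hvol, ← hgm.measure_preimage hPm.nullMeasurableSet,
    ← hfm.measure_preimage (hgm.measurable hPm).nullMeasurableSet]
  refine measure_mono ?_
  rintro z ⟨hv, h1, h2⟩
  have hR : 0 ≤ R := (norm_nonneg _).trans (hv a)
  have hsub : ∀ i j, ‖(z i + -z j).2‖ ≤ 2 * R := fun i j => by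
    rw [← sub_eq_add_neg]
    exact (norm_sub_le _ _).trans (by linarith [hv i, hv j])
  refine Set.mem_univ_pi.2 fun k => ?_
  by_cases hke : k = e
  · subst hke
    refine ⟨?_, ?_⟩
    · simpa [hf, hg, hbe.symm, hbc.symm, sub_eq_add_neg] using h2
    · simpa [hf, hg, hbe.symm, hbc.symm, hV] using hsub k c
  · by_cases hkb : k = b
    · subst hkb
      refine ⟨?_, ?_⟩
      · simpa [hf, hg, hke, sub_eq_add_neg] using h1
      · simpa [hf, hg, hke, hV] using hsub k a
    · refine ⟨by simp [hke, hkb], ?_⟩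
      have := hv k
      simp only [hf, hg, Function.update_of_ne hke, Function.update_of_ne hkb, hV,
        mem_closedBall_zero_iff]
      linarith

lemma volume_contact (hε : ε ≠ 0) {i j : Fin n} (hij : i ≠ j) :
    volume {z : Fin n → Phase d | torusDist (z i).1 (z j).1 = ε} = 0 := by
  have hm : MeasurePreserving (fun z : Fin n → Phase d => Function.update z j (z j + -z i)) :=
    measurePreserving_update_add j (measurable_pi_apply i).neg fun z x => by simp [hij]
  have h2 : Measure.QuasiMeasurePreserving (fun z : Fin n → Phase d => (z j).1) volume volume :=
    Measure.quasiMeasurePreserving_fst.comp (Measure.quasiMeasurePreserving_eval _ j)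
  have h3 := (h2.comp hm.quasiMeasurePreserving).preimage_null (volume_shell_singleton (d := d) hε)
  refine measure_mono_null (fun z hz => ?_) h3
  rw [Set.mem_ofPred_eq, torusDist_eq_zero_sub] at hz
  simpa [shell, sub_eq_add_neg] using hz

/-- Two different pairs must both lie in a shell of width `2 * R * δ`, at the cost of one factor `δ`
each. The quadratic order is essential, as the bound is summed over about `1 / δ` steps. -/
theorem exists_volume_irregular_le (hε : 0 < ε) (hε' : ε < 1 / 2) (hR : 0 ≤ R)
    (B : Finset (Fin n)) : ∃ C : ENNReal, C ≠ ⊤ ∧ ∀ δ : ℝ, 0 < δ → 2 * R * δ ≤ 1 / 2 →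
      volume ({z : Fin n → Phase d | energy z ≤ R ^ 2 ∧ Separated ε B z} \ regular ε δ R B) ≤
        C * ENNReal.ofReal (δ ^ 2) := by
  obtain ⟨C, hC, hshell⟩ := exists_volume_shell_le d
  set V := volume (Metric.closedBall (0 : EuclideanSpace ℝ (Fin d)) (2 * R)) with hV
  have hVt : V ≠ ⊤ := measure_closedBall_lt_top.ne
  set K : ENNReal := (C * ENNReal.ofReal (2 * R)) ^ 2 * V ^ n with hK
  have hKt : K ≠ ⊤ := ENNReal.mul_ne_top
    (ENNReal.pow_ne_top (ENNReal.mul_ne_top hC ENNReal.ofReal_ne_top)) (ENNReal.pow_ne_top hVt)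
  refine ⟨Fintype.card (Fin n × Fin n × Fin n × Fin n) * K,
    ENNReal.mul_ne_top (ENNReal.natCast_ne_top _) hKt, fun δ hδ hsmall => ?_⟩
  set S := shell d (Set.Ioc ε (ε + 2 * R * δ)) with hS
  have hSm : MeasurableSet S := measurableSet_shell measurableSet_Ioc
  have hSv : volume S ^ 2 * V ^ n ≤ K * ENNReal.ofReal (δ ^ 2) := by
    have h1 := hshell ε (2 * R * δ) hε.le (by positivity) (by linarith)
    calc volume S ^ 2 * V ^ n ≤ (C * ENNReal.ofReal (2 * R * δ)) ^ 2 * V ^ n := by gcongr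
      _ = K * ENNReal.ofReal (δ ^ 2) := by
        rw [ENNReal.ofReal_mul (by positivity), ENNReal.ofReal_pow hδ.le, hK]; ring
  set bad : Fin n × Fin n × Fin n × Fin n → Set (Fin n → Phase d) := fun x =>
    {z | x.1 ≠ x.2.1 ∧ x.2.2.1 ≠ x.2.2.2 ∧ x.2.1 ≠ x.2.2.1 ∧ x.2.1 ≠ x.2.2.2 ∧
      (∀ i, ‖(z i).2‖ ≤ R) ∧ (z x.2.1 - z x.1).1 ∈ S ∧ (z x.2.2.2 - z x.2.2.1).1 ∈ S} with hbad
  set touch : Set (Fin n → Phase d) := ⋃ i, ⋃ j, ⋃ _ : i < j,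
    freeFlight δ ⁻¹' {z | torusDist (z i).1 (z j).1 = ε} with htouch
  have htouch0 : volume touch = 0 := by
    refine measure_iUnion_null fun i => measure_iUnion_null fun j => measure_iUnion_null fun hij => ?_
    exact (measurePreserving_freeFlight δ).quasiMeasurePreserving.preimage_null
      (volume_contact hε.ne' hij.ne)
  have hbadv : ∀ x, volume (bad x) ≤ K * ENNReal.ofReal (δ ^ 2) := by
    intro x
    by_cases h : x.1 ≠ x.2.1 ∧ x.2.2.1 ≠ x.2.2.2 ∧ x.2.1 ≠ x.2.2.1 ∧ x.2.1 ≠ x.2.2.2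
    · refine (measure_mono fun z hz => ?_).trans
        ((volume_two_pairs_le (R := R) hSm h.1 h.2.1 h.2.2.1 h.2.2.2).trans hSv)
      exact hz.2.2.2.2
    · have : bad x = ∅ := Set.eq_empty_of_forall_notMem fun z hz =>
        h ⟨hz.1, hz.2.1, hz.2.2.1, hz.2.2.2.1⟩
      simp [this]
  have hsub : {z : Fin n → Phase d | energy z ≤ R ^ 2 ∧ Separated ε B z} \ regular ε δ R B ⊆
      (⋃ x, bad x) ∪ touch := by
    rintro z ⟨⟨hz1, hz2⟩, hz3⟩
    by_contra hcon
    simp only [Set.mem_union, not_or, htouch, Set.mem_iUnion, not_exists] at hcon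
    obtain ⟨hc1, hc2⟩ := hcon
    refine hz3 ⟨hz1, hz2, ?_, fun i _ j _ hij he => hc2 i j hij he⟩
    intro i hi j hj hij k hk l hl hkl h1 h2
    by_contra hne
    have hv := norm_le_of_energy hR hz1
    have hmem : ∀ a ∈ B, ∀ b ∈ B, a ≠ b → torusDist (z a).1 (z b).1 ≤ ε + 2 * R * δ →
        (z b - z a).1 ∈ S := by
      intro a ha b hb hab h
      have h3 := hz2.of_ne ha hb hab
      rw [torusDist_eq_zero_sub] at h h3
      exact ⟨h3, h⟩
    have h1' := h1
    rw [torusDist_comm] at h1'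
    -- One particle of the first pair lies outside the second, as `volume_two_pairs_le` requires: if
    -- it is not `j`, it is `i`, because the pairs are ordered and different.
    by_cases hj' : j ≠ k ∧ j ≠ l
    · exact hc1 (i, j, k, l) ⟨hij.ne, hkl.ne, hj'.1, hj'.2, hv, hmem i hi j hj hij.ne h1,
        hmem k hk l hl hkl.ne h2⟩
    · refine hc1 (j, i, k, l) ⟨hij.ne', hkl.ne, ?_, ?_, hv, hmem j hj i hi hij.ne' h1',
        hmem k hk l hl hkl.ne h2⟩
      · intro (h : i = k)
        subst h
        have : j = l := by
          by_contra h
          exact hj' ⟨hij.ne', h⟩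
        exact hne (by rw [this])
      · intro (h : i = l)
        subst h
        exact hj' ⟨(hkl.trans hij).ne', hij.ne'⟩
  calc _ ≤ volume ((⋃ x, bad x) ∪ touch) := measure_mono hsub
    _ ≤ volume (⋃ x, bad x) + volume touch := measure_union_le _ _
    _ ≤ ∑ x, volume (bad x) := by
      rw [htouch0, add_zero]
      exact measure_iUnion_fintype_le _ _
    _ ≤ ∑ _x : Fin n × Fin n × Fin n × Fin n, K * ENNReal.ofReal (δ ^ 2) :=
      Finset.sum_le_sum fun x _ => hbadv x
    _ = _ := by rw [Finset.sum_const, Finset.card_univ, nsmul_eq_mul, mul_assoc _ K]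

end HardSpheres

/-! ### Iteration of the time steps and induction on the set of particles. -/

namespace HardSpheres

variable {d n : ℕ} {ε δ R : ℝ} {B : Finset (Fin n)} {q q' : Fin n} {z z' : Fin n → Phase d}

/-! ### Almost all configurations are tame -/

lemma Tame.zero (A : Finset (Fin n)) (z : Fin n → Phase d) : Tame ε A z 0 :=
  .free A z 0 le_rfl fun _ hu => absurd hu.1 hu.2.not_gt

/-- The configurations of bounded energy that are not tame. -/
def wild (ε R : ℝ) (B : Finset (Fin n)) (s : ℝ) : Set (Fin n → Phase d) :=
  {z | energy z ≤ R ^ 2 ∧ Separated ε B z ∧ ¬ Tame ε B z s}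

/-- A wild datum is irregular, or its step ends in a wild datum, or a branch that removes a particle
fails later. Such a branch ends the step at `z'` or at `freeFlight δ z`, according to whether the
other particle scatters, so the null set `M` has to be avoided at both points. -/
lemma volume_wild_add_le (hε : 0 < ε) (hR : 0 ≤ R) (hδ : 0 < δ) (hsmall : ε + 8 * R * δ < 1 / 2)
    {s : ℝ} (hs : ∀ p ∈ B, volume {z : Fin n → Phase d |
      Separated ε (B.erase p) z ∧ ¬ Tame ε (B.erase p) z s} = 0) :
    volume (wild (d := d) ε R B (s + δ)) ≤
      volume ({z : Fin n → Phase d | energy z ≤ R ^ 2 ∧ Separated ε B z} \ regular ε δ R B) +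
        volume (wild (d := d) ε R B s) := by
  set M : Set (Fin n → Phase d) := ⋃ p ∈ B,
    {z | Separated ε (B.erase p) z ∧ ¬ Tame ε (B.erase p) z s} with hM
  have hM0 : volume M = 0 := (measure_biUnion_null_iff B.countable_toSet).2 hs
  have hM1 : volume (freeFlight δ ⁻¹' M) = 0 :=
    (measurePreserving_freeFlight δ).quasiMeasurePreserving.preimage_null hM0
  have hnM : ∀ {y}, y ∉ M → ∀ p ∈ B, Separated ε (B.erase p) y → Tame ε (B.erase p) y s := by
    intro y hy p hp hsep
    by_contra h
    exact hy (Set.mem_biUnion hp ⟨hsep, h⟩)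
  have hsub : wild ε R B (s + δ) ⊆
      (({z : Fin n → Phase d | energy z ≤ R ^ 2 ∧ Separated ε B z} \ regular ε δ R B) ∪
        freeFlight δ ⁻¹' M) ∪
      {z | z ∈ regular ε δ R B ∧ ∀ z', OneStep ε δ B z z' → z' ∈ wild ε R B s ∪ M} := by
    rintro z ⟨h1, h2, h3⟩
    by_contra hcon
    simp only [Set.mem_union, not_or] at hcon
    obtain ⟨⟨hc1, hc2⟩, hc3⟩ := hcon
    have hreg : z ∈ regular ε δ R B := by
      by_contra h
      exact hc1 ⟨⟨h1, h2⟩, h⟩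
    refine hc3 ⟨hreg, fun z' hz' => ?_⟩
    by_contra hcon
    simp only [not_or] at hcon
    have hsep := hz'.separated hδ
    refine h3 (hz'.tame hδ.le ?_ (fun p hp => hnM hcon.2 p hp (hsep.mono (Finset.erase_subset _ _)))
      (hnM hc2))
    by_contra h
    exact hcon.1 ⟨(hz'.energy_eq hε).trans_le h1, hsep, h⟩
  refine (measure_mono hsub).trans ((measure_union_le _ _).trans ?_)
  refine add_le_add ((measure_union_le _ _).trans_eq (by rw [hM1, add_zero])) ?_
  exact (volume_step_le hε hR hδ hsmall _).trans
    ((measure_union_le _ _).trans_eq (by rw [hM0, add_zero]))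

/-- With `k` steps of length `t / k`, the accumulated loss is at most `k * C * (t / k) ^ 2 = C * t ^
2 / k`, and `k` is arbitrarily large. -/
lemma volume_wild (hε : 0 < ε) (hε' : ε < 1 / 2) (hR : 0 ≤ R) {t : ℝ} (ht : 0 < t)
    (h : ∀ s, 0 ≤ s → ∀ p ∈ B, volume {z : Fin n → Phase d |
      Separated ε (B.erase p) z ∧ ¬ Tame ε (B.erase p) z s} = 0) :
    volume (wild (d := d) ε R B t) = 0 := by
  obtain ⟨C, hC, hirr⟩ := exists_volume_irregular_le (d := d) hε hε' hR B
  have hev : ∀ᶠ k : ℕ in Filter.atTop, 8 * R * t < (1 / 2 - ε) * k := by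
    have : Filter.Tendsto (fun k : ℕ => (1 / 2 - ε) * (k : ℝ)) Filter.atTop Filter.atTop :=
      tendsto_natCast_atTop_atTop.const_mul_atTop (by linarith)
    exact this.eventually_gt_atTop _
  have hbound : ∀ᶠ k : ℕ in Filter.atTop,
      volume (wild (d := d) ε R B t) ≤ C * ENNReal.ofReal (t ^ 2 / k) := by
    filter_upwards [hev, Filter.eventually_gt_atTop 0] with k hk hk0
    have hk0' : (0 : ℝ) < k := Nat.cast_pos.2 hk0
    set δ := t / k with hδ
    have hδ0 : 0 < δ := by positivity
    have hRδ : 8 * R * δ < 1 / 2 - ε := by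
      rw [hδ, mul_div_assoc', div_lt_iff₀ hk0']; exact hk
    have hRδ0 : 0 ≤ R * δ := by positivity
    have hstep : ∀ l : ℕ, volume (wild (d := d) ε R B (l * δ)) ≤
        l * (C * ENNReal.ofReal (δ ^ 2)) := by
      intro l
      induction l with
      | zero =>
        have : wild (d := d) ε R B 0 = ∅ :=
          Set.eq_empty_of_forall_notMem fun z hz => hz.2.2 (Tame.zero B z)
        simp [this]
      | succ l ih =>
        rw [Nat.cast_succ, add_one_mul, Nat.cast_succ, add_one_mul, add_comm (_ * _) (C * _)]
        refine (volume_wild_add_le hε hR hδ0 (by linarith) (h _ (by positivity))).trans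
          (add_le_add (hirr δ hδ0 (by linarith)) ih)
    have h1 := hstep k
    rw [hδ, mul_div_cancel₀ _ hk0'.ne', ← hδ] at h1
    refine h1.trans_eq ?_
    rw [mul_left_comm, ← ENNReal.ofReal_natCast, ← ENNReal.ofReal_mul (by positivity), hδ]
    congr 2
    field_simp
  have hlim : Filter.Tendsto (fun k : ℕ => C * ENNReal.ofReal (t ^ 2 / k)) Filter.atTop
      (nhds 0) := by
    have h1 := ENNReal.tendsto_ofReal (tendsto_const_div_atTop_nhds_zero_nat (t ^ 2))
    have h2 := ENNReal.Tendsto.const_mul (a := C) h1 (Or.inr hC)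
    simpa using h2
  exact le_antisymm (ge_of_tendsto hlim hbound) zero_le

/-- Alexander's theorem, for all subsystems and all trajectories with removals. -/
theorem volume_not_tame (hε : 0 < ε) (hε' : ε < 1 / 2) (B : Finset (Fin n)) {t : ℝ} (ht : 0 ≤ t) :
    volume {z : Fin n → Phase d | Separated ε B z ∧ ¬ Tame ε B z t} = 0 := by
  induction B using Finset.strongInduction generalizing t with
  | H B ih =>
    rcases ht.eq_or_lt with rfl | ht
    · have : {z : Fin n → Phase d | Separated ε B z ∧ ¬ Tame ε B z 0} = ∅ :=
        Set.eq_empty_of_forall_notMem fun z hz => hz.2 (Tame.zero B z)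
      simp [this]
    · have h1 : ∀ R : ℕ, volume (wild (d := d) ε R B t) = 0 := fun R =>
        volume_wild hε hε' (Nat.cast_nonneg R) ht fun s hs p hp =>
          ih _ (Finset.erase_ssubset hp) hs
      refine measure_mono_null (fun z hz => ?_) (measure_iUnion_null h1)
      -- The summand `1` ensures `1 ≤ R`, hence `energy z ≤ R ≤ R ^ 2`.
      obtain ⟨R, hR⟩ := exists_nat_ge (energy z + 1)
      have h0 : 0 ≤ energy z := Finset.sum_nonneg fun i _ => sq_nonneg _
      exact Set.mem_iUnion.2 ⟨R, by nlinarith, hz.1, hz.2⟩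

theorem ae_allTame (hε : 0 < ε) (hε' : ε < 1 / 2) {t : ℝ} (ht : 0 ≤ t) :
    ∀ᵐ z : Fin n → Phase d ∂(volume.restrict (domain d ε n)), AllTame ε t z := by
  have hdom : domain d ε n = {z | Separated ε Finset.univ z} := by
    ext z
    simp [domain, Separated]
  rw [hdom, ae_restrict_iff' (measurableSet_separated _)]
  have h1 : ∀ᵐ z : Fin n → Phase d, ∀ B, ¬ (Separated ε B z ∧ ¬ Tame ε B z t) :=
    ae_all_iff.2 fun B => measure_eq_zero_iff_ae_notMem.1 (volume_not_tame hε hε' B ht)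
  filter_upwards [h1] with z hz hsep
  exact ⟨hsep, fun B => by_contra fun h => hz B ⟨hsep.mono (Finset.subset_univ B), h⟩⟩

end HardSpheres

theorem mainTheorem4 (d : ℕ) (hd : 3 ≤ d) (ε : ℝ) (hε : 0 < ε) (hε' : ε < 1 / 2)
    (t : ℝ) (ht : 0 < t) (m : ℕ) (h : (Fin m → HardSpheres.Phase d) → ℝ)
    (hh : MemLp h ⊤ volume) (N : ℕ) :
    -- for almost all initial data, the dynamics and all pseudotrajectories exist up to time `t`,
    -- and all sums over pseudotrajectory parameters are finite sums
    (∀ᵐ Z : Fin N → HardSpheres.Phase d ∂(volume.restrict (HardSpheres.domain d ε N)),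
      (∃ Z', HardSpheres.HardSphereEvolves ε Z t Z') ∧
      ∀ (r : ℕ) (j : Fin (m + r) ↪ Fin N),
        (∀ p : HardSpheres.Params r (m + r), ∃ S,
          HardSpheres.PseudoEvolves ε p.1 (HardSpheres.initState p.2 fun k => Z (j k)) t S) ∧
        {p : HardSpheres.Params r (m + r) |
          (fun k => Z (j k)) ∈ HardSpheres.admissible m r ε t p}.Finite) ∧
    -- the development for a fixed family of particles
    (∀ i : Fin m ↪ Fin N,
      ∀ᵐ Z : Fin N → HardSpheres.Phase d ∂(volume.restrict (HardSpheres.domain d ε N)),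
        HasSum
          (fun r : ℕ => ∑ j ∈ HardSpheres.extensions i r,
            HardSpheres.development m r ε t h fun k => Z (j k))
          (h fun k => HardSpheres.flow ε t Z (i k))) ∧
    -- the development after summation over all families of particles
    (∀ᵐ Z : Fin N → HardSpheres.Phase d ∂(volume.restrict (HardSpheres.domain d ε N)),
      HasSum
        (fun r : ℕ => ∑ j : Fin (m + r) ↪ Fin N,
          HardSpheres.development m r ε t h fun k => Z (j k))
        (∑ i : Fin m ↪ Fin N, h fun k => HardSpheres.flow ε t Z (i k))) := by
  refine ⟨?_, fun i => ?_, ?_⟩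
  · filter_upwards [HardSpheres.ae_allTame hε hε' ht.le] with Z hZ using hZ.existence hε' m
  · filter_upwards [HardSpheres.ae_allTame hε hε' ht.le] with Z hZ using
      hZ.hasSum_extensions hε' h i
  · filter_upwards [HardSpheres.ae_allTame hε hε' ht.le] with Z hZ using hZ.hasSum hε' h
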